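/- Let $k$ be a positive even integer. For $a\in(1,\infty)$ let \[ \overline M=\Bigl\{(z,w)\in(\mathbb C\cup\{\infty\})^2 \;:\; w^{k+1}=z^2\Bigl(\frac{z-1}{z-a}\Bigr)^k\Bigr\},\qquad M=\overline M\setminus\{(0,0),(\infty,\infty)\}, \] regarded as Riemann surfaces, and on $M$ let \[ g=c\,w\quad\bigl(c=a^{(k-2)/(2k+2)}\bigr),\qquad \eta=\frac{dz}{zw},\qquad \Phi=\bigl((1-g^2)\eta,\; i(1+g^2)\eta,\; 2g\eta\bigr). \] Then there exists a unique constant $a\in(1,\infty)$ for which the period condition \[ \operatorname{Re}\oint_\ell\Phi=\mathbf 0\in\mathbb R^3\quad\text{for every (piecewise $C^1$) loop $\ell$ in $M$} \] holds. Moreover, for each $a\in(1,\infty)$ the period condition holds if and only if $f=\operatorname{Re}\int_{z_0}^{z}\Phi : M\to\mathbb R^3$ is well defined (independent of the piecewise $C^1$ path from $z_0$ to $z$ in $M$) for every base point $z_0\in M$; thus there is a unique $a\in(1,\infty)$ for which $f$ is well defined on $M$. -/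

import Mathlib

open Set MeasureTheory
open scoped Interval

noncomputable section

namespace EvenGenus

/-- The affine coordinate on the Riemann sphere `ℂ ∪ {∞}`, with the value `0` at `∞`. -/
def toC (x : OnePoint ℂ) : ℂ := OnePoint.elim x 0 id

/-- The compact Riemann surface `w ^ (k + 1) = z ^ 2 * ((z - 1) / (z - a)) ^ k` in
`(ℂ ∪ {∞}) ^ 2`. Over `z = a` and over `z = ∞` the right hand side is `∞`, so `w = ∞` there;
over every other `z` it is finite, so `w` is finite. -/
def closedCurve (k : ℕ) (a : ℝ) : Set (OnePoint ℂ × OnePoint ℂ) :=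
  {p | (∃ z w : ℂ, p = ((z : OnePoint ℂ), (w : OnePoint ℂ)) ∧ z ≠ (a : ℂ) ∧
          w ^ (k + 1) = z ^ 2 * ((z - 1) / (z - (a : ℂ))) ^ k) ∨
        p = (((a : ℂ) : OnePoint ℂ), OnePoint.infty) ∨
        p = (OnePoint.infty, OnePoint.infty)}

/-- The surface `M`: the compact surface with the ends `(0, 0)` and `(∞, ∞)` removed. -/
def surface (k : ℕ) (a : ℝ) : Set (OnePoint ℂ × OnePoint ℂ) :=
  closedCurve k a \
    {(((0 : ℂ) : OnePoint ℂ), ((0 : ℂ) : OnePoint ℂ)), (OnePoint.infty, OnePoint.infty)}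

variable {k : ℕ} {a : ℝ}

/-- The coordinate function `z`, which is finite and nonzero everywhere on `M`. -/
def zCoord (p : surface k a) : ℂ := toC p.1.1

/-- The coordinate function `w`, with the value `0` in place of `∞` at the point `(a, ∞)`. -/
def wCoord (p : surface k a) : ℂ := toC p.1.2

/-- The function `u = (z - 1) / w`. For even `k` it is holomorphic on `M`: it has a simple zero
at `(1, 0)` (where `z - 1` and `w` vanish to the orders `k + 1` and `k`), and a zero of order `k`
at `(a, ∞)`; at both points the formula below has the value `0`. -/
def uCoord (p : surface k a) : ℂ := (zCoord p - 1) / wCoord p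

/-- The function `v = (z - a) * w`. For even `k` it is holomorphic on `M`: it has a simple zero
at `(a, ∞)` (where `z - a` has a zero of order `k + 1` and `w` a pole of order `k`), and a zero of
order `k` at `(1, 0)`; at both points the formula below has the value `0`. -/
def vCoord (p : surface k a) : ℂ := (zCoord p - (a : ℂ)) * wCoord p

/-- Piecewise continuously differentiable paths on the Riemann surface `M` (for even `k`).
The functions `z`, `u`, `v` are holomorphic on `M`, and at every point of `M` one of them is a
local coordinate: `u` at `(1, 0)`, `v` at `(a, ∞)`, and `z` at all other points. Hence a
continuous path in `M` is `C¹` on a closed interval, in the sense of the complex structure of `M`,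
if and only if its compositions with `z`, `u` and `v` are `C¹` there. -/
def IsPiecewiseC1 {p q : surface k a} (γ : Path p q) : Prop :=
  ∃ (n : ℕ) (τ : ℕ → ℝ), Monotone τ ∧ τ 0 = 0 ∧ τ n = 1 ∧ ∀ i < n,
    ContDiffOn ℝ 1 (fun t => zCoord (γ.extend t)) (Icc (τ i) (τ (i + 1))) ∧
    ContDiffOn ℝ 1 (fun t => uCoord (γ.extend t)) (Icc (τ i) (τ (i + 1))) ∧
    ContDiffOn ℝ 1 (fun t => vCoord (γ.extend t)) (Icc (τ i) (τ (i + 1)))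

/-- The constant `c = a ^ ((k - 2) / (2 * k + 2))`. -/
def gaussConst (k : ℕ) (a : ℝ) : ℝ := a ^ (((k : ℝ) - 2) / (2 * (k : ℝ) + 2))

/-- The Gauss map `g = c * w`. -/
def gaussMap (p : surface k a) : ℂ := (gaussConst k a : ℂ) * wCoord p

/-- The coefficient of `dz` in the holomorphic differential `η = dz / (z * w)`. -/
def etaCoeff (p : surface k a) : ℂ := 1 / (zCoord p * wCoord p)

/-- The coefficients of `dz` in `Φ = ((1 - g ^ 2) η, i (1 + g ^ 2) η, 2 g η)`, valid away from the
two points `(1, 0)` and `(a, ∞)`, where the value is `0`. -/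
def phiCoeff (p : surface k a) : Fin 3 → ℂ :=
  ![(1 - gaussMap p ^ 2) * etaCoeff p,
    Complex.I * (1 + gaussMap p ^ 2) * etaCoeff p,
    2 * gaussMap p * etaCoeff p]

/-- `Re ∫_γ Φ ∈ ℝ³`, for a piecewise `C¹` path `γ` on `M`. The integrand is the pullback of the
holomorphic form `Φ` under `γ` at all times except possibly those `t` with `γ t = (1, 0)` or
`γ t = (a, ∞)`. Among these, only countably many are isolated, and at the others (apart from the
finitely many break points) the velocity of `γ` in a local coordinate is zero. So the integrand
is that pullback almost everywhere. -/
def reIntegral {p q : surface k a} (γ : Path p q) : Fin 3 → ℝ := fun j =>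
  (∫ t in (0 : ℝ)..1, phiCoeff (γ.extend t) j * deriv (fun s => zCoord (γ.extend s)) t).re

/-- The period condition: `Re ∮_ℓ Φ = 0` for every loop `ℓ` in `M`. -/
def PeriodCondition (k : ℕ) (a : ℝ) : Prop :=
  ∀ (p : surface k a) (γ : Path p p), IsPiecewiseC1 γ → reIntegral γ = 0

/-- The map `f = Re ∫_{z₀}^z Φ : M → ℝ³` is well defined, for each base point `z₀` of `M`. -/
def IsWellDefined (k : ℕ) (a : ℝ) : Prop :=
  ∀ p₀ : surface k a, ∃ f : surface k a → (Fin 3 → ℝ),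
    ∀ (p : surface k a) (γ : Path p₀ p), IsPiecewiseC1 γ → f p = reIntegral γ

end EvenGenus

end

namespace EvenGenus

open Filter Topology

/-! The third component of Φ is 2c dz/z, whose real integral 2c log|z| is always single valued. The
other two combine into one complex function: with F = ∫η and G = ∫g²η they are the real part and
minus the imaginary part of P = F − conj G. So the period condition says that P is single valued on
M.

Two symmetries control P. If ρ^(k+1) = 1, the change of sheet u ↦ ρu multiplies F by ρ and G by ρ⁻¹
(both normalized at (1, 0)), hence P by ρ (`potOne_mul`). The involution (z, w) ↦ (a/z, 1/(c²w)),
which explains the choice of c, exchanges η with −g²η, so it turns P into conj P up to a constant.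
Accordingly P has three local descriptions: `potOne`, vanishing at (1, 0); `potPole`, its conjugate
transported to (a, ∞); and `potNeg`, over the plane slit along [0, ∞), built from primitives
vanishing at the two ends. The first two always agree, because F(z) + G(a/z) is a real constant A =
`segInt` on the sheet positive over (1, a) (`potOne_eq_potPole`). With h = exp(iπ/(k+1)) and B =
`endInt`, `potOne` on the reference sheet `wNeg` exceeds F − conj G, normalized at the ends, by C =
−hA + 2h²B over the upper half plane and by conj C over the lower one. If C is real, everything
glues to a global potential (`isPotential_globalPot`); conversely, two paths from (1, 0) to a point
over −1, one through each half plane, have integrals whose second components differ by 2 Im C up to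
sign.

Now Im C = 0 reads sin(π/(k+1)) A(a) = 2 sin(2π/(k+1)) B(a). Both sines are positive since k ≥ 2, A
grows from the value 0 at a = 1, and B > 0 decreases strictly to 0, so there is exactly one solution
(`existsUnique_closing`).

Two devices keep the argument elementary. The primitives are explicit powers of u times holomorphic
Euler integrals, so no analytic continuation is needed. A path crosses a branch point with nonzero
velocity at only countably many times, and the fundamental theorem of calculus tolerates a countable
exceptional set. -/

/-! ### Euler integrals and their differential equation -/

/-- The Euler type integral `∫₀¹ n t ^ (m - 1) G (t ^ n z) dt`, which is
`∫₀¹ s ^ (m / n - 1) G (s z) ds` after the substitution `s = t ^ n`. -/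
noncomputable def eulerIntegral (m n : ℕ) (G : ℂ → ℂ) (z : ℂ) : ℂ :=
  ∫ t in (0 : ℝ)..1, (n : ℂ) * (t : ℂ) ^ (m - 1) * G ((t : ℂ) ^ n * z)

/-- Supplies one compact set on which G′ can be bounded for all parameters near z at once, as
differentiation under the integral sign requires. -/
lemma exists_closedBall_pow_mul_mem {U : Set ℂ} (hU : IsOpen U)
    (hs : StarConvex ℝ 0 U) (n : ℕ) {z : ℂ} (hz : z ∈ U) :
    ∃ r > 0, ∃ C : Set ℂ, IsCompact C ∧ C ⊆ U ∧
      ∀ t ∈ Icc (0 : ℝ) 1, ∀ y ∈ Metric.closedBall z r, (t : ℂ) ^ n * y ∈ C := by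
  obtain ⟨r, hr, hrU⟩ := Metric.nhds_basis_closedBall.mem_iff.1 (hU.mem_nhds hz)
  refine ⟨r, hr, (fun p : ℝ × ℂ => (p.1 : ℂ) ^ n * p.2) '' (Icc (0 : ℝ) 1 ×ˢ Metric.closedBall z r),
    ?_, ?_, ?_⟩
  · exact (isCompact_Icc.prod (isCompact_closedBall z r)).image (by fun_prop)
  · rintro _ ⟨⟨t, y⟩, ⟨ht, hy⟩, rfl⟩
    have h := hs.smul_mem (hrU hy) (pow_nonneg ht.1 n) (pow_le_one₀ ht.1 ht.2)
    simpa using h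
  · intro t ht y hy
    exact ⟨(t, y), ⟨ht, hy⟩, rfl⟩

/-- The Euler integral of a holomorphic function on a star-shaped domain solves the
Euler differential equation. -/
theorem eulerIntegral_hasDerivAt {U : Set ℂ} (hU : IsOpen U) (hs : StarConvex ℝ 0 U)
    {G : ℂ → ℂ} (hG : DifferentiableOn ℂ G U) {m n : ℕ} (hm : 0 < m) (hn : 0 < n)
    {z : ℂ} (hz : z ∈ U) :
    ∃ E', HasDerivAt (eulerIntegral m n G) E' z ∧
      n * z * E' + m * eulerIntegral m n G z = n * G z := by
  obtain ⟨r, hr, C, hC, hCU, hmem⟩ := exists_closedBall_pow_mul_mem hU hs n hz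
  have hG' : ContinuousOn (deriv G) U := (hG.deriv hU).continuousOn
  obtain ⟨B, hB⟩ := hC.exists_bound_of_continuousOn (hG'.mono hCU)
  have hder : ∀ t ∈ Icc (0 : ℝ) 1, ∀ y ∈ Metric.closedBall z r,
      HasDerivAt G (deriv G ((t : ℂ) ^ n * y)) ((t : ℂ) ^ n * y) := fun t ht y hy =>
    (hG.differentiableAt (hU.mem_nhds (hCU (hmem t ht y hy)))).hasDerivAt
  have hcont : ∀ (g : ℂ → ℂ), ContinuousOn g U → ∀ y ∈ Metric.closedBall z r,
      ContinuousOn (fun t : ℝ => g ((t : ℂ) ^ n * y)) (Icc 0 1) := by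
    intro g hg y hy
    exact hg.comp (by fun_prop) fun t ht => hCU (hmem t ht y hy)
  have hu : uIcc (0 : ℝ) 1 = Icc 0 1 := uIcc_of_le zero_le_one
  have hint : ∀ (g : ℂ → ℂ), ContinuousOn g U → ∀ j, ∀ y ∈ Metric.closedBall z r,
      IntervalIntegrable (fun t : ℝ => (n : ℂ) * (t : ℂ) ^ j * g ((t : ℂ) ^ n * y))
        volume 0 1 := by
    intro g hg j y hy
    apply ContinuousOn.intervalIntegrable
    rw [hu]
    exact ContinuousOn.mul (by fun_prop) (hcont g hg y hy)
  have hzz : z ∈ Metric.closedBall z r := Metric.mem_closedBall_self hr.le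
  have hsub : Ι (0 : ℝ) 1 ⊆ Icc 0 1 := by
    rw [uIoc_of_le zero_le_one]; exact Ioc_subset_Icc_self
  have key := intervalIntegral.hasDerivAt_integral_of_dominated_loc_of_deriv_le
    (μ := volume) (a := 0) (b := 1) (s := Metric.ball z r)
    (F := fun y (t : ℝ) => (n : ℂ) * (t : ℂ) ^ (m - 1) * G ((t : ℂ) ^ n * y))
    (F' := fun y (t : ℝ) => (n : ℂ) * (t : ℂ) ^ (m - 1 + n) * deriv G ((t : ℂ) ^ n * y))
    (x₀ := z) (bound := fun _ => n * B) (Metric.ball_mem_nhds z hr) ?_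
    (hint G hG.continuousOn _ z hzz) ?_ ?_ (by simp) ?_
  · refine ⟨_, key.2, ?_⟩
    -- The differential equation is the integral of d/dt [t^m G(t^n z)] over [0, 1]; since m > 0,
    -- only the boundary term G(z) survives.
    have hftc : ∫ t in (0 : ℝ)..1, (m * ((t : ℂ) ^ (m - 1)) * G ((t : ℂ) ^ n * z) +
        (t : ℂ) ^ m * (n * (t : ℂ) ^ (n - 1) * z * deriv G ((t : ℂ) ^ n * z))) =
        ((1 : ℝ) : ℂ) ^ m * G (((1 : ℝ) : ℂ) ^ n * z) -
          ((0 : ℝ) : ℂ) ^ m * G (((0 : ℝ) : ℂ) ^ n * z) := by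
      apply intervalIntegral.integral_eq_sub_of_hasDerivAt (f := fun t : ℝ =>
        (t : ℂ) ^ m * G ((t : ℂ) ^ n * z))
      · intro t ht
        rw [hu] at ht
        have h1 : HasDerivAt (fun t : ℝ => (t : ℂ) ^ m) (m * (t : ℂ) ^ (m - 1)) t := by
          simpa using (HasDerivAt.pow (n := m) (hasDerivAt_id (t : ℂ))).comp_ofReal
        have h2 : HasDerivAt (fun t : ℝ => (t : ℂ) ^ n * z) (n * (t : ℂ) ^ (n - 1) * z) t := by
          simpa using ((HasDerivAt.pow (n := n) (hasDerivAt_id (t : ℂ))).comp_ofReal).mul_const z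
        have h3 := (hder t ht z hzz).scomp t h2
        simpa only [smul_eq_mul, Function.comp_def] using h1.fun_mul h3
      · apply ContinuousOn.intervalIntegrable
        rw [hu]
        have c1 := hcont G hG.continuousOn z hzz
        have c2 := hcont _ hG' z hzz
        have c3 : ContinuousOn (fun t : ℝ => (t : ℂ)) (Icc 0 1) :=
          Complex.continuous_ofReal.continuousOn
        exact ((continuousOn_const.mul (c3.pow _)).mul c1).add
          ((c3.pow _).mul (((continuousOn_const.mul (c3.pow _)).mul continuousOn_const).mul c2))
    have hnz : ∀ t : ℝ,
        (n : ℂ) * z * ((n : ℂ) * (t : ℂ) ^ (m - 1 + n) * deriv G ((t : ℂ) ^ n * z)) +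
        m * ((n : ℂ) * (t : ℂ) ^ (m - 1) * G ((t : ℂ) ^ n * z)) =
        n * (m * ((t : ℂ) ^ (m - 1)) * G ((t : ℂ) ^ n * z) +
        (t : ℂ) ^ m * (n * (t : ℂ) ^ (n - 1) * z * deriv G ((t : ℂ) ^ n * z))) := by
      intro t
      obtain ⟨m, rfl⟩ := Nat.exists_eq_succ_of_ne_zero hm.ne'
      obtain ⟨n, rfl⟩ := Nat.exists_eq_succ_of_ne_zero hn.ne'
      simp only [Nat.succ_eq_add_one, Nat.add_sub_cancel]
      ring
    rw [eulerIntegral, ← intervalIntegral.integral_const_mul, ← intervalIntegral.integral_const_mul,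
      ← intervalIntegral.integral_add ((hint _ hG' _ z hzz).const_mul _)
        ((hint _ hG.continuousOn _ z hzz).const_mul _)]
    simp_rw [hnz]
    rw [intervalIntegral.integral_const_mul, hftc]
    simp [hm.ne']
  · filter_upwards [Metric.ball_mem_nhds z hr] with y hy
    exact (hint G hG.continuousOn _ y (Metric.ball_subset_closedBall hy)).def'.aestronglyMeasurable
  · exact (hint _ hG' _ z hzz).def'.aestronglyMeasurable
  · refine ae_of_all _ fun t ht y hy => ?_
    have ht' := hsub ht
    have h1 := hB _ (hmem t ht' y (Metric.ball_subset_closedBall hy))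
    rw [norm_mul, norm_mul, norm_pow, Complex.norm_natCast, Complex.norm_real,
      Real.norm_of_nonneg ht'.1]
    have h2 : t ^ (m - 1 + n) ≤ 1 := pow_le_one₀ ht'.1 ht'.2
    calc (n : ℝ) * t ^ (m - 1 + n) * ‖deriv G ((t : ℂ) ^ n * y)‖
        ≤ n * 1 * B := by gcongr
      _ = n * B := by ring
  · refine ae_of_all _ fun t ht y hy => ?_
    have h3 := (hder t (hsub ht) y (Metric.ball_subset_closedBall hy)).comp y
      ((hasDerivAt_id y).const_mul ((t : ℂ) ^ n))
    refine (h3.const_mul ((n : ℂ) * (t : ℂ) ^ (m - 1))).congr_deriv ?_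
    rw [pow_add]; ring

/-! ### Principal roots and slit domains -/

/-- The principal `(k + 1)`-st root. -/
noncomputable def rt (k : ℕ) (z : ℂ) : ℂ := z ^ (((k + 1 : ℕ) : ℂ)⁻¹)

lemma rt_pow (k : ℕ) (z : ℂ) : rt k z ^ (k + 1) = z :=
  Complex.cpow_nat_inv_pow z (Nat.succ_ne_zero k)

lemma rt_ne_zero (k : ℕ) {z : ℂ} (hz : z ≠ 0) : rt k z ≠ 0 := by
  intro h
  apply hz
  rw [← rt_pow k z, h, zero_pow (Nat.succ_ne_zero k)]

lemma hasDerivAt_rt (k : ℕ) {z : ℂ} (hz : z ∈ Complex.slitPlane) :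
    HasDerivAt (rt k) (rt k z / ((k + 1) * z)) z := by
  have h := (hasDerivAt_id z).cpow_const (c := (((k + 1 : ℕ) : ℂ)⁻¹)) hz
  have hz0 := Complex.slitPlane_ne_zero hz
  refine h.congr_deriv ?_
  simp only [id, rt]
  rw [Complex.cpow_sub _ _ hz0, Complex.cpow_one]
  push_cast
  have : (k : ℂ) + 1 ≠ 0 := by exact_mod_cast Nat.succ_ne_zero k
  field_simp

lemma rt_ofReal (k : ℕ) {x : ℝ} (hx : 0 ≤ x) :
    rt k (x : ℂ) = ((x ^ (((k + 1 : ℕ) : ℝ)⁻¹) : ℝ) : ℂ) := by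
  rw [rt, Complex.ofReal_cpow hx]
  push_cast
  rfl

/-- The root of unity `exp (i π / (k + 1))` of order `2 k + 2`. -/
noncomputable def halfRoot (k : ℕ) : ℂ := Complex.exp (Real.pi / ((k : ℂ) + 1) * Complex.I)

lemma halfRoot_ne_zero (k : ℕ) : halfRoot k ≠ 0 := Complex.exp_ne_zero _

lemma halfRoot_pow (k : ℕ) : halfRoot k ^ (k + 1) = -1 := by
  have : (k : ℂ) + 1 ≠ 0 := by exact_mod_cast Nat.succ_ne_zero k
  rw [halfRoot, ← Complex.exp_nat_mul, ← Complex.exp_pi_mul_I]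
  congr 1
  push_cast
  field_simp

/-- In the upper half plane arg(−z) = arg z − π. This is the only source of the roots of unity that
appear when branches with different slits are compared. -/
lemma rt_of_im_pos (k : ℕ) {z : ℂ} (hz : 0 < z.im) : rt k z = rt k (-z) * halfRoot k := by
  have hz0 : z ≠ 0 := by rintro rfl; simp at hz
  have : (k : ℂ) + 1 ≠ 0 := by exact_mod_cast Nat.succ_ne_zero k
  rw [rt, rt, halfRoot, Complex.cpow_def_of_ne_zero hz0,
    Complex.cpow_def_of_ne_zero (neg_ne_zero.2 hz0), ← Complex.exp_add, Complex.log, Complex.log,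
    Complex.arg_neg_eq_arg_sub_pi_of_im_pos hz, norm_neg]
  congr 1
  push_cast
  field_simp
  ring

lemma rt_neg_of_im_neg (k : ℕ) {z : ℂ} (hz : z.im < 0) : rt k (-z) = rt k z * halfRoot k := by
  have := rt_of_im_pos k (z := -z) (by simpa using hz)
  rwa [neg_neg] at this

lemma add_ofReal_mem_slitPlane {z : ℂ} (hz : z ∈ Complex.slitPlane) {r : ℝ} (hr : 0 ≤ r) :
    z + r ∈ Complex.slitPlane := by
  rw [Complex.mem_slitPlane_iff] at *
  simp only [Complex.add_re, Complex.add_im, Complex.ofReal_re, Complex.ofReal_im, add_zero]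
  rcases hz with hz | hz
  · left; linarith
  · right; exact hz

/-- The plane slit along `(-∞, 0]` and `[a, ∞)`. -/
def domOne (a : ℝ) : Set ℂ := {z | z ∈ Complex.slitPlane ∧ (a : ℂ) - z ∈ Complex.slitPlane}

/-- The plane slit along `(-∞, 1]`. -/
def domPole : Set ℂ := {z | z - 1 ∈ Complex.slitPlane}

/-- The plane slit along `[0, ∞)`. -/
def domNeg : Set ℂ := {z | -z ∈ Complex.slitPlane}

/-- The plane slit along `(-∞, 1]` and `[a, ∞)`. -/
def domMid (a : ℝ) : Set ℂ := {z | z - 1 ∈ Complex.slitPlane ∧ (a : ℂ) - z ∈ Complex.slitPlane}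

/-- The plane slit along `[1, ∞)`. -/
def domZero : Set ℂ := {z | 1 - z ∈ Complex.slitPlane}

/-- The plane slit along `(-∞, 0]` and `[1, ∞)`. -/
def domUnit : Set ℂ := {z | z ∈ Complex.slitPlane ∧ 1 - z ∈ Complex.slitPlane}

lemma isOpen_domOne (a : ℝ) : IsOpen (domOne a) :=
  Complex.isOpen_slitPlane.inter
    (Complex.isOpen_slitPlane.preimage (by fun_prop : Continuous fun z : ℂ => (a : ℂ) - z))

lemma isOpen_domPole : IsOpen domPole :=
  Complex.isOpen_slitPlane.preimage (by fun_prop : Continuous fun z : ℂ => z - 1)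

lemma isOpen_domNeg : IsOpen domNeg :=
  Complex.isOpen_slitPlane.preimage (by fun_prop : Continuous fun z : ℂ => -z)

lemma isOpen_domZero : IsOpen domZero :=
  Complex.isOpen_slitPlane.preimage (by fun_prop : Continuous fun z : ℂ => 1 - z)

lemma isOpen_domMid (a : ℝ) : IsOpen (domMid a) :=
  (Complex.isOpen_slitPlane.preimage (by fun_prop : Continuous fun z : ℂ => z - 1)).inter
    (Complex.isOpen_slitPlane.preimage (by fun_prop : Continuous fun z : ℂ => (a : ℂ) - z))

lemma isOpen_domUnit : IsOpen domUnit :=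
  Complex.isOpen_slitPlane.inter
    (Complex.isOpen_slitPlane.preimage (by fun_prop : Continuous fun z : ℂ => 1 - z))

lemma starConvex_preimage_sub {x r : ℝ} (h : r < x) :
    StarConvex ℝ (x : ℂ) {z : ℂ | z - r ∈ Complex.slitPlane} := by
  intro z hz s t hs ht hst
  have := Complex.starConvex_ofReal_slitPlane (sub_pos.2 h) hz hs ht hst
  simp only [mem_ofPred_eq]
  convert this using 1
  have hst' : (s : ℂ) + t = 1 := by exact_mod_cast hst
  simp only [Complex.real_smul]
  push_cast
  linear_combination (r : ℂ) * hst'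

lemma starConvex_preimage_const_sub {x r : ℝ} (h : x < r) :
    StarConvex ℝ (x : ℂ) {z : ℂ | r - z ∈ Complex.slitPlane} := by
  intro z hz s t hs ht hst
  have := Complex.starConvex_ofReal_slitPlane (sub_pos.2 h) hz hs ht hst
  simp only [mem_ofPred_eq]
  convert this using 1
  have hst' : (s : ℂ) + t = 1 := by exact_mod_cast hst
  simp only [Complex.real_smul]
  push_cast
  linear_combination (-(r : ℂ)) * hst'

lemma ofReal_mem_domMid {a x : ℝ} (h1 : 1 < x) (h2 : x < a) : (x : ℂ) ∈ domMid a := by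
  constructor
  · have := Complex.ofReal_mem_slitPlane.2 (sub_pos.2 h1)
    rwa [Complex.ofReal_sub] at this
  · have := Complex.ofReal_mem_slitPlane.2 (sub_pos.2 h2)
    rwa [Complex.ofReal_sub] at this

lemma ofReal_mem_domUnit {x : ℝ} (h1 : 0 < x) (h2 : x < 1) : (x : ℂ) ∈ domUnit := by
  constructor
  · exact Complex.ofReal_mem_slitPlane.2 h1
  · have := Complex.ofReal_mem_slitPlane.2 (sub_pos.2 h2)
    rwa [Complex.ofReal_sub] at this

lemma ofReal_mem_domNeg {x : ℝ} (h : x < 0) : (x : ℂ) ∈ domNeg := by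
  have := Complex.ofReal_mem_slitPlane.2 (neg_pos.2 h)
  rwa [Complex.ofReal_neg] at this

lemma isPreconnected_domMid {a : ℝ} (ha : 1 < a) : IsPreconnected (domMid a) := by
  have h1 : (1 : ℝ) < (1 + a) / 2 := by linarith
  have h2 : (1 + a) / 2 < a := by linarith
  have h := (starConvex_preimage_sub h1).inter (starConvex_preimage_const_sub h2)
  simp only [Complex.ofReal_one] at h
  exact (h.isPathConnected (ofReal_mem_domMid h1 h2)).isConnected.isPreconnected

lemma isPreconnected_domUnit : IsPreconnected domUnit := by
  have h1 : (0 : ℝ) < 1 / 2 := by norm_num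
  have h2 : (1 / 2 : ℝ) < 1 := by norm_num
  have h := (starConvex_preimage_sub h1).inter (starConvex_preimage_const_sub h2)
  simp only [Complex.ofReal_one, Complex.ofReal_zero, sub_zero] at h
  exact (h.isPathConnected (ofReal_mem_domUnit h1 h2)).isConnected.isPreconnected

lemma isPreconnected_domNeg : IsPreconnected domNeg := by
  have h1 : (-1 : ℝ) < 0 := by norm_num
  have h := starConvex_preimage_const_sub h1
  simp only [Complex.ofReal_zero, zero_sub] at h
  exact (h.isPathConnected (ofReal_mem_domNeg h1)).isConnected.isPreconnected

lemma starConvex_domZero : StarConvex ℝ 0 domZero := by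
  have h := starConvex_preimage_const_sub (x := 0) (r := 1) (by norm_num)
  simpa only [domZero, Complex.ofReal_zero, Complex.ofReal_one] using h

lemma starConvex_domOne {a : ℝ} (ha : 1 < a) : StarConvex ℝ 1 (domOne a) := by
  have h := (starConvex_preimage_sub (x := 1) (r := 0) (by norm_num)).inter
    (starConvex_preimage_const_sub ha)
  simpa [domOne, ofPred_and] using h

lemma domPole_subset_slitPlane {z : ℂ} (hz : z ∈ domPole) : z ∈ Complex.slitPlane := by
  simpa using add_ofReal_mem_slitPlane hz zero_le_one

lemma domMid_subset_domOne {a : ℝ} {z : ℂ} (hz : z ∈ domMid a) : z ∈ domOne a :=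
  ⟨domPole_subset_slitPlane hz.1, hz.2⟩

lemma sub_mem_slitPlane_of_one {a : ℝ} (ha : 1 < a) {z : ℂ} (hz : 1 - z ∈ Complex.slitPlane) :
    (a : ℂ) - z ∈ Complex.slitPlane := by
  have := add_ofReal_mem_slitPlane hz (sub_pos.2 ha).le
  push_cast at this
  convert this using 1
  ring

lemma domUnit_subset_domOne {a : ℝ} (ha : 1 < a) {z : ℂ} (hz : z ∈ domUnit) : z ∈ domOne a :=
  ⟨hz.1, sub_mem_slitPlane_of_one ha hz.2⟩

lemma domNeg_subset_domZero {z : ℂ} (hz : z ∈ domNeg) : z ∈ domZero := by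
  have := add_ofReal_mem_slitPlane hz zero_le_one
  rw [domZero, mem_ofPred_eq]
  convert this using 1
  push_cast; ring

lemma ne_zero_of_mem_domOne {a : ℝ} {z : ℂ} (hz : z ∈ domOne a) : z ≠ 0 :=
  Complex.slitPlane_ne_zero hz.1

lemma sub_ne_zero_of_mem_domOne {a : ℝ} {z : ℂ} (hz : z ∈ domOne a) : z - (a : ℂ) ≠ 0 := by
  have := Complex.slitPlane_ne_zero hz.2
  rwa [← neg_sub, neg_ne_zero]

lemma div_im_eq (a : ℝ) (z : ℂ) : ((a : ℂ) / z).im = -(a * z.im / Complex.normSq z) := by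
  simp [Complex.div_im]

lemma eq_ofReal_of_im_eq_zero {z : ℂ} (h : z.im = 0) : z = (z.re : ℂ) :=
  Complex.ext (by simp) (by simp [h])

lemma div_im_ne_zero {a : ℝ} (ha : 0 < a) {z : ℂ} (h : z.im ≠ 0) : ((a : ℂ) / z).im ≠ 0 := by
  have : z ≠ 0 := by rintro rfl; simp at h
  rw [div_im_eq, neg_ne_zero]
  exact div_ne_zero (mul_ne_zero ha.ne' h) (Complex.normSq_pos.2 this).ne'

lemma div_im_neg {a : ℝ} (ha : 0 < a) {z : ℂ} (h : 0 < z.im) : ((a : ℂ) / z).im < 0 := by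
  have : z ≠ 0 := by rintro rfl; simp at h
  rw [div_im_eq, neg_lt_zero]
  exact div_pos (mul_pos ha h) (Complex.normSq_pos.2 this)

lemma div_im_pos {a : ℝ} (ha : 0 < a) {z : ℂ} (h : z.im < 0) : 0 < ((a : ℂ) / z).im := by
  have : z ≠ 0 := by rintro rfl; simp at h
  rw [div_im_eq, neg_pos]
  exact div_neg_of_neg_of_pos (mul_neg_of_pos_of_neg ha h) (Complex.normSq_pos.2 this)

/-- The map z ↦ a/z keeps nonreal points nonreal and exchanges the real gaps (1, ∞) and (0, a) in
the two slits. -/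
lemma div_mem_domOne {a : ℝ} (ha : 1 < a) {z : ℂ} (hz : z ∈ domPole) : (a : ℂ) / z ∈ domOne a := by
  have ha0 : 0 < a := by linarith
  by_cases h : z.im = 0
  · rw [eq_ofReal_of_im_eq_zero h] at hz ⊢
    set x := z.re
    have hx : 1 < x := by
      have : ((x - 1 : ℝ) : ℂ) ∈ Complex.slitPlane := by
        rw [Complex.ofReal_sub]; exact hz
      have := Complex.ofReal_mem_slitPlane.1 this
      linarith
    have hx0 : 0 < x := by linarith
    rw [← Complex.ofReal_div]
    refine ⟨Complex.ofReal_mem_slitPlane.2 (div_pos ha0 hx0), ?_⟩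
    rw [← Complex.ofReal_sub]
    exact Complex.ofReal_mem_slitPlane.2 (sub_pos.2 (div_lt_self ha0 hx))
  · have := div_im_ne_zero ha0 h
    exact ⟨Or.inr this, Or.inr (by simpa using this)⟩

lemma div_mem_domPole {a : ℝ} (ha : 1 < a) {z : ℂ} (hz : z ∈ domOne a) : (a : ℂ) / z ∈ domPole := by
  have ha0 : 0 < a := by linarith
  by_cases h : z.im = 0
  · rw [eq_ofReal_of_im_eq_zero h] at hz ⊢
    set x := z.re
    have hx : 0 < x := Complex.ofReal_mem_slitPlane.1 hz.1
    have hxa : x < a := by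
      have : ((a - x : ℝ) : ℂ) ∈ Complex.slitPlane := by simpa using hz.2
      have := Complex.ofReal_mem_slitPlane.1 this
      linarith
    rw [← Complex.ofReal_div, domPole, mem_ofPred_eq, ← Complex.ofReal_one, ← Complex.ofReal_sub]
    exact Complex.ofReal_mem_slitPlane.2 (sub_pos.2 ((one_lt_div hx).2 hxa))
  · have := div_im_ne_zero ha0 h
    exact Or.inr (by simpa using this)

lemma div_mem_domMid {a : ℝ} (ha : 1 < a) {z : ℂ} (hz : z ∈ domMid a) : (a : ℂ) / z ∈ domMid a :=
  ⟨div_mem_domPole ha (domMid_subset_domOne hz), (div_mem_domOne ha hz.1).2⟩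

lemma div_mem_domNeg {a : ℝ} (ha : 1 < a) {z : ℂ} (hz : z ∈ domNeg) : (a : ℂ) / z ∈ domNeg := by
  have ha0 : 0 < a := by linarith
  by_cases h : z.im = 0
  · rw [eq_ofReal_of_im_eq_zero h] at hz ⊢
    set x := z.re
    have hx : 0 < -x := by
      have : ((-x : ℝ) : ℂ) ∈ Complex.slitPlane := by
        rw [Complex.ofReal_neg]; exact hz
      exact Complex.ofReal_mem_slitPlane.1 this
    rw [← Complex.ofReal_div, domNeg, mem_ofPred_eq, ← Complex.ofReal_neg]
    exact Complex.ofReal_mem_slitPlane.2 (by rw [← div_neg]; exact div_pos ha0 hx)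
  · have := div_im_ne_zero ha0 h
    exact Or.inr (by simpa using this)

/-- Two continuous functions with equal `n`-th powers on a preconnected set that agree at one
point agree everywhere. -/
lemma eq_one_of_pow_eq_one {S : Set ℂ} (hS : IsPreconnected S) {f : ℂ → ℂ} (hf : ContinuousOn f S)
    {n : ℕ} (hn : 0 < n) (h : ∀ z ∈ S, f z ^ n = 1) {z₀ : ℂ} (hz₀ : z₀ ∈ S) (h₀ : f z₀ = 1)
    {z : ℂ} (hz : z ∈ S) : f z = 1 := by
  rw [← h₀]
  have hfin : {x : ℂ | x ^ n = 1}.Finite := by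
    have : {x : ℂ | x ^ n = 1} ⊆ ((Polynomial.nthRoots n (1 : ℂ)).toFinset : Set ℂ) := by
      intro x hx
      simpa [Polynomial.mem_nthRoots hn] using hx
    exact (Finset.finite_toSet _).subset this
  exact hS.constant_of_mapsTo hfin.isDiscrete hf h hz hz₀

/-! ### Primitives of η and g²η near the branch point (1, 0) -/

/-- The branch of `(z - a) ^ (k / (k + 1)) / z ^ (2 / (k + 1))` on `domOne a`. -/
noncomputable def unitFactor (k : ℕ) (a : ℝ) (z : ℂ) : ℂ := rt k (a - z) ^ k / rt k z ^ 2

/-- The square of the constant `c`. -/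
noncomputable def cSq (k : ℕ) (a : ℝ) : ℂ := (gaussConst k a : ℂ) ^ 2

/-- The holomorphic factor of the primitive of `η` that vanishes at `(1, 0)`. -/
noncomputable def etaFactor (k : ℕ) (a : ℝ) (z : ℂ) : ℂ :=
  eulerIntegral 1 (k + 1) (fun s => unitFactor k a (1 + s) / (1 + s)) (z - 1) / unitFactor k a z

/-- The holomorphic factor of the primitive of `g ^ 2 η` that vanishes at `(1, 0)`. -/
noncomputable def dualFactor (k : ℕ) (a : ℝ) (z : ℂ) : ℂ :=
  cSq k a * eulerIntegral (2 * k + 1) (k + 1) (fun s => 1 / (unitFactor k a (1 + s) * (1 + s)))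
    (z - 1) / unitFactor k a z ^ (2 * k + 1)

/-- The primitive of `η` vanishing at `(1, 0)`, as a function of `z` and `u`. -/
noncomputable def etaPrim (k : ℕ) (a : ℝ) (z u : ℂ) : ℂ := u * etaFactor k a z

/-- The primitive of `g ^ 2 η` vanishing at `(1, 0)`, as a function of `z` and `u`. -/
noncomputable def dualPrim (k : ℕ) (a : ℝ) (z u : ℂ) : ℂ := u ^ (2 * k + 1) * dualFactor k a z

/-- The equation of the surface in the coordinates `z` and `u`. -/
def SheetEq (k : ℕ) (a : ℝ) (z u : ℂ) : Prop := u ^ (k + 1) * z ^ 2 = (z - 1) * (z - a) ^ k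

/-- The polynomial `z (z - 1) (z - a)` times `k + 1` times the logarithmic derivative of `u`. -/
def logPoly (k : ℕ) (a : ℝ) (z : ℂ) : ℂ :=
  z * (z - a) + k * z * (z - 1) - 2 * (z - 1) * (z - a)

variable {k : ℕ} {a : ℝ}

lemma succ_ne_zero' (k : ℕ) : (k : ℂ) + 1 ≠ 0 := by exact_mod_cast Nat.succ_ne_zero k

lemma unitFactor_ne_zero {z : ℂ} (hz : z ∈ domOne a) : unitFactor k a z ≠ 0 :=
  div_ne_zero (pow_ne_zero _ (rt_ne_zero k (Complex.slitPlane_ne_zero hz.2)))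
    (pow_ne_zero _ (rt_ne_zero k (Complex.slitPlane_ne_zero hz.1)))

lemma unitFactor_pow (hk : Even k) (z : ℂ) :
    unitFactor k a z ^ (k + 1) = (z - a) ^ k / z ^ 2 := by
  rw [unitFactor, div_pow, ← pow_mul, mul_comm, pow_mul, rt_pow, ← pow_mul, mul_comm 2, pow_mul,
    rt_pow, ← neg_sub z, hk.neg_pow]

lemma hasDerivAt_unitFactor (hk0 : 0 < k) {z : ℂ} (hz : z ∈ domOne a) :
    HasDerivAt (unitFactor k a)
      (unitFactor k a z * (k * z - 2 * (z - a)) / ((k + 1) * z * (z - a))) z := by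
  have h1 : HasDerivAt (fun z : ℂ => rt k (a - z)) _ z :=
    (hasDerivAt_rt k hz.2).comp z ((hasDerivAt_id z).const_sub (a : ℂ))
  have h2 := (h1.fun_pow k).fun_div ((hasDerivAt_rt k hz.1).fun_pow 2)
    (pow_ne_zero _ (rt_ne_zero k (Complex.slitPlane_ne_zero hz.1)))
  refine h2.congr_deriv ?_
  obtain ⟨j, rfl⟩ := Nat.exists_eq_succ_of_ne_zero hk0.ne'
  have e1 := rt_ne_zero (j + 1) (Complex.slitPlane_ne_zero hz.1)
  have e2 := rt_ne_zero (j + 1) (Complex.slitPlane_ne_zero hz.2)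
  have e3 := Complex.slitPlane_ne_zero hz.1
  have e4 := Complex.slitPlane_ne_zero hz.2
  have e5 := sub_ne_zero_of_mem_domOne hz
  have e6 := succ_ne_zero' (j + 1)
  have e7 : (z : ℂ) - a = -(a - z) := by ring
  simp only [Nat.succ_eq_add_one, unitFactor, Nat.add_sub_cancel, e7] at *
  set r := rt (j + 1) z
  set q := rt (j + 1) (a - z)
  set y := (a : ℂ) - z
  push_cast at e6 ⊢
  field_simp
  ring

lemma starConvex_shift (ha : 1 < a) : StarConvex ℝ 0 {s : ℂ | 1 + s ∈ domOne a} := by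
  intro z hz s t hs ht hst
  have := starConvex_domOne ha hz hs ht hst
  simp only [mem_ofPred_eq]
  convert this using 1
  have hst' : (s : ℂ) + t = 1 := by exact_mod_cast hst
  simp only [Complex.real_smul]
  linear_combination -hst'

lemma isOpen_shift (a : ℝ) : IsOpen {s : ℂ | 1 + s ∈ domOne a} :=
  (isOpen_domOne a).preimage (by fun_prop : Continuous fun s : ℂ => 1 + s)

lemma differentiableOn_unitFactor_shift (hk0 : 0 < k) :
    DifferentiableOn ℂ (fun s => unitFactor k a (1 + s)) {s : ℂ | 1 + s ∈ domOne a} := by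
  intro s hs
  exact ((hasDerivAt_unitFactor hk0 hs).comp s
    ((hasDerivAt_id s).const_add 1)).differentiableAt.differentiableWithinAt

/-- With s = z − 1 and N = `unitFactor`, η = s^(1/(k+1) − 1) N ds/z, so its primitive is s^(1/(k+1))
= u/N times the Euler integral with m = 1. The equation is Euler's equation after division by N;
cleared of denominators, it also makes sense at z = 1. -/
lemma etaFactor_hasDerivAt (hk0 : 0 < k) (ha : 1 < a) {z : ℂ} (hz : z ∈ domOne a) :
    ∃ K', HasDerivAt (etaFactor k a) K' z ∧
      (k + 1) * z * (z - 1) * (z - a) * K' + logPoly k a z * etaFactor k a z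
        = (k + 1) * (z - a) := by
  have hz' : z - 1 ∈ {s : ℂ | 1 + s ∈ domOne a} := by simpa using hz
  obtain ⟨E', h1, h2⟩ := eulerIntegral_hasDerivAt (isOpen_shift a) (starConvex_shift ha)
    (G := fun s => unitFactor k a (1 + s) / (1 + s))
    ((differentiableOn_unitFactor_shift hk0).fun_div (by fun_prop)
      (fun s hs => ne_zero_of_mem_domOne hs)) one_pos k.succ_pos hz'
  have h3 := HasDerivAt.comp z h1 ((hasDerivAt_id z).sub_const 1)
  have hN := unitFactor_ne_zero (k := k) hz
  have h4 := h3.fun_div (hasDerivAt_unitFactor hk0 hz) hN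
  refine ⟨_, h4, ?_⟩
  simp only [Function.comp_def, id, etaFactor, logPoly, add_sub_cancel] at h2 ⊢
  set E := eulerIntegral 1 (k + 1) (fun s => unitFactor k a (1 + s) / (1 + s)) (z - 1)
  set N := unitFactor k a z
  have e1 := ne_zero_of_mem_domOne hz
  have e2 := sub_ne_zero_of_mem_domOne hz
  have e3 := succ_ne_zero' k
  push_cast at h2 ⊢
  rw [← mul_div_assoc, eq_div_iff e1] at h2
  field_simp
  linear_combination (z - a) * h2

/-- Here g²η = c² s^((2k+1)/(k+1) − 1) ds/(Nz), hence m = 2k + 1 and the power u^(2k+1). The factor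
(z − a)^(2k) = N^(2k+2) z⁴ serves to eliminate the powers of N. -/
lemma dualFactor_hasDerivAt (hk : Even k) (hk0 : 0 < k) (ha : 1 < a) {z : ℂ} (hz : z ∈ domOne a) :
    ∃ K', HasDerivAt (dualFactor k a) K' z ∧
      (z - a) ^ (2 * k) * ((k + 1) * z * (z - 1) * (z - a) * K' +
        (2 * k + 1) * logPoly k a z * dualFactor k a z) = (k + 1) * cSq k a * (z - a) * z ^ 4 := by
  have hz' : z - 1 ∈ {s : ℂ | 1 + s ∈ domOne a} := by simpa using hz
  obtain ⟨E', h1, h2⟩ := eulerIntegral_hasDerivAt (isOpen_shift a) (starConvex_shift ha)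
    (G := fun s => 1 / (unitFactor k a (1 + s) * (1 + s)))
    ((differentiableOn_const 1).fun_div
      ((differentiableOn_unitFactor_shift hk0).fun_mul (by fun_prop))
      (fun s hs => mul_ne_zero (unitFactor_ne_zero hs) (ne_zero_of_mem_domOne hs)))
    (2 * k).succ_pos k.succ_pos hz'
  have h3 := HasDerivAt.comp z h1 ((hasDerivAt_id z).sub_const 1)
  have hN := unitFactor_ne_zero (k := k) hz
  have h4 := (h3.const_mul (cSq k a)).fun_div ((hasDerivAt_unitFactor hk0 hz).fun_pow (2 * k + 1))
    (pow_ne_zero _ hN)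
  refine ⟨_, h4, ?_⟩
  have hNp := unitFactor_pow (a := a) hk z
  simp only [Function.comp_def, id, dualFactor, logPoly, add_sub_cancel, Nat.succ_eq_add_one,
    Nat.add_sub_cancel] at h2 ⊢
  set E := eulerIntegral (2 * k + 1) (k + 1) (fun s => 1 / (unitFactor k a (1 + s) * (1 + s)))
    (z - 1)
  set N := unitFactor k a z
  have e1 := ne_zero_of_mem_domOne hz
  have e2 := sub_ne_zero_of_mem_domOne hz
  have e3 := succ_ne_zero' k
  have hNp2 : N ^ (2 * k) * N ^ 2 * z ^ 4 = (z - a) ^ (2 * k) := by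
    rw [eq_div_iff (by positivity)] at hNp
    calc N ^ (2 * k) * N ^ 2 * z ^ 4 = (N ^ (k + 1) * z ^ 2) ^ 2 := by ring
      _ = _ := by rw [hNp]; ring
  push_cast at h2 ⊢
  rw [← mul_div_assoc, eq_div_iff (by positivity)] at h2
  rw [← hNp2, pow_succ N (2 * k)]
  have hM : N ^ (2 * k) ≠ 0 := pow_ne_zero _ hN
  set M := N ^ (2 * k)
  field_simp
  linear_combination cSq k a * (z - a) * h2

section PathDerivative

variable {𝕜 : Type*} [NontriviallyNormedField 𝕜] [NormedAlgebra 𝕜 ℂ]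
  {Z U : 𝕜 → ℂ} {Z' U' : ℂ} {t : 𝕜}

/-- The parameter field is arbitrary so that one computation serves both for branches over a domain
(parameter in ℂ) and for paths on the surface (parameter in ℝ). -/
lemma sheetEq_hasDerivAt (hk0 : 0 < k) (hZ : HasDerivAt Z Z' t) (hU : HasDerivAt U U' t)
    (h : ∀ᶠ s in 𝓝 t, SheetEq k a (Z s) (U s)) :
    (k + 1) * U t ^ k * U' * Z t ^ 2 + 2 * U t ^ (k + 1) * Z t * Z' =
      (Z t - a) ^ (k - 1) * ((Z t - a) + k * (Z t - 1)) * Z' := by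
  have h1 := (hU.fun_pow (k + 1)).fun_mul (hZ.fun_pow 2)
  have h2 := (hZ.sub_const 1).fun_mul ((hZ.sub_const (a : ℂ)).fun_pow k)
  have h3 := h1.unique (h2.congr_of_eventuallyEq h)
  obtain ⟨j, rfl⟩ := Nat.exists_eq_succ_of_ne_zero hk0.ne'
  simp only [Nat.succ_eq_add_one, Nat.add_sub_cancel] at h3 ⊢
  push_cast at h3 ⊢
  linear_combination h3

lemma sheetEq_logDeriv (hk0 : 0 < k) (hZ : HasDerivAt Z Z' t) (hU : HasDerivAt U U' t)
    (h : ∀ᶠ s in 𝓝 t, SheetEq k a (Z s) (U s)) (h1 : Z t ≠ 1) (h2 : Z t ≠ a) :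
    (k + 1) * U' * (Z t * (Z t - 1) * (Z t - a)) = U t * Z' * logPoly k a (Z t) := by
  have h3 := sheetEq_hasDerivAt hk0 hZ hU h
  have h4 : U t ^ (k + 1) * Z t ^ 2 = (Z t - 1) * (Z t - a) ^ k := h.self_of_nhds
  have e1 : Z t - 1 ≠ 0 := sub_ne_zero.2 h1
  have e2 : Z t - a ≠ 0 := sub_ne_zero.2 h2
  obtain ⟨j, rfl⟩ := Nat.exists_eq_succ_of_ne_zero hk0.ne'
  simp only [Nat.succ_eq_add_one, Nat.add_sub_cancel, logPoly] at h3 h4 ⊢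
  push_cast at h3 ⊢
  have e3 : (Z t - a) ^ j ≠ 0 := pow_ne_zero _ e2
  apply mul_right_cancel₀ e3
  rw [pow_succ (Z t - (a : ℂ))] at h4
  set p := (Z t - (a : ℂ)) ^ j
  linear_combination U t * Z t * h3 - (2 * U t * Z' + (j + 1 + 1) * U' * Z t) * h4

/-- Since 1/w = u/(z − 1), the derivative is the pullback of η. It follows from the product rule,
with u′ eliminated by the logarithmic derivative and K′ by the equation of `etaFactor`. -/
lemma etaPrim_hasDerivAt (hk0 : 0 < k) (ha : 1 < a) (hZ : HasDerivAt Z Z' t)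
    (hU : HasDerivAt U U' t) (h : ∀ᶠ s in 𝓝 t, SheetEq k a (Z s) (U s)) (hd : Z t ∈ domOne a)
    (h1 : Z t ≠ 1) :
    HasDerivAt (fun s => etaPrim k a (Z s) (U s)) (U t * Z' / (Z t * (Z t - 1))) t := by
  obtain ⟨K', hK, hode⟩ := etaFactor_hasDerivAt hk0 ha hd
  have e0 := ne_zero_of_mem_domOne hd
  have e1 : Z t - 1 ≠ 0 := sub_ne_zero.2 h1
  have e2 := sub_ne_zero_of_mem_domOne hd
  have e3 := succ_ne_zero' k
  have hl := sheetEq_logDeriv hk0 hZ hU h h1 (sub_ne_zero.1 e2)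
  have h2 := hU.fun_mul (hK.scomp t hZ)
  refine h2.congr_deriv ?_
  simp only [Function.comp_def, smul_eq_mul]
  rw [eq_div_iff (mul_ne_zero e0 e1)]
  apply mul_left_cancel₀ (mul_ne_zero e3 e2)
  linear_combination etaFactor k a (Z t) * hl + U t * Z' * hode

lemma dualPrim_hasDerivAt (hk : Even k) (hk0 : 0 < k) (ha : 1 < a) (hZ : HasDerivAt Z Z' t)
    (hU : HasDerivAt U U' t) (h : ∀ᶠ s in 𝓝 t, SheetEq k a (Z s) (U s)) (hd : Z t ∈ domOne a)
    (h1 : Z t ≠ 1) :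
    HasDerivAt (fun s => dualPrim k a (Z s) (U s)) (cSq k a * (Z t - 1) * Z' / (Z t * U t)) t := by
  obtain ⟨K', hK, hode⟩ := dualFactor_hasDerivAt hk hk0 ha hd
  have e0 := ne_zero_of_mem_domOne hd
  have e1 : Z t - 1 ≠ 0 := sub_ne_zero.2 h1
  have e2 := sub_ne_zero_of_mem_domOne hd
  have e3 := succ_ne_zero' k
  have hl := sheetEq_logDeriv hk0 hZ hU h h1 (sub_ne_zero.1 e2)
  have h4 : U t ^ (k + 1) * Z t ^ 2 = (Z t - 1) * (Z t - a) ^ k := h.self_of_nhds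
  have e4 : U t ≠ 0 := by
    intro h0
    rw [h0, zero_pow k.succ_ne_zero, zero_mul] at h4
    exact mul_ne_zero e1 (pow_ne_zero k e2) h4.symm
  have h2 := (hU.fun_pow (2 * k + 1)).fun_mul (hK.scomp t hZ)
  refine h2.congr_deriv ?_
  simp only [Function.comp_def, smul_eq_mul, Nat.add_sub_cancel]
  rw [eq_div_iff (mul_ne_zero e0 e4)]
  apply mul_left_cancel₀ (mul_ne_zero (mul_ne_zero e3 e2) (mul_ne_zero e1 (pow_ne_zero (2 * k) e2)))
  have h5 : U t ^ (2 * k) * U t ^ 2 * Z t ^ 4 = (Z t - 1) ^ 2 * (Z t - a) ^ (2 * k) := by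
    linear_combination (U t ^ (k + 1) * Z t ^ 2 + (Z t - 1) * (Z t - a) ^ k) * h4
  push_cast
  rw [pow_succ (U t) (2 * k)]
  set M := U t ^ (2 * k)
  set q := (Z t - (a : ℂ)) ^ (2 * k)
  linear_combination (2 * k + 1) * M * U t * q * dualFactor k a (Z t) * hl +
    M * U t ^ 2 * Z' * hode + (k + 1) * cSq k a * (Z t - a) * Z' * h5

/-- At a zero of `u` to second order the primitives are stationary. -/
lemma etaPrim_hasDerivAt_of_zero (hk0 : 0 < k) (ha : 1 < a) (hZ : HasDerivAt Z Z' t)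
    (hU : HasDerivAt U 0 t) (hd : Z t ∈ domOne a) (h0 : U t = 0) :
    HasDerivAt (fun s => etaPrim k a (Z s) (U s)) 0 t := by
  obtain ⟨K', hK, -⟩ := etaFactor_hasDerivAt hk0 ha hd
  refine (hU.fun_mul (hK.scomp t hZ)).congr_deriv ?_
  simp [h0]

lemma dualPrim_hasDerivAt_of_zero (hk : Even k) (hk0 : 0 < k) (ha : 1 < a)
    (hZ : HasDerivAt Z Z' t) (hU : HasDerivAt U 0 t) (hd : Z t ∈ domOne a) (h0 : U t = 0) :
    HasDerivAt (fun s => dualPrim k a (Z s) (U s)) 0 t := by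
  obtain ⟨K', hK, -⟩ := dualFactor_hasDerivAt hk hk0 ha hd
  refine ((hU.fun_pow (2 * k + 1)).fun_mul (hK.scomp t hZ)).congr_deriv ?_
  simp [h0]

end PathDerivative

/-! ### The two real period integrals and the closing equation -/

/-- The real `(k + 1)`-st root. -/
noncomputable def rroot (k : ℕ) (x : ℝ) : ℝ := x ^ (((k + 1 : ℕ) : ℝ)⁻¹)

lemma inv_succ_pos (k : ℕ) : (0 : ℝ) < ((k + 1 : ℕ) : ℝ)⁻¹ := by positivity

lemma rroot_nonneg (k : ℕ) {x : ℝ} (hx : 0 ≤ x) : 0 ≤ rroot k x := Real.rpow_nonneg hx _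

lemma rroot_pos (k : ℕ) {x : ℝ} (hx : 0 < x) : 0 < rroot k x := Real.rpow_pos_of_pos hx _

lemma rroot_one (k : ℕ) : rroot k 1 = 1 := Real.one_rpow _

lemma rroot_pow (k : ℕ) {x : ℝ} (hx : 0 ≤ x) : rroot k x ^ (k + 1) = x :=
  Real.rpow_inv_natCast_pow hx k.succ_ne_zero

lemma rroot_mul (k : ℕ) {x y : ℝ} (hx : 0 ≤ x) (hy : 0 ≤ y) :
    rroot k (x * y) = rroot k x * rroot k y := Real.mul_rpow hx hy

lemma rroot_div (k : ℕ) {x y : ℝ} (hx : 0 ≤ x) (hy : 0 ≤ y) :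
    rroot k (x / y) = rroot k x / rroot k y := Real.div_rpow hx hy _

lemma rroot_le (k : ℕ) {x y : ℝ} (hx : 0 ≤ x) (hxy : x ≤ y) : rroot k x ≤ rroot k y :=
  Real.rpow_le_rpow hx hxy (inv_succ_pos k).le

lemma rroot_lt (k : ℕ) {x y : ℝ} (hx : 0 ≤ x) (hxy : x < y) : rroot k x < rroot k y :=
  Real.rpow_lt_rpow hx hxy (inv_succ_pos k)

lemma continuous_rroot (k : ℕ) : Continuous (rroot k) :=
  Real.continuous_rpow_const (inv_succ_pos k).le

lemma rt_ofReal_eq (k : ℕ) {x : ℝ} (hx : 0 ≤ x) : rt k (x : ℂ) = (rroot k x : ℂ) := rt_ofReal k hx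

/-- The integrand `1 / (x |w|)` on the interval `(1, a)`. -/
noncomputable def segFun (k : ℕ) (a x : ℝ) : ℝ :=
  rroot k (a - x) ^ k / (x * rroot k x ^ 2 * rroot k (x - 1) ^ k)

/-- The integral of `|η|` over the interval `(1, a)`. -/
noncomputable def segInt (k : ℕ) (a : ℝ) : ℝ := ∫ x in (1 : ℝ)..a, segFun k a x

/-- The integrand of `endInt`, without its constant factor. -/
noncomputable def endFun (k : ℕ) (a x : ℝ) : ℝ :=
  rroot k x ^ 2 / x * rroot k (a * (1 - x) / (a - x)) ^ k

/-- The integral of `|g ^ 2 η|` over the interval `(0, 1)`. -/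
noncomputable def endInt (k : ℕ) (a : ℝ) : ℝ :=
  (rroot k a ^ 2)⁻¹ * ∫ x in (0 : ℝ)..1, endFun k a x

lemma intervalIntegrable_rroot_inv (k : ℕ) {b : ℝ} (hb : 0 ≤ b) :
    IntervalIntegrable (fun x => (rroot k x ^ k)⁻¹) volume 0 b := by
  have h : IntervalIntegrable (fun x : ℝ => x ^ (-((k : ℝ) / (k + 1)))) volume 0 b :=
    intervalIntegral.intervalIntegrable_rpow' (by
      rw [neg_lt_neg_iff, div_lt_one (by positivity)]; linarith)
  refine h.congr ?_
  intro x hx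
  rw [uIoc_of_le hb] at hx
  simp only [rroot]
  rw [← Real.rpow_natCast, ← Real.rpow_mul hx.1.le, ← Real.rpow_neg hx.1.le]
  congr 1
  push_cast
  field_simp

lemma intervalIntegrable_rroot_div (k : ℕ) :
    IntervalIntegrable (fun x => rroot k x ^ 2 / x) volume 0 1 := by
  have h : IntervalIntegrable (fun x : ℝ => x ^ (2 / ((k : ℝ) + 1) - 1)) volume 0 1 :=
    intervalIntegral.intervalIntegrable_rpow' (by
      have : (0 : ℝ) < 2 / ((k : ℝ) + 1) := by positivity
      linarith)
  refine h.congr ?_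
  intro x hx
  rw [uIoc_of_le zero_le_one] at hx
  simp only [rroot]
  rw [← Real.rpow_natCast, ← Real.rpow_mul hx.1.le, Real.rpow_sub hx.1, Real.rpow_one]
  congr 2
  push_cast
  field_simp

lemma intervalIntegrable_segFun (k : ℕ) (a : ℝ) {b : ℝ} (hb : 1 ≤ b) :
    IntervalIntegrable (segFun k a) volume 1 b := by
  have h1 := (intervalIntegrable_rroot_inv k (sub_nonneg.2 hb)).comp_sub_right 1
  simp only [zero_add, sub_add_cancel] at h1
  have h2 : ContinuousOn (fun x => rroot k (a - x) ^ k / (x * rroot k x ^ 2)) (uIcc 1 b) := by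
    have hc := continuous_rroot k
    refine ContinuousOn.div (by fun_prop) (by fun_prop) fun x hx => ?_
    rw [uIcc_of_le hb] at hx
    have hx0 : 0 < x := by linarith [hx.1]
    have := rroot_pos k hx0
    positivity
  refine (h1.mul_continuousOn h2).congr fun x _ => ?_
  simp only [segFun]
  rw [mul_comm, ← div_eq_mul_inv, div_div]

lemma segFun_nonneg (k : ℕ) {a x : ℝ} (hx : 1 ≤ x) (hxa : x ≤ a) : 0 ≤ segFun k a x := by
  have h1 := rroot_nonneg k (sub_nonneg.2 hx)
  have h2 := rroot_nonneg k (sub_nonneg.2 hxa)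
  have h3 : 0 ≤ x := by linarith
  rw [segFun]
  positivity

lemma segFun_pos (k : ℕ) {a x : ℝ} (hx : 1 < x) (hxa : x < a) : 0 < segFun k a x := by
  have h0 : 0 < x := by linarith
  have h1 := rroot_pos k (sub_pos.2 hx)
  have h2 := rroot_pos k (sub_pos.2 hxa)
  have h3 := rroot_pos k h0
  rw [segFun]
  positivity

lemma segFun_le (k : ℕ) {a b x : ℝ} (hx : 1 ≤ x) (hxa : x ≤ a) (hab : a ≤ b) :
    segFun k a x ≤ segFun k b x := by
  have h1 := rroot_nonneg k (sub_nonneg.2 hx)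
  have h2 := rroot_le k (sub_nonneg.2 hxa) (sub_le_sub_right hab x)
  have h4 := rroot_nonneg k (sub_nonneg.2 hxa)
  have h3 : 0 ≤ x := by linarith
  rw [segFun, segFun]
  gcongr

/-- Enlarging a enlarges both the integrand and the interval of integration. -/
lemma segInt_le (k : ℕ) {a b : ℝ} (ha : 1 ≤ a) (hab : a ≤ b) : segInt k a ≤ segInt k b := by
  have h1 : segInt k a ≤ ∫ x in (1 : ℝ)..a, segFun k b x :=
    intervalIntegral.integral_mono_on ha (intervalIntegrable_segFun k a ha)
      (intervalIntegrable_segFun k b ha) fun x hx => segFun_le k hx.1 hx.2 hab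
  refine h1.trans (intervalIntegral.integral_mono_interval le_rfl ha hab ?_
    (intervalIntegrable_segFun k b (ha.trans hab)))
  filter_upwards [ae_restrict_mem measurableSet_Ioc] with x hx
  exact segFun_nonneg k hx.1.le hx.2

lemma segInt_pos (k : ℕ) {a : ℝ} (ha : 1 < a) : 0 < segInt k a :=
  intervalIntegral.intervalIntegral_pos_of_pos_on (intervalIntegrable_segFun k a ha.le)
    (fun _ hx => segFun_pos k hx.1 hx.2) ha

/-- The integrand of `segInt` rescaled to the interval `(0, 1)`. -/
noncomputable def segScaled (k : ℕ) (a s : ℝ) : ℝ :=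
  (rroot k s ^ k)⁻¹ * (rroot k (1 - s) ^ k / ((1 + (a - 1) * s) * rroot k (1 + (a - 1) * s) ^ 2))

/-- Substitute x = 1 + (a − 1)s; the powers of a − 1 in numerator and denominator cancel. A fixed
interval is what dominated convergence needs for continuity in a. -/
lemma segInt_eq (k : ℕ) {a : ℝ} (ha : 1 ≤ a) :
    segInt k a = (a - 1) * ∫ s in (0 : ℝ)..1, segScaled k a s := by
  rcases ha.eq_or_lt with rfl | ha
  · simp [segInt]
  have h := intervalIntegral.mul_integral_comp_add_mul (a := 0) (b := 1) (f := segFun k a)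
    (a - 1) 1
  simp only [mul_zero, add_zero, mul_one, add_sub_cancel] at h
  rw [segInt, ← h]
  congr 1
  apply intervalIntegral.integral_congr_ae
  refine ae_of_all _ fun s hs => ?_
  rw [uIoc_of_le zero_le_one] at hs
  have ha' : 0 < a - 1 := sub_pos.2 ha
  have h1 : a - (1 + (a - 1) * s) = (a - 1) * (1 - s) := by ring
  have h2 : 1 + (a - 1) * s - 1 = (a - 1) * s := by ring
  simp only [segFun, segScaled]
  rw [h1, h2, rroot_mul k ha'.le hs.1.le, rroot_mul k ha'.le (sub_nonneg.2 hs.2), mul_pow, mul_pow]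
  have := rroot_pos k ha'
  have := rroot_pos k hs.1
  field_simp

lemma continuousOn_segInt (k : ℕ) : ContinuousOn (segInt k) (Ici 1) := by
  have h : ContinuousOn (fun a => (a - 1) * ∫ s in (0 : ℝ)..1, segScaled k a s) (Ici 1) := by
    refine ContinuousOn.mul (by fun_prop) fun a ha => ?_
    have hc := continuous_rroot k
    refine intervalIntegral.continuousWithinAt_of_dominated_interval
      (bound := fun s => (rroot k s ^ k)⁻¹) ?_ ?_ (intervalIntegrable_rroot_inv k zero_le_one) ?_
    · refine Eventually.of_forall fun b => Measurable.aestronglyMeasurable ?_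
      have := hc.measurable
      unfold segScaled
      fun_prop
    · filter_upwards [self_mem_nhdsWithin] with b hb
      refine ae_of_all _ fun s hs => ?_
      rw [uIoc_of_le zero_le_one] at hs
      have hb' : 0 ≤ (b - 1) * s := mul_nonneg (sub_nonneg.2 hb) hs.1.le
      have h1 : 1 ≤ 1 + (b - 1) * s := by linarith
      have h2 : 1 ≤ rroot k (1 + (b - 1) * s) := by
        simpa [rroot_one] using rroot_le k zero_le_one h1
      have h3 : rroot k (1 - s) ≤ 1 := by
        simpa [rroot_one] using rroot_le k (sub_nonneg.2 hs.2) (by linarith [hs.1] : 1 - s ≤ 1)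
      have h4 := rroot_nonneg k (sub_nonneg.2 hs.2)
      have h5 := rroot_nonneg k hs.1.le
      have h6 : 1 ≤ (1 + (b - 1) * s) * rroot k (1 + (b - 1) * s) ^ 2 :=
        one_le_mul_of_one_le_of_one_le h1 (one_le_pow₀ h2)
      rw [segScaled, Real.norm_of_nonneg (by positivity)]
      refine mul_le_of_le_one_right (by positivity) ?_
      rw [div_le_one (by positivity)]
      exact (pow_le_one₀ h4 h3).trans h6
    · refine ae_of_all _ fun s hs => ?_
      rw [uIoc_of_le zero_le_one] at hs
      have hb' : 0 ≤ (a - 1) * s := mul_nonneg (sub_nonneg.2 ha) hs.1.le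
      have h1 : 0 < 1 + (a - 1) * s := by linarith
      have h2 := rroot_pos k h1
      apply ContinuousAt.continuousWithinAt
      unfold segScaled
      refine continuousAt_const.mul (continuousAt_const.div (by fun_prop) (by positivity))
  exact h.congr fun a ha => segInt_eq k ha

lemma measurable_endFun (k : ℕ) (a : ℝ) : Measurable (endFun k a) := by
  have := (continuous_rroot k).measurable
  unfold endFun
  fun_prop

lemma end_ratio_nonneg {a x : ℝ} (ha : 1 ≤ a) (hx : x ≤ 1) : 0 ≤ a * (1 - x) / (a - x) :=
  div_nonneg (mul_nonneg (by linarith) (by linarith)) (by linarith)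

lemma end_ratio_le_one {a x : ℝ} (ha : 1 ≤ a) (hx0 : 0 ≤ x) (hx : x ≤ 1) :
    a * (1 - x) / (a - x) ≤ 1 :=
  div_le_one_of_le₀ (by nlinarith) (by linarith)

/-- After cross multiplication the difference is x(1 − x)(b − a). -/
lemma end_ratio_le {a b x : ℝ} (ha : 1 ≤ a) (hab : a ≤ b) (hx0 : 0 ≤ x) (hx : x < 1) :
    b * (1 - x) / (b - x) ≤ a * (1 - x) / (a - x) := by
  rw [div_le_div_iff₀ (by linarith) (by linarith)]
  have := mul_nonneg (mul_nonneg hx0 (sub_nonneg.2 hab)) (sub_nonneg.2 hx.le)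
  nlinarith

lemma endFun_nonneg (k : ℕ) {a x : ℝ} (ha : 1 ≤ a) (hx0 : 0 ≤ x) (hx : x ≤ 1) :
    0 ≤ endFun k a x := by
  have h1 := rroot_nonneg k (end_ratio_nonneg ha hx)
  rw [endFun]
  positivity

lemma endFun_pos (k : ℕ) {a x : ℝ} (ha : 1 ≤ a) (hx0 : 0 < x) (hx : x < 1) :
    0 < endFun k a x := by
  have h1 := rroot_pos k (div_pos (mul_pos (by linarith) (by linarith)) (by linarith) :
    0 < a * (1 - x) / (a - x))
  have h2 := rroot_pos k hx0
  rw [endFun]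
  positivity

lemma endFun_le_bound (k : ℕ) {a x : ℝ} (ha : 1 ≤ a) (hx0 : 0 ≤ x) (hx : x ≤ 1) :
    endFun k a x ≤ rroot k x ^ 2 / x := by
  have h1 := rroot_nonneg k (end_ratio_nonneg ha hx)
  have h2 : rroot k (a * (1 - x) / (a - x)) ≤ 1 := by
    simpa [rroot_one] using rroot_le k (end_ratio_nonneg ha hx) (end_ratio_le_one ha hx0 hx)
  rw [endFun]
  exact mul_le_of_le_one_right (by positivity) (pow_le_one₀ h1 h2)

lemma intervalIntegrable_endFun (k : ℕ) {a : ℝ} (ha : 1 ≤ a) :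
    IntervalIntegrable (endFun k a) volume 0 1 := by
  refine (intervalIntegrable_rroot_div k).mono_fun (measurable_endFun k a).aestronglyMeasurable ?_
  filter_upwards [ae_restrict_mem measurableSet_uIoc] with x hx
  rw [uIoc_of_le zero_le_one] at hx
  rw [Real.norm_of_nonneg (endFun_nonneg k ha hx.1.le hx.2)]
  exact (endFun_le_bound k ha hx.1.le hx.2).trans (le_abs_self _)

lemma endFun_le (k : ℕ) {a b x : ℝ} (ha : 1 ≤ a) (hab : a ≤ b) (hx0 : 0 ≤ x) (hx : x < 1) :
    endFun k b x ≤ endFun k a x := by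
  have h1 := rroot_nonneg k (end_ratio_nonneg (ha.trans hab) hx.le)
  have h2 := rroot_le k (end_ratio_nonneg (ha.trans hab) hx.le) (end_ratio_le ha hab hx0 hx)
  rw [endFun, endFun]
  gcongr

lemma integral_endFun_pos (k : ℕ) {a : ℝ} (ha : 1 ≤ a) : 0 < ∫ x in (0 : ℝ)..1, endFun k a x :=
  intervalIntegral.intervalIntegral_pos_of_pos_on (intervalIntegrable_endFun k ha)
    (fun _ hx => endFun_pos k ha hx.1 hx.2) zero_lt_one

/-- The integral is only shown to be weakly decreasing; strictness comes from the prefactor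
a^(−2/(k+1)). -/
lemma endInt_lt (k : ℕ) {a b : ℝ} (ha : 1 ≤ a) (hab : a < b) : endInt k b < endInt k a := by
  have h1 : ∫ x in (0 : ℝ)..1, endFun k b x ≤ ∫ x in (0 : ℝ)..1, endFun k a x := by
    refine intervalIntegral.integral_mono_on_of_le_Ioo zero_le_one
      (intervalIntegrable_endFun k (ha.trans hab.le)) (intervalIntegrable_endFun k ha) ?_
    exact fun x hx => endFun_le k ha hab.le hx.1.le hx.2
  have h2 := integral_endFun_pos k (ha.trans hab.le)
  have ha0 : 0 < a := by linarith
  have h3 := rroot_pos k ha0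
  have h4 := rroot_lt k ha0.le hab
  rw [endInt, endInt]
  refine mul_lt_mul ?_ h1 h2 (by positivity)
  gcongr

lemma endInt_pos (k : ℕ) {a : ℝ} (ha : 1 ≤ a) : 0 < endInt k a := by
  have := rroot_pos k (by linarith : 0 < a)
  have := integral_endFun_pos k ha
  rw [endInt]
  positivity

lemma continuousOn_endInt (k : ℕ) : ContinuousOn (endInt k) (Ici 1) := by
  have hc := continuous_rroot k
  unfold endInt
  refine ContinuousOn.mul (ContinuousOn.inv₀ (by fun_prop) fun a ha => ?_) fun a ha => ?_
  · have := rroot_pos k (lt_of_lt_of_le zero_lt_one ha)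
    positivity
  · refine intervalIntegral.continuousWithinAt_of_dominated_interval
      (bound := fun x => rroot k x ^ 2 / x) ?_ ?_ (intervalIntegrable_rroot_div k) ?_
    · exact Eventually.of_forall fun b => (measurable_endFun k b).aestronglyMeasurable
    · filter_upwards [self_mem_nhdsWithin] with b hb
      refine ae_of_all _ fun x hx => ?_
      rw [uIoc_of_le zero_le_one] at hx
      rw [Real.norm_of_nonneg (endFun_nonneg k hb hx.1.le hx.2)]
      exact endFun_le_bound k hb hx.1.le hx.2
    · refine ae_of_all _ fun x hx => ?_
      rw [uIoc_of_le zero_le_one] at hx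
      -- At x = 1 the ratio may be 0/0, namely when a = 1; with the convention 0/0 = 0 the integrand
      -- is there constant in the parameter.
      rcases hx.2.eq_or_lt with rfl | hx1
      · simp only [endFun, sub_self, mul_zero, zero_div]
        exact continuousWithinAt_const
      · apply ContinuousAt.continuousWithinAt
        have hax : a - x ≠ 0 := by
          have : (1 : ℝ) ≤ a := ha
          exact (sub_pos.2 (hx1.trans_le this)).ne'
        have h1 : ContinuousAt (fun b => b * (1 - x) / (b - x)) a :=
          ContinuousAt.div (by fun_prop) (by fun_prop) hax
        unfold endFun
        exact continuousAt_const.mul ((hc.continuousAt.comp h1).pow k)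

/-- The integrand is bounded by its factor x^(2/(k+1) − 1), independently of a, while the prefactor
tends to 0. -/
lemma tendsto_endInt (k : ℕ) : Tendsto (endInt k) atTop (𝓝 0) := by
  have h1 : Tendsto (fun a => (rroot k a ^ 2)⁻¹ * ∫ x in (0 : ℝ)..1, rroot k x ^ 2 / x) atTop
      (𝓝 (0 * ∫ x in (0 : ℝ)..1, rroot k x ^ 2 / x)) := by
    refine Tendsto.mul_const _ (tendsto_inv_atTop_zero.comp ?_)
    exact (tendsto_pow_atTop two_ne_zero).comp (tendsto_rpow_atTop (inv_succ_pos k))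
  rw [zero_mul] at h1
  refine tendsto_of_tendsto_of_tendsto_of_le_of_le' tendsto_const_nhds h1 ?_ ?_
  · filter_upwards [eventually_ge_atTop 1] with a ha using (endInt_pos k ha).le
  · filter_upwards [eventually_ge_atTop 1] with a ha
    rw [endInt]
    refine mul_le_mul_of_nonneg_left ?_ (by positivity)
    refine intervalIntegral.integral_mono_on zero_le_one
      (intervalIntegrable_endFun k ha) (intervalIntegrable_rroot_div k) ?_
    exact fun x hx => endFun_le_bound k ha hx.1 hx.2

/-- The real equation that closes the periods has exactly one solution. -/
theorem existsUnique_closing (k : ℕ) {p q : ℝ} (hp : 0 < p) (hq : 0 < q) :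
    ∃! a : ℝ, 1 < a ∧ p * segInt k a = q * endInt k a := by
  set F : ℝ → ℝ := fun a => p * segInt k a - q * endInt k a with hF
  have hmono : StrictMonoOn F (Ici 1) := by
    intro a ha b hb hab
    have h1 := mul_le_mul_of_nonneg_left (segInt_le k ha hab.le) hp.le
    have h2 := mul_lt_mul_of_pos_left (endInt_lt k ha hab) hq
    simp only [hF]
    linarith
  have hcont : ContinuousOn F (Ici 1) :=
    (continuousOn_const.mul (continuousOn_segInt k)).sub
      (continuousOn_const.mul (continuousOn_endInt k))
  have h1 : F 1 < 0 := by
    have := mul_pos hq (endInt_pos k le_rfl)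
    simp only [hF, segInt, intervalIntegral.integral_same]
    linarith
  obtain ⟨b, hb2, hb⟩ : ∃ b, 2 ≤ b ∧ 0 < F b := by
    -- For a ≥ 2 the first term stays above its positive value at 2, while the second tends to 0.
    have h2 : 0 < p * segInt k 2 := mul_pos hp (segInt_pos k one_lt_two)
    have h3 := (tendsto_endInt k).const_mul q
    rw [mul_zero] at h3
    obtain ⟨b, hb, hb2⟩ := ((h3.eventually_lt_const h2).and (eventually_ge_atTop 2)).exists
    refine ⟨b, hb2, ?_⟩
    have h4 := mul_le_mul_of_nonneg_left (segInt_le k one_le_two hb2) hp.le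
    simp only [hF]
    linarith
  obtain ⟨a, ha, hFa⟩ := intermediate_value_Icc (by linarith : (1 : ℝ) ≤ b)
    (hcont.mono Icc_subset_Ici_self) ⟨h1.le, hb.le⟩
  have ha1 : 1 < a := by
    rcases ha.1.eq_or_lt with h | h
    · rw [← h] at hFa; exact absurd hFa h1.ne
    · exact h
  refine ⟨a, ⟨ha1, sub_eq_zero.1 hFa⟩, ?_⟩
  rintro c ⟨hc, hFc⟩
  exact hmono.injOn hc.le ha1.le ((sub_eq_zero.2 hFc).trans hFa.symm)

/-! ### Branches of w and u over the slit domains, and the involution -/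

/-- The branch of `w` on `domMid a` that is positive on `(1, a)`. -/
noncomputable def wMid (k : ℕ) (a : ℝ) (z : ℂ) : ℂ := rt k (z - 1) ^ k / unitFactor k a z

/-- The branch of `u` belonging to `wMid`. -/
noncomputable def uMid (k : ℕ) (a : ℝ) (z : ℂ) : ℂ := rt k (z - 1) * unitFactor k a z

/-- The branch of `w` on `domUnit` that is positive on `(0, 1)`. -/
noncomputable def wUnit (k : ℕ) (a : ℝ) (z : ℂ) : ℂ := rt k (1 - z) ^ k / unitFactor k a z

/-- The branch of `u` belonging to `wUnit`. -/
noncomputable def uUnit (k : ℕ) (a : ℝ) (z : ℂ) : ℂ := -rt k (1 - z) * unitFactor k a z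

/-- The branch of `w` on `domNeg` that is positive on `(-∞, 0)`. -/
noncomputable def wNeg (k : ℕ) (a : ℝ) (z : ℂ) : ℂ :=
  rt k (-z) ^ 2 * rt k (1 - z) ^ k / rt k (a - z) ^ k

/-- The branch of `u` belonging to `wNeg`. -/
noncomputable def uNeg (k : ℕ) (a : ℝ) (z : ℂ) : ℂ := (z - 1) / wNeg k a z

/-- The holomorphic factor of the primitive of `g ^ 2 η` that vanishes at the end `(0, 0)`. -/
noncomputable def zeroFactor (k : ℕ) (a : ℝ) : ℂ → ℂ :=
  eulerIntegral 2 (k + 1) (fun s => rt k (1 - s) ^ k / rt k (a - s) ^ k)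

/-- The primitive of `g ^ 2 η` on the sheet `wUnit` that vanishes at the end `(0, 0)`. -/
noncomputable def dualUnit (k : ℕ) (a : ℝ) (z : ℂ) : ℂ := cSq k a * rt k z ^ 2 * zeroFactor k a z

/-- The primitive of `g ^ 2 η` on the sheet `wNeg` that vanishes at the end `(0, 0)`. -/
noncomputable def dualNeg (k : ℕ) (a : ℝ) (z : ℂ) : ℂ := cSq k a * rt k (-z) ^ 2 * zeroFactor k a z

/-- The primitive of `η` on the sheet `wNeg` that vanishes at the end `(∞, ∞)`. -/
noncomputable def etaNeg (k : ℕ) (a : ℝ) (z : ℂ) : ℂ := -dualNeg k a (a / z)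

lemma rt_pow_pow (k j : ℕ) (z : ℂ) : (rt k z ^ j) ^ (k + 1) = z ^ j := by
  rw [← pow_mul, mul_comm, pow_mul, rt_pow]

lemma rroot_pow_pow (k j : ℕ) {x : ℝ} (hx : 0 ≤ x) : (rroot k x ^ j) ^ (k + 1) = x ^ j := by
  rw [← pow_mul, mul_comm, pow_mul, rroot_pow k hx]

lemma hasDerivAt_rt_one_sub (k : ℕ) {z : ℂ} (hz : 1 - z ∈ Complex.slitPlane) :
    HasDerivAt (fun z => rt k (1 - z)) (-(rt k (1 - z) / ((k + 1) * (1 - z)))) z :=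
  ((hasDerivAt_rt k hz).comp z ((hasDerivAt_id z).const_sub (1 : ℂ))).congr_deriv (by simp)

lemma hasDerivAt_rt_sub_one (k : ℕ) {z : ℂ} (hz : z - 1 ∈ Complex.slitPlane) :
    HasDerivAt (fun z => rt k (z - 1)) (rt k (z - 1) / ((k + 1) * (z - 1))) z :=
  HasDerivAt.comp_sub_const z 1 (hasDerivAt_rt k hz)

lemma hasDerivAt_rt_const_sub (k : ℕ) {z : ℂ} (hz : (a : ℂ) - z ∈ Complex.slitPlane) :
    HasDerivAt (fun z => rt k (a - z)) (-(rt k (a - z) / ((k + 1) * (a - z)))) z :=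
  ((hasDerivAt_rt k hz).comp z ((hasDerivAt_id z).const_sub (a : ℂ))).congr_deriv (by simp)

lemma hasDerivAt_rt_neg (k : ℕ) {z : ℂ} (hz : -z ∈ Complex.slitPlane) :
    HasDerivAt (fun z => rt k (-z)) (rt k (-z) / ((k + 1) * z)) z := by
  refine ((hasDerivAt_rt k hz).comp z (hasDerivAt_neg z)).congr_deriv ?_
  have := Complex.slitPlane_ne_zero hz
  have h2 : z ≠ 0 := neg_ne_zero.1 this
  have := succ_ne_zero' k
  field_simp

lemma sheetEq_uMid (hk : Even k) {z : ℂ} (hz : z ≠ 0) : SheetEq k a z (uMid k a z) := by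
  rw [SheetEq, uMid, mul_pow, rt_pow, unitFactor_pow hk]
  field_simp

lemma sheetEq_uUnit (hk : Even k) {z : ℂ} (hz : z ≠ 0) : SheetEq k a z (uUnit k a z) := by
  rw [SheetEq, uUnit, mul_pow, hk.add_one.neg_pow, rt_pow, unitFactor_pow hk]
  field_simp
  ring

lemma uMid_mul_wMid {z : ℂ} (hz : z ∈ domOne a) : uMid k a z * wMid k a z = z - 1 := by
  have := unitFactor_ne_zero (k := k) hz
  rw [uMid, wMid]
  field_simp
  rw [mul_comm, ← pow_succ, rt_pow]

lemma uUnit_mul_wUnit {z : ℂ} (hz : z ∈ domOne a) : uUnit k a z * wUnit k a z = z - 1 := by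
  have := unitFactor_ne_zero (k := k) hz
  rw [uUnit, wUnit]
  field_simp
  rw [mul_comm, ← pow_succ, rt_pow]
  ring

lemma wMid_ne_zero {z : ℂ} (hz : z ∈ domMid a) : wMid k a z ≠ 0 :=
  div_ne_zero (pow_ne_zero _ (rt_ne_zero k (Complex.slitPlane_ne_zero hz.1)))
    (unitFactor_ne_zero (domMid_subset_domOne hz))

lemma wUnit_ne_zero (ha : 1 < a) {z : ℂ} (hz : z ∈ domUnit) : wUnit k a z ≠ 0 :=
  div_ne_zero (pow_ne_zero _ (rt_ne_zero k (Complex.slitPlane_ne_zero hz.2)))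
    (unitFactor_ne_zero (domUnit_subset_domOne ha hz))

lemma wNeg_ne_zero (ha : 1 < a) {z : ℂ} (hz : z ∈ domNeg) : wNeg k a z ≠ 0 :=
  div_ne_zero (mul_ne_zero (pow_ne_zero _ (rt_ne_zero k (Complex.slitPlane_ne_zero hz)))
    (pow_ne_zero _ (rt_ne_zero k (Complex.slitPlane_ne_zero (domNeg_subset_domZero hz)))))
    (pow_ne_zero _ (rt_ne_zero k (Complex.slitPlane_ne_zero
      (sub_mem_slitPlane_of_one ha (domNeg_subset_domZero hz)))))

lemma wMid_pow (hk : Even k) {z : ℂ} (hz : z ∈ domOne a) :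
    wMid k a z ^ (k + 1) * (z - a) ^ k = z ^ 2 * (z - 1) ^ k := by
  have h0 := ne_zero_of_mem_domOne hz
  have h1 := sub_ne_zero_of_mem_domOne hz
  rw [wMid, div_pow, rt_pow_pow, unitFactor_pow hk]
  field_simp

lemma wNeg_pow (hk : Even k) (ha : 1 < a) {z : ℂ} (hz : z ∈ domNeg) :
    wNeg k a z ^ (k + 1) * (z - a) ^ k = z ^ 2 * (z - 1) ^ k := by
  have h1 := Complex.slitPlane_ne_zero (sub_mem_slitPlane_of_one ha (domNeg_subset_domZero hz))
  have e1 : (z - a) ^ k = (a - z) ^ k := by rw [← neg_sub, hk.neg_pow]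
  have e2 : (z - 1) ^ k = (1 - z) ^ k := by rw [← neg_sub, hk.neg_pow]
  rw [wNeg, div_pow, mul_pow, rt_pow_pow, rt_pow_pow, rt_pow_pow, e1, e2, neg_sq]
  field_simp

/-- The exponent of c is half of (k − 2)/(k + 1), so c² is a quotient of powers of the real root of
a. -/
lemma cSq_eq (ha : 0 < a) : cSq k a = ((rroot k a ^ k / rroot k a ^ 2 : ℝ) : ℂ) := by
  rw [cSq, ← Complex.ofReal_pow]
  congr 1
  simp only [gaussConst, rroot]
  rw [← Real.rpow_natCast, ← Real.rpow_mul ha.le, ← Real.rpow_natCast (a ^ _) k,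
    ← Real.rpow_mul ha.le, ← Real.rpow_natCast (a ^ _) 2, ← Real.rpow_mul ha.le, ← Real.rpow_sub ha]
  congr 1
  push_cast
  field_simp

lemma cSq_ne_zero (ha : 0 < a) : cSq k a ≠ 0 := by
  rw [cSq_eq ha]
  have := rroot_pos k ha
  exact_mod_cast (by positivity)

lemma cSq_pow (ha : 0 < a) : cSq k a ^ (k + 1) * (a : ℂ) ^ 2 = (a : ℂ) ^ k := by
  rw [cSq_eq ha]
  norm_cast
  rw [div_pow, rroot_pow_pow k _ ha.le, rroot_pow_pow k _ ha.le]
  field_simp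

/-- A branch of `w` on a connected domain invariant under `z ↦ a / z` is compatible with the
involution `(z, w) ↦ (a / z, 1 / (c ^ 2 w))` if it is at one point. -/
lemma branch_involution (hk : Even k) (ha : 1 < a) {S : Set ℂ} (hS : IsPreconnected S)
    (hdiv : ∀ z ∈ S, (a : ℂ) / z ∈ S) {w : ℂ → ℂ} (hw : ContinuousOn w S)
    (h0 : ∀ z ∈ S, z ≠ 0) (h1 : ∀ z ∈ S, z ≠ 1) (h2 : ∀ z ∈ S, z ≠ a)
    (hpow : ∀ z ∈ S, w z ^ (k + 1) * (z - a) ^ k = z ^ 2 * (z - 1) ^ k)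
    {x : ℝ} (hx : (x : ℂ) ∈ S) (hxa : x ^ 2 = a) {y : ℝ} (hy : 0 < y) (hwy : w x = y)
    {z : ℂ} (hz : z ∈ S) : w (a / z) * cSq k a * w z = 1 := by
  have ha0 : 0 < a := by linarith
  have haC : (a : ℂ) ≠ 0 := by exact_mod_cast ha0.ne'
  have hcont : ContinuousOn (fun z => w (a / z) * cSq k a * w z) S :=
    ((hw.comp (continuousOn_const.div continuousOn_id h0) hdiv).mul continuousOn_const).mul hw
  have hpow1 : ∀ z ∈ S, (w (a / z) * cSq k a * w z) ^ (k + 1) = 1 := by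
    intro z hz
    have e0 := h0 z hz
    have e1 := sub_ne_zero.2 (h1 z hz)
    have e2 := sub_ne_zero.2 (h2 z hz)
    have p1 := hpow z hz
    have p2 := hpow _ (hdiv z hz)
    have p3 := cSq_pow (k := k) ha0
    have q1 : (a : ℂ) / z - a = -(a * (z - 1) / z) := by field_simp; ring
    have q2 : (a : ℂ) / z - 1 = -((z - a) / z) := by field_simp; ring
    rw [q1, q2, hk.neg_pow, hk.neg_pow, div_pow, div_pow, div_pow, mul_pow] at p2
    have f1 := pow_ne_zero k e1
    have f2 := pow_ne_zero k e2
    have f3 := pow_ne_zero k e0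
    have f4 := pow_ne_zero k haC
    rw [mul_pow, mul_pow]
    generalize w (a / z) ^ (k + 1) = A at *
    generalize w z ^ (k + 1) = B at *
    generalize cSq k a ^ (k + 1) = C at *
    have p1' : B = z ^ 2 * (z - 1) ^ k / (z - a) ^ k := by rw [eq_div_iff f2, p1]
    have p3' : C = a ^ k / a ^ 2 := by rw [eq_div_iff (by positivity), p3]
    have p2' : A = a ^ 2 / z ^ 2 * ((z - a) ^ k / z ^ k) / (a ^ k * (z - 1) ^ k / z ^ k) := by
      rw [eq_div_iff (div_ne_zero (mul_ne_zero f4 f1) f3), p2]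
    rw [p1', p2', p3']
    field_simp
  have hx0 : x ≠ 0 := by rintro rfl; simp at hxa; linarith
  have hpt : (a : ℂ) / x = x := by
    rw [div_eq_iff (by exact_mod_cast hx0)]
    exact_mod_cast (by rw [← hxa]; ring)
  -- The product is a continuous root of unity on a connected set. At the fixed point x of the
  -- involution it equals c²y² > 0, and the only nonnegative root of unity is 1.
  refine eq_one_of_pow_eq_one hS hcont k.succ_pos hpow1 hx ?_ hz
  have h3 := hpow1 x hx
  simp only [hpt, hwy, cSq_eq ha0] at h3 ⊢
  have hr := rroot_pos k ha0
  norm_cast at h3 ⊢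
  exact (pow_eq_one_iff_of_nonneg (by positivity) k.succ_ne_zero).1 h3

lemma wMid_hasDerivAt (hk0 : 0 < k) {z : ℂ} (hz : z ∈ domMid a) :
    DifferentiableAt ℂ (wMid k a) z :=
  ((hasDerivAt_rt_sub_one k hz.1).differentiableAt.pow k).div
    (hasDerivAt_unitFactor hk0 (domMid_subset_domOne hz)).differentiableAt
    (unitFactor_ne_zero (domMid_subset_domOne hz))

lemma uMid_differentiableAt (hk0 : 0 < k) {z : ℂ} (hz : z ∈ domMid a) :
    DifferentiableAt ℂ (uMid k a) z :=
  (hasDerivAt_rt_sub_one k hz.1).differentiableAt.mul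
    (hasDerivAt_unitFactor hk0 (domMid_subset_domOne hz)).differentiableAt

lemma uUnit_differentiableAt (hk0 : 0 < k) (ha : 1 < a) {z : ℂ} (hz : z ∈ domUnit) :
    DifferentiableAt ℂ (uUnit k a) z :=
  (hasDerivAt_rt_one_sub k hz.2).differentiableAt.neg.mul
    (hasDerivAt_unitFactor hk0 (domUnit_subset_domOne ha hz)).differentiableAt

lemma wNeg_differentiableAt (ha : 1 < a) {z : ℂ} (hz : z ∈ domNeg) :
    DifferentiableAt ℂ (wNeg k a) z := by
  have h1 : 1 - z ∈ Complex.slitPlane := domNeg_subset_domZero hz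
  have h2 := sub_mem_slitPlane_of_one ha h1
  exact (((hasDerivAt_rt_neg k hz).differentiableAt.pow 2).mul
    ((hasDerivAt_rt_one_sub k h1).differentiableAt.pow k)).div
    ((hasDerivAt_rt_const_sub k h2).differentiableAt.pow k)
    (pow_ne_zero _ (rt_ne_zero k (Complex.slitPlane_ne_zero h2)))

lemma ne_zero_of_mem_domMid {z : ℂ} (hz : z ∈ domMid a) : z ≠ 0 :=
  ne_zero_of_mem_domOne (domMid_subset_domOne hz)

lemma ne_one_of_mem_domMid {z : ℂ} (hz : z ∈ domMid a) : z ≠ 1 :=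
  sub_ne_zero.1 (Complex.slitPlane_ne_zero hz.1)

lemma ne_zero_of_mem_domNeg {z : ℂ} (hz : z ∈ domNeg) : z ≠ 0 :=
  neg_ne_zero.1 (Complex.slitPlane_ne_zero hz)

lemma ne_one_of_mem_domNeg {z : ℂ} (hz : z ∈ domNeg) : z ≠ 1 :=
  (sub_ne_zero.1 (Complex.slitPlane_ne_zero (domNeg_subset_domZero hz))).symm

lemma ne_pole_of_mem_domNeg (ha : 1 < a) {z : ℂ} (hz : z ∈ domNeg) : z ≠ a :=
  (sub_ne_zero.1 (Complex.slitPlane_ne_zero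
    (sub_mem_slitPlane_of_one ha (domNeg_subset_domZero hz)))).symm

lemma wMid_ofReal {x : ℝ} (h1 : 1 < x) (h2 : x < a) :
    wMid k a x = ((rroot k (x - 1) ^ k * rroot k x ^ 2 / rroot k (a - x) ^ k : ℝ) : ℂ) := by
  have e1 := rt_ofReal_eq k (sub_pos.2 h1).le
  have e2 := rt_ofReal_eq k (sub_pos.2 h2).le
  have e3 := rt_ofReal_eq k (zero_lt_one.trans h1).le
  push_cast at e1 e2 e3 ⊢
  rw [wMid, unitFactor, e1, e2, e3, div_div_eq_mul_div]

lemma wNeg_ofReal (ha : 1 < a) {x : ℝ} (h : x < 0) :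
    wNeg k a x = ((rroot k (-x) ^ 2 * rroot k (1 - x) ^ k / rroot k (a - x) ^ k : ℝ) : ℂ) := by
  have e1 := rt_ofReal_eq k (neg_pos.2 h).le
  have e2 := rt_ofReal_eq k (by linarith : 0 ≤ 1 - x)
  have e3 := rt_ofReal_eq k (by linarith : 0 ≤ a - x)
  push_cast at e1 e2 e3 ⊢
  rw [wNeg, e1, e2, e3]

/-- The fixed point √a of z ↦ a/z lies in (1, a), where this branch is positive; `wNeg` is treated
in the same way at −√a. -/
lemma wMid_involution (hk : Even k) (hk0 : 0 < k) (ha : 1 < a) {z : ℂ} (hz : z ∈ domMid a) :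
    wMid k a (a / z) * cSq k a * wMid k a z = 1 := by
  have ha0 : (0 : ℝ) ≤ a := by linarith
  have h1 : 1 < √a := by rw [Real.lt_sqrt] <;> linarith
  have h2 : √a < a := by rw [Real.sqrt_lt'] <;> nlinarith
  have r1 := rroot_pos k (sub_pos.2 h1)
  have r2 := rroot_pos k (sub_pos.2 h2)
  have r3 := rroot_pos k (zero_lt_one.trans h1)
  exact branch_involution hk ha (isPreconnected_domMid ha) (fun z hz => div_mem_domMid ha hz)
    (fun z hz => (wMid_hasDerivAt hk0 hz).continuousAt.continuousWithinAt)
    (fun z hz => ne_zero_of_mem_domMid hz) (fun z hz => ne_one_of_mem_domMid hz)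
    (fun z hz => sub_ne_zero.1 (sub_ne_zero_of_mem_domOne (domMid_subset_domOne hz)))
    (fun z hz => wMid_pow hk (domMid_subset_domOne hz)) (ofReal_mem_domMid h1 h2)
    (Real.sq_sqrt ha0) (by positivity) (wMid_ofReal h1 h2) hz

lemma wNeg_involution (hk : Even k) (ha : 1 < a) {z : ℂ} (hz : z ∈ domNeg) :
    wNeg k a (a / z) * cSq k a * wNeg k a z = 1 := by
  have ha0 : (0 : ℝ) ≤ a := by linarith
  have h1 : 1 < √a := by rw [Real.lt_sqrt] <;> linarith
  have h2 : -√a < 0 := by linarith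
  have r1 := rroot_pos k (neg_pos.2 h2)
  have r2 := rroot_pos k (by linarith : 0 < 1 - -√a)
  have r3 := rroot_pos k (by linarith : 0 < a - -√a)
  exact branch_involution hk ha isPreconnected_domNeg (fun z hz => div_mem_domNeg ha hz)
    (fun z hz => (wNeg_differentiableAt ha hz).continuousAt.continuousWithinAt)
    (fun z hz => ne_zero_of_mem_domNeg hz) (fun z hz => ne_one_of_mem_domNeg hz)
    (fun z hz => ne_pole_of_mem_domNeg ha hz)
    (fun z hz => wNeg_pow hk ha hz) (ofReal_mem_domNeg h2)
    (by rw [neg_sq, Real.sq_sqrt ha0]) (by positivity) (wNeg_ofReal ha h2) hz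

lemma etaPrim_uMid_hasDerivAt (hk : Even k) (hk0 : 0 < k) (ha : 1 < a) {z : ℂ}
    (hz : z ∈ domMid a) :
    HasDerivAt (fun z => etaPrim k a z (uMid k a z)) (1 / (z * wMid k a z)) z := by
  have h := etaPrim_hasDerivAt (Z := fun z => z) hk0 ha (hasDerivAt_id' z)
    (uMid_differentiableAt hk0 hz).hasDerivAt
    (by filter_upwards [(isOpen_domMid a).mem_nhds hz] with y hy using
      sheetEq_uMid hk (ne_zero_of_mem_domMid hy))
    (domMid_subset_domOne hz) (ne_one_of_mem_domMid hz)
  refine h.congr_deriv ?_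
  have h1 := uMid_mul_wMid (k := k) (domMid_subset_domOne hz)
  have h2 := wMid_ne_zero (k := k) hz
  have h3 := ne_zero_of_mem_domMid hz
  have h4 := sub_ne_zero.2 (ne_one_of_mem_domMid hz)
  field_simp
  linear_combination h1

lemma dualPrim_uMid_hasDerivAt (hk : Even k) (hk0 : 0 < k) (ha : 1 < a) {z : ℂ}
    (hz : z ∈ domMid a) :
    HasDerivAt (fun z => dualPrim k a z (uMid k a z)) (cSq k a * wMid k a z / z) z := by
  have h := dualPrim_hasDerivAt (Z := fun z => z) hk hk0 ha (hasDerivAt_id' z)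
    (uMid_differentiableAt hk0 hz).hasDerivAt
    (by filter_upwards [(isOpen_domMid a).mem_nhds hz] with y hy using
      sheetEq_uMid hk (ne_zero_of_mem_domMid hy))
    (domMid_subset_domOne hz) (ne_one_of_mem_domMid hz)
  refine h.congr_deriv ?_
  have h1 := uMid_mul_wMid (k := k) (domMid_subset_domOne hz)
  have h3 := ne_zero_of_mem_domMid hz
  have h4 := sub_ne_zero.2 (ne_one_of_mem_domMid hz)
  have h2 : uMid k a z ≠ 0 := fun h => h4 (by rw [← h1, h, zero_mul])
  rw [← h1]
  field_simp

lemma dualPrim_uUnit_hasDerivAt (hk : Even k) (hk0 : 0 < k) (ha : 1 < a) {z : ℂ}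
    (hz : z ∈ domUnit) :
    HasDerivAt (fun z => dualPrim k a z (uUnit k a z)) (cSq k a * wUnit k a z / z) z := by
  have h4 : z - 1 ≠ 0 := by
    have := Complex.slitPlane_ne_zero hz.2
    rwa [← neg_sub, neg_ne_zero]
  have h := dualPrim_hasDerivAt (Z := fun z => z) hk hk0 ha (hasDerivAt_id' z)
    (uUnit_differentiableAt hk0 ha hz).hasDerivAt
    (by filter_upwards [isOpen_domUnit.mem_nhds hz] with y hy using
      sheetEq_uUnit hk (Complex.slitPlane_ne_zero hy.1))
    (domUnit_subset_domOne ha hz) (sub_ne_zero.1 h4)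
  refine h.congr_deriv ?_
  have h1 := uUnit_mul_wUnit (k := k) (domUnit_subset_domOne ha hz)
  have h3 := Complex.slitPlane_ne_zero hz.1
  have h2 : uUnit k a z ≠ 0 := fun h => h4 (by rw [← h1, h, zero_mul])
  rw [← h1]
  field_simp

/-- Near the end (0, 0), g²η is z^(2/(k+1) − 1) dz times a holomorphic function on suitable
branches, whence the Euler parameter m = 2. -/
lemma zeroFactor_hasDerivAt (ha : 1 < a) {z : ℂ} (hz : z ∈ domZero) :
    ∃ E', HasDerivAt (zeroFactor k a) E' z ∧
      (k + 1) * z * E' + 2 * zeroFactor k a z =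
        (k + 1) * (rt k (1 - z) ^ k / rt k (a - z) ^ k) := by
  have h := eulerIntegral_hasDerivAt isOpen_domZero starConvex_domZero
    (G := fun s => rt k (1 - s) ^ k / rt k (a - s) ^ k) (fun s hs => by
      have h2 := sub_mem_slitPlane_of_one ha hs
      exact (((hasDerivAt_rt_one_sub k hs).differentiableAt.pow k).div
        ((hasDerivAt_rt_const_sub k h2).differentiableAt.pow k)
        (pow_ne_zero _ (rt_ne_zero k (Complex.slitPlane_ne_zero h2)))).differentiableWithinAt)
    two_pos k.succ_pos hz
  obtain ⟨E', h1, h2⟩ := h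
  push_cast at h2
  exact ⟨E', h1, h2⟩

lemma dualUnit_hasDerivAt (ha : 1 < a) {z : ℂ} (hz : z ∈ domUnit) :
    HasDerivAt (dualUnit k a) (cSq k a * wUnit k a z / z) z := by
  obtain ⟨E', h1, h2⟩ := zeroFactor_hasDerivAt (k := k) ha (show z ∈ domZero from hz.2)
  refine ((((hasDerivAt_rt k hz.1).fun_pow 2).const_mul (cSq k a)).fun_mul h1).congr_deriv ?_
  have e1 := Complex.slitPlane_ne_zero hz.1
  have e2 := rt_ne_zero k e1
  have e3 := rt_ne_zero k (Complex.slitPlane_ne_zero (sub_mem_slitPlane_of_one ha hz.2))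
  have e4 := succ_ne_zero' k
  rw [wUnit, unitFactor]
  field_simp at h2 ⊢
  push_cast
  linear_combination cSq k a * rt k z * h2

lemma dualNeg_hasDerivAt (ha : 1 < a) {z : ℂ} (hz : z ∈ domNeg) :
    HasDerivAt (dualNeg k a) (cSq k a * wNeg k a z / z) z := by
  have hz1 : z ∈ domZero := domNeg_subset_domZero hz
  obtain ⟨E', h1, h2⟩ := zeroFactor_hasDerivAt (k := k) ha hz1
  refine ((((hasDerivAt_rt_neg k hz).fun_pow 2).const_mul (cSq k a)).fun_mul h1).congr_deriv ?_
  have e1 := ne_zero_of_mem_domNeg hz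
  have e2 := rt_ne_zero k (neg_ne_zero.2 e1)
  have e3 := rt_ne_zero k (Complex.slitPlane_ne_zero (sub_mem_slitPlane_of_one ha hz1))
  have e4 := succ_ne_zero' k
  rw [wNeg]
  field_simp at h2 ⊢
  push_cast
  linear_combination cSq k a * rt k (-z) * h2

lemma hasDerivAt_const_div (a : ℂ) {z : ℂ} (hz : z ≠ 0) :
    HasDerivAt (fun z => a / z) (-(a / z ^ 2)) z := by
  refine ((hasDerivAt_const z a).fun_div (hasDerivAt_id' z) hz).congr_deriv ?_
  field_simp
  ring

/-- The involution pulls g²η back to −η, so a primitive of g²η at the end over 0 becomes, up to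
sign, one of η at the end over ∞. -/
lemma etaNeg_hasDerivAt (hk : Even k) (ha : 1 < a) {z : ℂ} (hz : z ∈ domNeg) :
    HasDerivAt (etaNeg k a) (1 / (z * wNeg k a z)) z := by
  have hz0 := ne_zero_of_mem_domNeg hz
  have ha0 : (a : ℂ) ≠ 0 := by exact_mod_cast (by linarith : a ≠ 0)
  refine ((dualNeg_hasDerivAt ha (div_mem_domNeg ha hz)).comp z
    (hasDerivAt_const_div a hz0)).neg.congr_deriv ?_
  have h1 := wNeg_involution hk ha hz
  have h2 := wNeg_ne_zero (k := k) ha hz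
  field_simp
  linear_combination h1

/-! ### Constants between primitives with different base points -/

lemma intervalIntegrable_ofReal {f : ℝ → ℝ} {b c : ℝ} (h : IntervalIntegrable f volume b c) :
    IntervalIntegrable (fun x => (f x : ℂ)) volume b c := ⟨h.1.ofReal, h.2.ofReal⟩

lemma rt_continuousAt_zero (k : ℕ) : ContinuousAt (rt k) 0 :=
  Complex.continuousAt_cpow_const_of_re_pos (by simp) (by
    rw [← Complex.ofReal_natCast, ← Complex.ofReal_inv, Complex.ofReal_re]
    exact inv_succ_pos k)

lemma rt_zero (k : ℕ) : rt k 0 = 0 := by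
  have := rt_pow k 0
  exact pow_eq_zero_iff k.succ_ne_zero |>.1 this

lemma one_mem_domOne (ha : 1 < a) : (1 : ℂ) ∈ domOne a :=
  ⟨by simp, by
    have := Complex.ofReal_mem_slitPlane.2 (sub_pos.2 ha)
    rwa [Complex.ofReal_sub, Complex.ofReal_one] at this⟩

/-- Provides the boundary value 0 at z = 1 for the improper integrals that identify the constants.
The branches `uMid` and `uUnit` are only continuous there, hence the formulation with limits. -/
lemma tendsto_prims (hk : Even k) (hk0 : 0 < k) (ha : 1 < a) {l : Filter ℂ} {U : ℂ → ℂ}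
    (hl : l ≤ 𝓝 1) (hU : Tendsto U l (𝓝 0)) :
    Tendsto (fun z => etaPrim k a z (U z)) l (𝓝 0) ∧
      Tendsto (fun z => dualPrim k a z (U z)) l (𝓝 0) := by
  obtain ⟨_, h1, -⟩ := etaFactor_hasDerivAt hk0 ha (one_mem_domOne ha)
  obtain ⟨_, h2, -⟩ := dualFactor_hasDerivAt hk hk0 ha (one_mem_domOne ha)
  constructor
  · simpa [etaPrim] using hU.mul (h1.continuousAt.tendsto.mono_left hl)
  · simpa [dualPrim] using (hU.pow (2 * k + 1)).mul (h2.continuousAt.tendsto.mono_left hl)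

lemma tendsto_uMid (hk0 : 0 < k) (ha : 1 < a) : Tendsto (uMid k a) (𝓝 1) (𝓝 0) := by
  have h1 : ContinuousAt (fun z => rt k (z - 1)) 1 :=
    ContinuousAt.comp (g := rt k) (by simpa using rt_continuousAt_zero k) (by fun_prop)
  have h2 : ContinuousAt (uMid k a) 1 :=
    h1.mul (hasDerivAt_unitFactor hk0 (one_mem_domOne ha)).continuousAt
  have h3 : uMid k a 1 = 0 := by simp [uMid, rt_zero]
  rwa [ContinuousAt, h3] at h2

lemma tendsto_uUnit (hk0 : 0 < k) (ha : 1 < a) : Tendsto (uUnit k a) (𝓝 1) (𝓝 0) := by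
  have h1 : ContinuousAt (fun z => rt k (1 - z)) 1 :=
    ContinuousAt.comp (g := rt k) (by simpa using rt_continuousAt_zero k) (by fun_prop)
  have h2 : ContinuousAt (uUnit k a) 1 :=
    h1.neg.mul (hasDerivAt_unitFactor hk0 (one_mem_domOne ha)).continuousAt
  have h3 : uUnit k a 1 = 0 := by simp [uUnit, rt_zero]
  rwa [ContinuousAt, h3] at h2

lemma uMid_involution (hk : Even k) (hk0 : 0 < k) (ha : 1 < a) {z : ℂ} (hz : z ∈ domMid a) :
    uMid k a (a / z) = -cSq k a * (z - a) * wMid k a z / z := by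
  have h1 := wMid_involution hk hk0 ha hz
  have h2 := uMid_mul_wMid (k := k) (domMid_subset_domOne (div_mem_domMid ha hz))
  have h0 := ne_zero_of_mem_domMid hz
  have h3 : uMid k a (a / z) = (a / z - 1) * (cSq k a * wMid k a z) := by
    rw [← h2]; linear_combination -uMid k a (a / z) * h1
  rw [h3]
  field_simp
  ring

/-- The primitives of `η` based at `(1, 0)` and at `(a, ∞)` differ by a real constant. -/
theorem etaPrim_add_dualPrim_uMid (hk : Even k) (hk0 : 0 < k) (ha : 1 < a) {z : ℂ}
    (hz : z ∈ domMid a) :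
    etaPrim k a z (uMid k a z) + dualPrim k a (a / z) (uMid k a (a / z)) = segInt k a := by
  have ha0 : (a : ℂ) ≠ 0 := by exact_mod_cast (by linarith : a ≠ 0)
  have hder : ∀ z ∈ domMid a, HasDerivAt (fun z => etaPrim k a z (uMid k a z) +
      dualPrim k a (a / z) (uMid k a (a / z))) 0 z := by
    intro z hz
    have hz0 := ne_zero_of_mem_domMid hz
    refine ((etaPrim_uMid_hasDerivAt hk hk0 ha hz).fun_add
      ((dualPrim_uMid_hasDerivAt hk hk0 ha (div_mem_domMid ha hz)).comp z
        (hasDerivAt_const_div a hz0))).congr_deriv ?_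
    have h1 := wMid_involution hk hk0 ha hz
    have h2 := wMid_ne_zero (k := k) hz
    field_simp
    linear_combination -h1
  obtain ⟨C, hC⟩ := (isOpen_domMid a).exists_is_const_of_deriv_eq_zero (isPreconnected_domMid ha)
    (fun z hz => (hder z hz).differentiableAt.differentiableWithinAt)
    (fun z hz => (hder z hz).deriv)
  rw [hC z hz]
  have hmap1 : Tendsto (fun x : ℝ => (x : ℂ)) (𝓝[>] 1) (𝓝 1) :=
    (Complex.continuous_ofReal.tendsto' 1 1 (by simp)).mono_left nhdsWithin_le_nhds
  have hmapa : Tendsto (fun x : ℝ => (a : ℂ) / x) (𝓝[<] a) (𝓝 1) := by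
    have : ContinuousAt (fun x : ℝ => (a : ℂ) / x) a :=
      continuousAt_const.div Complex.continuous_ofReal.continuousAt ha0
    have h := this.tendsto
    rw [div_self ha0] at h
    exact h.mono_left nhdsWithin_le_nhds
  have hlim := tendsto_prims hk hk0 ha le_rfl (tendsto_uMid hk0 ha)
  -- Evaluate C along (1, a): the primitive of η tends to 0 at 1. At a the other summand tends to 0,
  -- because a/x → 1, so the primitive of η tends to C.
  have hftc := intervalIntegral.integral_eq_sub_of_hasDerivAt_of_tendsto ha
    (f := fun x : ℝ => etaPrim k a x (uMid k a x)) (f' := fun x => (segFun k a x : ℂ))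
    (fa := 0) (fb := C) ?_ (intervalIntegrable_ofReal (intervalIntegrable_segFun k a ha.le))
    (hlim.1.comp hmap1) ?_
  · rw [sub_zero, intervalIntegral.integral_ofReal] at hftc
    exact hftc.symm
  · intro x hx
    have hxm := ofReal_mem_domMid hx.1 hx.2
    refine (etaPrim_uMid_hasDerivAt hk hk0 ha hxm).comp_ofReal.congr_deriv ?_
    rw [wMid_ofReal hx.1 hx.2, segFun]
    push_cast
    have := rroot_pos k (sub_pos.2 hx.1)
    have := rroot_pos k (sub_pos.2 hx.2)
    have := rroot_pos k (zero_lt_one.trans hx.1)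
    norm_cast
    field_simp
  · have h1 := (tendsto_const_nhds (x := C)).sub (hlim.2.comp hmapa)
    rw [sub_zero] at h1
    refine h1.congr' ?_
    filter_upwards [Ioo_mem_nhdsLT ha] with x hx
    rw [← hC x (ofReal_mem_domMid hx.1 hx.2)]
    simp

/-- The primitives of `g ^ 2 η` based at `(1, 0)` and at the end `(0, 0)` differ by a real
constant. -/
theorem dualPrim_sub_dualUnit (hk : Even k) (hk0 : 0 < k) (ha : 1 < a) {z : ℂ}
    (hz : z ∈ domUnit) :
    dualPrim k a z (uUnit k a z) - dualUnit k a z = -endInt k a := by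
  have ha0 : 0 < a := by linarith
  have hder : ∀ z ∈ domUnit, HasDerivAt (fun z => dualPrim k a z (uUnit k a z) -
      dualUnit k a z) 0 z := by
    intro z hz
    refine ((dualPrim_uUnit_hasDerivAt hk hk0 ha hz).fun_sub
      (dualUnit_hasDerivAt ha hz)).congr_deriv (sub_self _)
  obtain ⟨C, hC⟩ := isOpen_domUnit.exists_is_const_of_deriv_eq_zero isPreconnected_domUnit
    (fun z hz => (hder z hz).differentiableAt.differentiableWithinAt)
    (fun z hz => (hder z hz).deriv)
  rw [hC z hz]
  have hmap1 : Tendsto (fun x : ℝ => (x : ℂ)) (𝓝[<] 1) (𝓝 1) :=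
    (Complex.continuous_ofReal.tendsto' 1 1 (by simp)).mono_left nhdsWithin_le_nhds
  have hmap0 : Tendsto (fun x : ℝ => (x : ℂ)) (𝓝[>] 0) (𝓝 0) :=
    (Complex.continuous_ofReal.tendsto' 0 0 (by simp)).mono_left nhdsWithin_le_nhds
  have hlim := tendsto_prims hk hk0 ha le_rfl (tendsto_uUnit hk0 ha)
  -- Evaluate C along (0, 1): `dualUnit` tends to 0 at 0, and to −C at 1 because `dualPrim` vanishes
  -- there.
  have hftc := intervalIntegral.integral_eq_sub_of_hasDerivAt_of_tendsto zero_lt_one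
    (f := fun x : ℝ => dualUnit k a x)
    (f' := fun x => (((rroot k a ^ 2)⁻¹ * endFun k a x : ℝ) : ℂ))
    (fa := 0) (fb := -C) ?_ (intervalIntegrable_ofReal
      ((intervalIntegrable_endFun k ha.le).const_mul _)) ?_ ?_
  · rw [sub_zero, intervalIntegral.integral_ofReal, intervalIntegral.integral_const_mul] at hftc
    rw [endInt, hftc, neg_neg]
  · intro x hx
    have hxm := ofReal_mem_domUnit hx.1 hx.2
    refine (dualUnit_hasDerivAt ha hxm).comp_ofReal.congr_deriv ?_
    have hax : 0 < a - x := by linarith [hx.2]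
    have e1 := rt_ofReal_eq k (sub_pos.2 hx.2).le
    have e2 := rt_ofReal_eq k hax.le
    have e3 := rt_ofReal_eq k hx.1.le
    push_cast at e1 e2 e3
    rw [wUnit, unitFactor, e1, e2, e3, cSq_eq ha0, endFun,
      rroot_div k (mul_nonneg ha0.le (sub_pos.2 hx.2).le) hax.le,
      rroot_mul k ha0.le (sub_pos.2 hx.2).le]
    have r1 := rroot_pos k (sub_pos.2 hx.2)
    have r2 := rroot_pos k hax
    have r3 := rroot_pos k hx.1
    have r4 := rroot_pos k ha0
    have hx0 := hx.1
    norm_cast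
    simp only [div_pow, mul_pow]
    field_simp
  · obtain ⟨E', h1, -⟩ := zeroFactor_hasDerivAt (k := k) ha (z := 0) (by simp [domZero])
    have h2 := ((continuousAt_const (y := cSq k a)).mul ((rt_continuousAt_zero k).pow 2)).mul
      h1.continuousAt
    have h3 := h2.tendsto.comp hmap0
    simpa [rt_zero, Function.comp_def, dualUnit] using h3
  · have h1 := (hlim.2.comp hmap1).sub (tendsto_const_nhds (x := C))
    rw [zero_sub] at h1
    refine h1.congr' ?_
    filter_upwards [Ioo_mem_nhdsLT zero_lt_one] with x hx
    rw [← hC x (ofReal_mem_domUnit hx.1 hx.2)]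
    simp

/-! ### The local potentials and how they glue -/

/-- The multivalued function `∫ η - conj ∫ g ^ 2 η` near `(1, 0)`, normalized to vanish there. -/
noncomputable def potOne (k : ℕ) (a : ℝ) (z u : ℂ) : ℂ :=
  etaPrim k a z u - starRingEnd ℂ (dualPrim k a z u)

/-- The function `∫ η - conj ∫ g ^ 2 η` near `(a, ∞)`, normalized to vanish there. -/
noncomputable def potPole (k : ℕ) (a : ℝ) (z v : ℂ) : ℂ :=
  starRingEnd ℂ (potOne k a (a / z) (-cSq k a * v / z))

/-- The function `∫ η - conj ∫ g ^ 2 η` over `domNeg`, normalized at the ends up to a constant. -/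
noncomputable def potNeg (k : ℕ) (a : ℝ) (μ : ℝ) (z w : ℂ) : ℂ :=
  wNeg k a z / w * (etaNeg k a z - starRingEnd ℂ (dualNeg k a z) + μ)

/-- The equation of the surface in the coordinates `z` and `w`. -/
def BranchEq (k : ℕ) (a : ℝ) (z w : ℂ) : Prop := w ^ (k + 1) * (z - a) ^ k = z ^ 2 * (z - 1) ^ k

/-- The difference of `potOne` and `potNeg` over the upper half plane. -/
noncomputable def closeConst (k : ℕ) (a : ℝ) : ℂ :=
  -halfRoot k * segInt k a + 2 * halfRoot k ^ 2 * endInt k a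

lemma norm_of_pow_eq_one {ρ : ℂ} (hρ : ρ ^ (k + 1) = 1) : ‖ρ‖ = 1 :=
  Complex.norm_eq_one_of_pow_eq_one hρ k.succ_ne_zero

lemma conj_of_norm {ρ : ℂ} (hρ : ‖ρ‖ = 1) : starRingEnd ℂ ρ = ρ⁻¹ := by
  rw [Complex.inv_def, Complex.normSq_eq_norm_sq, hρ]
  simp

lemma ne_zero_of_norm {ρ : ℂ} (hρ : ‖ρ‖ = 1) : ρ ≠ 0 := by
  rintro rfl
  simp at hρ

lemma etaPrim_mul (z u ρ : ℂ) : etaPrim k a z (ρ * u) = ρ * etaPrim k a z u := by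
  rw [etaPrim, etaPrim, mul_assoc]

lemma dualPrim_mul (z u ρ : ℂ) :
    dualPrim k a z (ρ * u) = ρ ^ (2 * k + 1) * dualPrim k a z u := by
  rw [dualPrim, dualPrim, mul_pow, mul_assoc]

/-- Since ρ^(2k+1) = ρ⁻¹ = conj ρ, conjugating the second primitive makes it scale by the same
factor ρ as the first. -/
lemma potOne_mul {ρ : ℂ} (hρ : ρ ^ (k + 1) = 1) (z u : ℂ) :
    potOne k a z (ρ * u) = ρ * potOne k a z u := by
  have h1 := norm_of_pow_eq_one hρ
  have h0 := ne_zero_of_norm h1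
  have h2 : ρ ^ (2 * k + 1) = ρ⁻¹ := by
    apply eq_inv_of_mul_eq_one_left
    calc ρ ^ (2 * k + 1) * ρ = (ρ ^ (k + 1)) ^ 2 := by ring
      _ = 1 := by rw [hρ, one_pow]
  rw [potOne, potOne, etaPrim_mul, dualPrim_mul, h2, map_mul, map_inv₀, conj_of_norm h1, inv_inv]
  ring

lemma div_pow_eq_one {z w w' : ℂ} (h : BranchEq k a z w) (h' : BranchEq k a z w') (hz : z ≠ 0)
    (h1 : z ≠ 1) (h2 : z ≠ a) : (w / w') ^ (k + 1) = 1 := by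
  rw [BranchEq] at h h'
  have e1 := pow_ne_zero k (sub_ne_zero.2 h1)
  have e2 := pow_ne_zero k (sub_ne_zero.2 h2)
  have e3 : w ^ (k + 1) = w' ^ (k + 1) := mul_right_cancel₀ e2 (h.trans h'.symm)
  have e4 : w' ^ (k + 1) ≠ 0 := by
    intro h0
    rw [h0, zero_mul] at h'
    exact mul_ne_zero (pow_ne_zero 2 hz) e1 h'.symm
  rw [div_pow, e3, div_self e4]

lemma branch_ne_zero {z w : ℂ} (h : BranchEq k a z w) (hz : z ≠ 0) (h1 : z ≠ 1) : w ≠ 0 := by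
  rintro rfl
  rw [BranchEq, zero_pow k.succ_ne_zero, zero_mul] at h
  exact mul_ne_zero (pow_ne_zero 2 hz) (pow_ne_zero k (sub_ne_zero.2 h1)) h.symm

/-- On the sheet `wMid`, apply F(z) + G(a/z) = A at z and at a/z; since A is real it cancels from F
− conj G. Every other sheet is a rotation of this one, and both sides scale by the same root of
unity. -/
lemma potOne_eq_potPole (hk : Even k) (hk0 : 0 < k) (ha : 1 < a) {z w : ℂ} (hz : z ∈ domMid a)
    (hw : BranchEq k a z w) :
    potOne k a z ((z - 1) / w) = potPole k a z ((z - a) * w) := by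
  have ha0 : (a : ℂ) ≠ 0 := by exact_mod_cast (by linarith : a ≠ 0)
  have z0 := ne_zero_of_mem_domMid hz
  have z1 := ne_one_of_mem_domMid hz
  have z2 := sub_ne_zero_of_mem_domOne (domMid_subset_domOne hz)
  have hm := wMid_ne_zero (k := k) hz
  have hρ := div_pow_eq_one hw (wMid_pow hk (domMid_subset_domOne hz)) z0 z1 (sub_ne_zero.1 z2)
  have w0 := branch_ne_zero hw z0 z1
  set ρ := w / wMid k a z with hρdef
  have hwρ : w = ρ * wMid k a z := by rw [hρdef]; field_simp
  have hρ0 : ρ ≠ 0 := div_ne_zero w0 hm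
  have hu : (z - 1) / w = ρ⁻¹ * uMid k a z := by
    rw [← uMid_mul_wMid (k := k) (domMid_subset_domOne hz), hwρ]
    field_simp
  have hv : -cSq k a * ((z - a) * w) / z = ρ * uMid k a (a / z) := by
    rw [uMid_involution hk hk0 ha hz, hwρ]
    ring
  have hρ' : ρ⁻¹ ^ (k + 1) = 1 := by rw [inv_pow, hρ, inv_one]
  rw [potPole, hv, hu, potOne_mul hρ', potOne_mul hρ, map_mul, conj_of_norm (norm_of_pow_eq_one hρ)]
  congr 1
  have h1 := etaPrim_add_dualPrim_uMid hk hk0 ha hz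
  have h2 := etaPrim_add_dualPrim_uMid hk hk0 ha (div_mem_domMid ha hz)
  rw [div_div_cancel₀ ha0] at h2
  rw [potOne, potOne, eq_sub_of_add_eq h1, eq_sub_of_add_eq h2, map_sub, map_sub,
    Complex.conj_conj, Complex.conj_ofReal]
  ring

lemma mem_domMid_of_im {z : ℂ} (hz : z.im ≠ 0) : z ∈ domMid a :=
  ⟨Or.inr (by simpa using hz), Or.inr (by simpa using hz)⟩

lemma mem_domUnit_of_im {z : ℂ} (hz : z.im ≠ 0) : z ∈ domUnit :=
  ⟨Or.inr hz, Or.inr (by simpa using hz)⟩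

lemma mem_domNeg_of_im {z : ℂ} (hz : z.im ≠ 0) : z ∈ domNeg := Or.inr (by simpa using hz)

lemma halfRoot_pow_two_mul (k : ℕ) : halfRoot k ^ (2 * k + 2) = 1 := by
  calc halfRoot k ^ (2 * k + 2) = (halfRoot k ^ (k + 1)) ^ 2 := by ring
    _ = 1 := by rw [halfRoot_pow]; norm_num

lemma norm_halfRoot (k : ℕ) : ‖halfRoot k‖ = 1 :=
  Complex.norm_eq_one_of_pow_eq_one (halfRoot_pow_two_mul k) (by omega)

/-- The square of the half root comes from moving the slit of z^(2/(k+1)) from the negative to the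
positive axis, and the factor −h from comparing the roots of 1 − z and z − 1. -/
lemma uNeg_of_im_pos {z : ℂ} (ha : 1 < a) (hz : 0 < z.im) :
    uNeg k a z = halfRoot k ^ 2 * uUnit k a z ∧ uNeg k a z = -halfRoot k * uMid k a z := by
  have h1 := mem_domUnit_of_im hz.ne'
  have h2 := mem_domNeg_of_im hz.ne'
  have hn := wNeg_ne_zero (k := k) ha h2
  have hwU : wUnit k a z = wNeg k a z * halfRoot k ^ 2 := by
    rw [wUnit, wNeg, unitFactor, rt_of_im_pos k hz, div_div_eq_mul_div]
    ring
  have e := halfRoot_ne_zero k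
  have hU : uNeg k a z = halfRoot k ^ 2 * uUnit k a z := by
    rw [uNeg, ← uUnit_mul_wUnit (k := k) (domUnit_subset_domOne ha h1), hwU]
    field_simp
  refine ⟨hU, ?_⟩
  have hr : rt k (z - 1) = rt k (1 - z) * halfRoot k := by
    rw [rt_of_im_pos k (z := z - 1) (by simpa using hz), neg_sub]
  rw [hU, uUnit, uMid, hr]
  ring

lemma uNeg_of_im_neg {z : ℂ} (ha : 1 < a) (hz : z.im < 0) :
    uUnit k a z = halfRoot k ^ 2 * uNeg k a z ∧ uMid k a z = -halfRoot k * uNeg k a z := by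
  have h1 := mem_domUnit_of_im hz.ne
  have h2 := mem_domNeg_of_im hz.ne
  have hn := wNeg_ne_zero (k := k) ha h2
  have hwU : wNeg k a z = wUnit k a z * halfRoot k ^ 2 := by
    rw [wUnit, wNeg, unitFactor, rt_neg_of_im_neg k hz, div_div_eq_mul_div]
    ring
  have e := halfRoot_ne_zero k
  have e' := wUnit_ne_zero (k := k) ha h1
  have hU : uUnit k a z = halfRoot k ^ 2 * uNeg k a z := by
    rw [uNeg, ← uUnit_mul_wUnit (k := k) (domUnit_subset_domOne ha h1), hwU]
    field_simp
  refine ⟨hU, ?_⟩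
  have hr : rt k (z - 1) * halfRoot k = rt k (1 - z) := by
    rw [← rt_neg_of_im_neg k (z := z - 1) (by simpa using hz), neg_sub]
  apply mul_left_cancel₀ e
  have : halfRoot k * (-halfRoot k * uNeg k a z) = -uUnit k a z := by rw [hU]; ring
  rw [this, uUnit, uMid, ← hr]
  ring

lemma dualPrim_uNeg_of_im_pos (hk : Even k) (hk0 : 0 < k) (ha : 1 < a) {z : ℂ} (hz : 0 < z.im) :
    dualPrim k a z (uNeg k a z) = dualNeg k a z - (halfRoot k ^ 2)⁻¹ * endInt k a := by
  have h := dualPrim_sub_dualUnit hk hk0 ha (mem_domUnit_of_im hz.ne')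
  have e := halfRoot_ne_zero k
  have hu : dualUnit k a z = halfRoot k ^ 2 * dualNeg k a z := by
    rw [dualUnit, dualNeg, rt_of_im_pos k hz]; ring
  rw [(uNeg_of_im_pos ha hz).1, dualPrim_mul, eq_add_of_sub_eq h, hu]
  have : (halfRoot k ^ 2) ^ (2 * k + 1) = (halfRoot k ^ 2)⁻¹ := by
    apply eq_inv_of_mul_eq_one_left
    calc _ = (halfRoot k ^ (2 * k + 2)) ^ 2 := by ring
      _ = 1 := by rw [halfRoot_pow_two_mul, one_pow]
  rw [this]
  field_simp
  ring

lemma dualPrim_uNeg_of_im_neg (hk : Even k) (hk0 : 0 < k) (ha : 1 < a) {z : ℂ} (hz : z.im < 0) :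
    dualPrim k a z (uNeg k a z) = dualNeg k a z - halfRoot k ^ 2 * endInt k a := by
  have h := dualPrim_sub_dualUnit hk hk0 ha (mem_domUnit_of_im hz.ne)
  have e := halfRoot_ne_zero k
  have hu : dualNeg k a z = halfRoot k ^ 2 * dualUnit k a z := by
    rw [dualUnit, dualNeg, rt_neg_of_im_neg k hz]; ring
  rw [(uNeg_of_im_neg ha hz).1, dualPrim_mul] at h
  have : (halfRoot k ^ 2) ^ (2 * k + 1) = (halfRoot k ^ 2)⁻¹ := by
    apply eq_inv_of_mul_eq_one_left
    calc _ = (halfRoot k ^ (2 * k + 2)) ^ 2 := by ring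
      _ = 1 := by rw [halfRoot_pow_two_mul, one_pow]
  rw [this] at h
  rw [hu]
  field_simp at h
  linear_combination h

lemma conj_halfRoot (k : ℕ) : starRingEnd ℂ (halfRoot k) = (halfRoot k)⁻¹ :=
  conj_of_norm (norm_halfRoot k)

lemma neg_halfRoot_pow (k : ℕ) : (-halfRoot k) ^ (2 * k + 1) = -(halfRoot k)⁻¹ := by
  rw [Odd.neg_pow ⟨k, rfl⟩, neg_inj]
  apply eq_inv_of_mul_eq_one_left
  rw [← pow_succ, ← halfRoot_pow_two_mul k]

/-- F is −h times its value on `uMid`, which gives −hA and a dual primitive at a/z, in the lower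
half plane. That primitive contributes h²B when it is renormalized at its end. The term −conj G
contributes a second h²B at the end over 0. -/
lemma potOne_uNeg_of_im_pos (hk : Even k) (hk0 : 0 < k) (ha : 1 < a) {z : ℂ} (hz : 0 < z.im) :
    potOne k a z (uNeg k a z) =
      etaNeg k a z - starRingEnd ℂ (dualNeg k a z) + closeConst k a := by
  have hz' := div_im_neg (by linarith : 0 < a) hz
  have e := halfRoot_ne_zero k
  have h1 := etaPrim_add_dualPrim_uMid hk hk0 ha (mem_domMid_of_im hz.ne')
  have h2 := dualPrim_uNeg_of_im_neg hk hk0 ha hz'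
  rw [(uNeg_of_im_neg ha hz').2, dualPrim_mul, neg_halfRoot_pow, h2] at h1
  have h3 := dualPrim_uNeg_of_im_pos hk hk0 ha hz
  rw [potOne, h3, (uNeg_of_im_pos ha hz).2, etaPrim_mul, eq_sub_of_add_eq h1, closeConst, etaNeg]
  simp only [map_sub, map_mul, map_inv₀, map_pow, conj_halfRoot, Complex.conj_ofReal]
  field_simp
  ring

lemma potOne_uNeg_of_im_neg (hk : Even k) (hk0 : 0 < k) (ha : 1 < a) {z : ℂ} (hz : z.im < 0) :
    potOne k a z (uNeg k a z) = etaNeg k a z - starRingEnd ℂ (dualNeg k a z) +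
      starRingEnd ℂ (closeConst k a) := by
  have hz' := div_im_pos (by linarith : 0 < a) hz
  have e := halfRoot_ne_zero k
  have h1 := etaPrim_add_dualPrim_uMid hk hk0 ha (mem_domMid_of_im hz.ne)
  have h2 := dualPrim_uNeg_of_im_pos hk hk0 ha hz'
  rw [(uNeg_of_im_pos ha hz').2, dualPrim_mul, neg_halfRoot_pow] at h2
  have h3 := dualPrim_uNeg_of_im_neg hk hk0 ha hz
  rw [(uNeg_of_im_neg ha hz).2, etaPrim_mul] at h1
  rw [potOne, h3, closeConst, etaNeg]
  simp only [map_sub, map_mul, map_add, map_neg, map_pow, conj_halfRoot, Complex.conj_ofReal,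
    map_ofNat]
  field_simp at h2 ⊢
  linear_combination (-halfRoot k) * h1 - h2

lemma closeConst_im (k : ℕ) (a : ℝ) : (closeConst k a).im =
    -(Real.sin (Real.pi / (k + 1)) * segInt k a) +
      2 * Real.sin (2 * Real.pi / (k + 1)) * endInt k a := by
  have h1 : halfRoot k = Complex.exp ((Real.pi / (k + 1) : ℝ) * Complex.I) := by
    rw [halfRoot]; push_cast; rfl
  have h2 : halfRoot k ^ 2 = Complex.exp ((2 * Real.pi / (k + 1) : ℝ) * Complex.I) := by
    rw [halfRoot, ← Complex.exp_nat_mul]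
    congr 1
    push_cast
    ring
  rw [closeConst, Complex.add_im, Complex.im_mul_ofReal, Complex.im_mul_ofReal, h2, h1,
    Complex.neg_im, Complex.exp_ofReal_mul_I_im]
  have : (2 * Complex.exp ((2 * Real.pi / (k + 1) : ℝ) * Complex.I)).im =
      2 * (Complex.exp ((2 * Real.pi / (k + 1) : ℝ) * Complex.I)).im := by
    simp
  rw [this, Complex.exp_ofReal_mul_I_im]
  ring

/-- For a real closing constant the upper and lower half planes demand the same additive constant.
Other sheets follow by rotation, which multiplies the constant as well. -/
lemma potOne_eq_potNeg (hk : Even k) (hk0 : 0 < k) (ha : 1 < a) (hc : (closeConst k a).im = 0)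
    {z w : ℂ} (hz : z.im ≠ 0) (hw : BranchEq k a z w) :
    potOne k a z ((z - 1) / w) = potNeg k a (closeConst k a).re z w := by
  have hzn := mem_domNeg_of_im hz
  have z0 := ne_zero_of_mem_domNeg hzn
  have z1 := ne_one_of_mem_domNeg hzn
  have hm := wNeg_ne_zero (k := k) ha hzn
  have hρ := div_pow_eq_one (wNeg_pow hk ha hzn) hw z0 z1 (ne_pole_of_mem_domNeg ha hzn)
  have w0 := branch_ne_zero hw z0 z1
  have hu : (z - 1) / w = wNeg k a z / w * uNeg k a z := by
    rw [uNeg]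
    field_simp
  have hcr : ((closeConst k a).re : ℂ) = closeConst k a := Complex.ext (by simp) (by simp [hc])
  have hcc : starRingEnd ℂ (closeConst k a) = closeConst k a := Complex.conj_eq_iff_im.2 hc
  rw [hu, potOne_mul hρ, potNeg, hcr]
  congr 1
  rcases hz.lt_or_gt with h | h
  · rw [potOne_uNeg_of_im_neg hk hk0 ha h, hcc]
  · rw [potOne_uNeg_of_im_pos hk hk0 ha h]

/-! ### Coordinates on the surface and derivatives of the potentials along paths -/

lemma coord_cases (p : surface k a) :
    (zCoord p ≠ 0 ∧ zCoord p ≠ a ∧ BranchEq k a (zCoord p) (wCoord p)) ∨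
      (zCoord p = a ∧ wCoord p = 0) := by
  obtain ⟨p, hp, hne⟩ := p
  rcases hp with ⟨z, w, rfl, hza, hw⟩ | rfl | rfl
  · left
    have e2 := sub_ne_zero.2 hza
    refine ⟨?_, hza, ?_⟩
    · rintro (rfl : z = 0)
      rw [zero_pow two_ne_zero, zero_mul] at hw
      rw [pow_eq_zero_iff k.succ_ne_zero |>.1 hw] at hne
      simp at hne
    · change w ^ (k + 1) * (z - a) ^ k = z ^ 2 * (z - 1) ^ k
      rw [hw, div_pow]
      field_simp
  · right
    exact ⟨rfl, rfl⟩
  · simp at hne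

lemma zCoord_ne_zero (ha : 1 < a) (p : surface k a) : zCoord p ≠ 0 := by
  rcases coord_cases p with h | h
  · exact h.1
  · rw [h.1]
    exact_mod_cast (by linarith : a ≠ 0)

lemma branchEq_coord {p : surface k a} (h : zCoord p ≠ a) :
    BranchEq k a (zCoord p) (wCoord p) := by
  rcases coord_cases p with h' | h'
  · exact h'.2.2
  · exact absurd h'.1 h

lemma uCoord_pole {p : surface k a} (h : zCoord p = a) : uCoord p = 0 := by
  rcases coord_cases p with h' | h'
  · exact absurd h h'.2.1
  · rw [uCoord, h'.2, div_zero]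

lemma vCoord_pole {p : surface k a} (h : zCoord p = a) : vCoord p = 0 := by
  rw [vCoord, h, sub_self, zero_mul]

lemma uCoord_one {p : surface k a} (h : zCoord p = 1) : uCoord p = 0 := by
  rw [uCoord, h, sub_self, zero_div]

lemma wCoord_one (hk0 : 0 < k) (ha : 1 < a) {p : surface k a} (h : zCoord p = 1) :
    wCoord p = 0 := by
  have h1 : zCoord p ≠ a := by rw [h]; exact_mod_cast ha.ne
  have h2 := branchEq_coord h1
  rw [BranchEq, h, sub_self, zero_pow hk0.ne', mul_zero] at h2
  rcases mul_eq_zero.1 h2 with h3 | h3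
  · exact pow_eq_zero_iff k.succ_ne_zero |>.1 h3
  · rw [← h] at h3
    exact absurd h3 (pow_ne_zero k (sub_ne_zero.2 h1))

lemma vCoord_one (hk0 : 0 < k) (ha : 1 < a) {p : surface k a} (h : zCoord p = 1) :
    vCoord p = 0 := by
  rw [vCoord, wCoord_one hk0 ha h, mul_zero]

lemma wCoord_ne_zero (ha : 1 < a) {p : surface k a} (h1 : zCoord p ≠ 1)
    (h2 : zCoord p ≠ a) : wCoord p ≠ 0 :=
  branch_ne_zero (branchEq_coord h2) (zCoord_ne_zero ha p) h1

lemma sheetEq_coord (hk0 : 0 < k) (ha : 1 < a) (p : surface k a) :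
    SheetEq k a (zCoord p) (uCoord p) := by
  by_cases h1 : zCoord p = 1
  · rw [SheetEq, uCoord_one h1, h1, sub_self, zero_pow k.succ_ne_zero, zero_mul, zero_mul]
  by_cases h2 : zCoord p = a
  · rw [SheetEq, uCoord_pole h2, h2, sub_self, zero_pow k.succ_ne_zero, zero_pow hk0.ne',
      zero_mul, mul_zero]
  have h3 := branchEq_coord h2
  have h4 := wCoord_ne_zero ha h1 h2
  rw [BranchEq] at h3
  rw [SheetEq, uCoord, div_pow]
  field_simp
  linear_combination -(zCoord p - 1) * h3

lemma vCoord_pow (p : surface k a) :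
    vCoord p ^ (k + 1) = (zCoord p - a) * zCoord p ^ 2 * (zCoord p - 1) ^ k := by
  by_cases h2 : zCoord p = a
  · rw [vCoord_pole h2, h2, sub_self, zero_pow k.succ_ne_zero, zero_mul, zero_mul]
  have h3 := branchEq_coord h2
  rw [BranchEq] at h3
  rw [vCoord, mul_pow]
  linear_combination (zCoord p - a) * h3

/-- The involution carries u to (a/z − 1)c²w = −c²v/z, so everything known at (1, 0) in terms of u
transfers to (a, ∞) in terms of v. -/
lemma sheetEq_involution (hk : Even k) (ha : 1 < a) (p : surface k a) :
    SheetEq k a (a / zCoord p) (-cSq k a * vCoord p / zCoord p) := by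
  have h0 := zCoord_ne_zero ha p
  have h1 := vCoord_pow p
  have h2 := cSq_pow (k := k) (by linarith : 0 < a)
  have q1 : (a : ℂ) / zCoord p - a = -(a * (zCoord p - 1) / zCoord p) := by field_simp; ring
  rw [SheetEq, q1, hk.neg_pow]
  simp only [div_pow, mul_pow, hk.add_one.neg_pow, h1]
  field_simp
  linear_combination -(zCoord p - a) * (zCoord p - 1) ^ k * zCoord p ^ (k + 1) * h2

lemma wCoord_eq (p : surface k a) :
    wCoord p = vCoord p / (zCoord p - a) := by
  by_cases h2 : zCoord p = a
  · rcases coord_cases p with h | h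
    · exact absurd h2 h.2.1
    · rw [h.2, vCoord_pole h2, zero_div]
  · have := sub_ne_zero.2 h2
    rw [vCoord]
    field_simp

/-- The pullback of `η - conj (g ^ 2 η)`, in terms of the derivative of `z`. -/
noncomputable def potForm (p : surface k a) (Z' : ℂ) : ℂ :=
  etaCoeff p * Z' - starRingEnd ℂ (gaussMap p ^ 2 * etaCoeff p * Z')

lemma gaussMap_sq (p : surface k a) : gaussMap p ^ 2 = cSq k a * wCoord p ^ 2 := by
  rw [gaussMap, mul_pow, cSq]

lemma hasDerivAt_conj {f : ℝ → ℂ} {f' : ℂ} {t : ℝ} (h : HasDerivAt f f' t) :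
    HasDerivAt (fun s => starRingEnd ℂ (f s)) (starRingEnd ℂ f') t :=
  Complex.conjCLE.toContinuousLinearMap.hasFDerivAt.comp_hasDerivAt t h

section

variable {γ : ℝ → surface k a} {Z' U' V' : ℂ} {t : ℝ}

/-- The hypothesis `hreg` excludes transversal passages through a branch point. There the
coefficient in terms of z takes its default value 0, although the pullback of the form need not
vanish. -/
lemma potOne_hasDerivAt (hk : Even k) (hk0 : 0 < k) (ha : 1 < a)
    (hZ : HasDerivAt (fun s => zCoord (γ s)) Z' t) (hU : HasDerivAt (fun s => uCoord (γ s)) U' t)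
    (hd : zCoord (γ t) ∈ domOne a) (hreg : uCoord (γ t) = 0 → U' = 0) :
    HasDerivAt (fun s => potOne k a (zCoord (γ s)) (uCoord (γ s))) (potForm (γ t) Z') t := by
  have hs : ∀ᶠ s in 𝓝 t, SheetEq k a (zCoord (γ s)) (uCoord (γ s)) :=
    Eventually.of_forall fun s => sheetEq_coord hk0 ha (γ s)
  have h2 := sub_ne_zero.1 (sub_ne_zero_of_mem_domOne hd)
  by_cases h1 : zCoord (γ t) = 1
  · have hu := uCoord_one h1
    rw [hreg hu] at hU
    refine ((etaPrim_hasDerivAt_of_zero hk0 ha hZ hU hd hu).sub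
      (hasDerivAt_conj (dualPrim_hasDerivAt_of_zero hk hk0 ha hZ hU hd hu))).congr_deriv ?_
    simp [potForm, etaCoeff, wCoord_one hk0 ha h1]
  · refine ((etaPrim_hasDerivAt hk0 ha hZ hU hs hd h1).sub
      (hasDerivAt_conj (dualPrim_hasDerivAt hk hk0 ha hZ hU hs hd h1))).congr_deriv ?_
    have h3 := wCoord_ne_zero ha h1 h2
    have h0 := zCoord_ne_zero ha (γ t)
    have h4 := sub_ne_zero.2 h1
    rw [potForm, gaussMap_sq, etaCoeff, uCoord]
    congr 1
    · field_simp
    · congr 1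
      field_simp

lemma potPole_hasDerivAt (hk : Even k) (hk0 : 0 < k) (ha : 1 < a)
    (hZ : HasDerivAt (fun s => zCoord (γ s)) Z' t) (hV : HasDerivAt (fun s => vCoord (γ s)) V' t)
    (hd : zCoord (γ t) ∈ domPole) (hreg : vCoord (γ t) = 0 → V' = 0) :
    HasDerivAt (fun s => potPole k a (zCoord (γ s)) (vCoord (γ s))) (potForm (γ t) Z') t := by
  have hs : ∀ᶠ s in 𝓝 t, SheetEq k a (a / zCoord (γ s)) (-cSq k a * vCoord (γ s) / zCoord (γ s)) :=
    Eventually.of_forall fun s => sheetEq_involution hk ha (γ s)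
  have ha0 : (a : ℂ) ≠ 0 := by exact_mod_cast (by linarith : a ≠ 0)
  have h0 := zCoord_ne_zero ha (γ t)
  have h1 : zCoord (γ t) - 1 ≠ 0 := Complex.slitPlane_ne_zero hd
  have hd' := div_mem_domOne ha hd
  have hZ2 : HasDerivAt (fun s => (a : ℂ) / zCoord (γ s)) (-(a * Z') / zCoord (γ t) ^ 2) t := by
    simpa using (hasDerivAt_const t (a : ℂ)).fun_div hZ h0
  have hU2 := (hV.const_mul (-cSq k a)).fun_div hZ h0
  by_cases h2 : zCoord (γ t) = a
  · have hv := vCoord_pole h2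
    have hu2 : -cSq k a * vCoord (γ t) / zCoord (γ t) = 0 := by simp [hv]
    have hU2' : HasDerivAt (fun s => -cSq k a * vCoord (γ s) / zCoord (γ s)) 0 t := by
      refine hU2.congr_deriv ?_
      simp [hv, hreg hv]
    refine (hasDerivAt_conj ((etaPrim_hasDerivAt_of_zero hk0 ha hZ2 hU2' hd' hu2).sub
      (hasDerivAt_conj (dualPrim_hasDerivAt_of_zero hk hk0 ha hZ2 hU2' hd' hu2)))).congr_deriv ?_
    have hw : wCoord (γ t) = 0 := by rw [wCoord_eq, hv, zero_div]
    simp [potForm, etaCoeff, hw]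
  · have h2' := sub_ne_zero.2 h2
    have h3 : (a : ℂ) / zCoord (γ t) ≠ 1 := by
      rw [Ne, div_eq_one_iff_eq h0]
      exact fun h => h2 h.symm
    refine (hasDerivAt_conj ((etaPrim_hasDerivAt hk0 ha hZ2 hU2 hs hd' h3).sub
      (hasDerivAt_conj (dualPrim_hasDerivAt hk hk0 ha hZ2 hU2 hs hd' h3)))).congr_deriv ?_
    have h4 := wCoord_ne_zero ha (sub_ne_zero.1 h1) h2
    have h5 := cSq_ne_zero (k := k) (by linarith : 0 < a)
    have q1 : (a : ℂ) / zCoord (γ t) - 1 = -((zCoord (γ t) - a) / zCoord (γ t)) := by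
      field_simp; ring
    -- The involution sends (η, g²η) to (−g²η, −η), and the outer conjugation restores η −
    -- conj(g²η).
    have key : ∀ A B x y : ℂ, A = -y → B = -x →
        starRingEnd ℂ (A - starRingEnd ℂ B) = x - starRingEnd ℂ y := by
      rintro _ _ x y rfl rfl
      simp only [map_sub, map_neg, Complex.conj_conj]
      ring
    rw [potForm, gaussMap_sq, etaCoeff, vCoord, q1]
    refine key _ _ _ _ ?_ ?_ <;> field_simp

lemma potNeg_hasDerivAt (hk : Even k) (ha : 1 < a) (μ : ℝ)
    (hZ : HasDerivAt (fun s => zCoord (γ s)) Z' t) (hV : HasDerivAt (fun s => vCoord (γ s)) V' t)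
    (hd : zCoord (γ t) ∈ domNeg) :
    HasDerivAt (fun s => potNeg k a μ (zCoord (γ s)) (wCoord (γ s))) (potForm (γ t) Z') t := by
  have h0 := zCoord_ne_zero ha (γ t)
  have h1 := ne_one_of_mem_domNeg hd
  have h2 := ne_pole_of_mem_domNeg ha hd
  have hw0 := wCoord_ne_zero ha h1 h2
  have hn0 := wNeg_ne_zero (k := k) ha hd
  obtain ⟨W', hW⟩ : ∃ W', HasDerivAt (fun s => wCoord (γ s)) W' t :=
    ⟨_, (hV.fun_div (hZ.sub_const (a : ℂ)) (sub_ne_zero.2 h2)).congr_of_eventuallyEq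
      (Eventually.of_forall fun s => wCoord_eq (γ s))⟩
  obtain ⟨R', hR⟩ : ∃ R', HasDerivAt (fun s => wNeg k a (zCoord (γ s)) / wCoord (γ s)) R' t :=
    ⟨_, ((wNeg_differentiableAt (k := k) ha hd).hasDerivAt.scomp t hZ).fun_div hW hw0⟩
  have hev : ∀ᶠ s in 𝓝 t, (wNeg k a (zCoord (γ s)) / wCoord (γ s)) ^ (k + 1) = 1 := by
    filter_upwards [hZ.continuousAt (isOpen_domNeg.mem_nhds hd)] with s hs
    have hs : zCoord (γ s) ∈ domNeg := hs
    exact div_pow_eq_one (wNeg_pow hk ha hs) (branchEq_coord (ne_pole_of_mem_domNeg ha hs))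
      (ne_zero_of_mem_domNeg hs) (ne_one_of_mem_domNeg hs) (ne_pole_of_mem_domNeg ha hs)
  have hRn := hev.self_of_nhds
  -- The quotient of branches is a root of unity along the path; differentiating its (k + 1)-st
  -- power, which is constantly 1, kills the derivative.
  have hR0 : R' = 0 := by
    have h3 := (hR.fun_pow (k + 1)).unique ((hasDerivAt_const t (1 : ℂ)).congr_of_eventuallyEq hev)
    rw [Nat.add_sub_cancel, mul_eq_zero, mul_eq_zero] at h3
    rcases h3 with (h3 | h3) | h3
    · exact absurd h3 (by exact_mod_cast k.succ_ne_zero)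
    · exact absurd h3 (pow_ne_zero k (div_ne_zero hn0 hw0))
    · exact h3
  rw [hR0] at hR
  have hE := (etaNeg_hasDerivAt (k := k) hk ha hd).scomp t hZ
  have hD := hasDerivAt_conj ((dualNeg_hasDerivAt (k := k) ha hd).scomp t hZ)
  refine (hR.fun_mul ((hE.fun_sub hD).add_const (μ : ℂ))).congr_deriv ?_
  have hc := conj_of_norm (norm_of_pow_eq_one hRn)
  rw [zero_mul, zero_add, potForm, gaussMap_sq, etaCoeff, mul_sub]
  congr 1
  · simp only [smul_eq_mul]
    field_simp
  · rw [← inv_inv (wNeg k a (zCoord (γ t)) / wCoord (γ t)), ← hc, ← map_inv₀, ← map_mul]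
    congr 1
    simp only [smul_eq_mul]
    field_simp

end

/-! ### Regularity and integrability at the branch points -/

/-- The form `η` along a path in terms of `z`, `u` and their derivatives, also at branch points. -/
noncomputable def etaReg (k : ℕ) (a : ℝ) (z u z' u' : ℂ) : ℂ :=
  ((k + 1) * z * (z - a) * u' - ((k - 1) * z + (a + 1)) * u * z') / ((1 - a) * z)

/-- The form `g ^ 2 η` along a path in terms of `z`, `v` and their derivatives, also at branch
points. -/
noncomputable def dualReg (k : ℕ) (a : ℝ) (z v z' v' : ℂ) : ℂ :=
  cSq k a * ((k + 1) * z * (z - 1) * v' - ((k + 3) * z + (a - 3)) * v * z') / (a * (a - 1) * z)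

/-- The times at which a function to `ℂ` has a simple zero are isolated. -/
lemma countable_simple_zeros (f : ℝ → ℂ) : {t | f t = 0 ∧ deriv f t ≠ 0}.Countable := by
  refine IsLindelof.countable_of_isDiscrete (HereditarilyLindelofSpace.isLindelof _) ?_
  rw [isDiscrete_iff_discreteTopology, discreteTopology_subtype_iff]
  intro t ht
  have h1 : DifferentiableAt ℝ f t := differentiableAt_of_deriv_ne_zero ht.2
  have h2 := h1.hasDerivAt.eventually_ne (c := 0) ht.2
  rw [inf_principal_eq_bot]
  filter_upwards [h2] with s hs using fun h => hs h.1

/-- The times at which a path passes through a branch point with nonzero velocity. -/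
def crossing (γ : ℝ → surface k a) : Set ℝ :=
  {t | uCoord (γ t) = 0 ∧ deriv (fun s => uCoord (γ s)) t ≠ 0} ∪
    {t | vCoord (γ t) = 0 ∧ deriv (fun s => vCoord (γ s)) t ≠ 0}

lemma countable_crossing (γ : ℝ → surface k a) : (crossing γ).Countable :=
  (countable_simple_zeros _).union (countable_simple_zeros _)

section

variable {γ : ℝ → surface k a} {Z' U' V' : ℂ} {t : ℝ}

/-- At (1, 0) the function z − 1 has order k + 1 in u, so differentiating the sheet equation at u =
0 leaves a nonzero multiple of z′. At (a, ∞) apply this after the involution. -/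
lemma zCoord_deriv_eq_zero (hk : Even k) (hk0 : 0 < k) (ha : 1 < a)
    (hZ : HasDerivAt (fun s => zCoord (γ s)) Z' t) (hU : HasDerivAt (fun s => uCoord (γ s)) U' t)
    (hV : HasDerivAt (fun s => vCoord (γ s)) V' t)
    (h : zCoord (γ t) = 1 ∨ zCoord (γ t) = a) : Z' = 0 := by
  have h1a : (1 : ℂ) - a ≠ 0 := sub_ne_zero.2 (by exact_mod_cast ha.ne)
  have ha0 : (a : ℂ) ≠ 0 := by exact_mod_cast (by linarith : a ≠ 0)
  have h0 := zCoord_ne_zero ha (γ t)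
  rcases h with h | h
  · have h1 := sheetEq_hasDerivAt (a := a) hk0 hZ hU
      (Eventually.of_forall fun s => sheetEq_coord hk0 ha (γ s))
    rw [uCoord_one h, h, zero_pow hk0.ne', zero_pow k.succ_ne_zero, sub_self] at h1
    simp only [mul_zero, zero_mul, add_zero] at h1
    exact (mul_eq_zero.1 h1.symm).resolve_left (mul_ne_zero (pow_ne_zero _ h1a) h1a)
  · have hZ2 : HasDerivAt (fun s => (a : ℂ) / zCoord (γ s)) (-(a * Z') / zCoord (γ t) ^ 2) t := by
      simpa using (hasDerivAt_const t (a : ℂ)).fun_div hZ h0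
    have h1 := sheetEq_hasDerivAt (a := a) hk0 hZ2 ((hV.const_mul (-cSq k a)).fun_div hZ h0)
      (Eventually.of_forall fun s => sheetEq_involution hk ha (γ s))
    rw [vCoord_pole h, h, div_self ha0, mul_zero, zero_div, zero_pow hk0.ne',
      zero_pow k.succ_ne_zero, sub_self] at h1
    simp only [mul_zero, zero_mul, add_zero] at h1
    have h2 := (mul_eq_zero.1 h1.symm).resolve_left (mul_ne_zero (pow_ne_zero _ h1a) h1a)
    rw [div_eq_zero_iff, neg_eq_zero, mul_eq_zero] at h2
    rcases h2 with (h2 | h2) | h2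
    · exact absurd h2 ha0
    · exact h2
    · exact absurd h2 (pow_ne_zero 2 ha0)

lemma uCoord_eq_zero_iff (ha : 1 < a) {p : surface k a} :
    uCoord p = 0 ↔ zCoord p = 1 ∨ zCoord p = a := by
  constructor
  · intro h
    by_contra! h1
    exact div_ne_zero (sub_ne_zero.2 h1.1) (wCoord_ne_zero ha h1.1 h1.2) h
  · rintro (h | h)
    · exact uCoord_one h
    · exact uCoord_pole h

lemma vCoord_eq_zero_iff (hk0 : 0 < k) (ha : 1 < a) {p : surface k a} :
    vCoord p = 0 ↔ zCoord p = 1 ∨ zCoord p = a := by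
  constructor
  · intro h
    by_contra! h1
    exact mul_ne_zero (sub_ne_zero.2 h1.2) (wCoord_ne_zero ha h1.1 h1.2) h
  · rintro (h | h)
    · exact vCoord_one hk0 ha h
    · exact vCoord_pole h

/-- Away from the crossing times, the forms along a path have regular expressions. -/
lemma forms_eq_reg (hk : Even k) (hk0 : 0 < k) (ha : 1 < a)
    (hZ : HasDerivAt (fun s => zCoord (γ s)) Z' t) (hU : HasDerivAt (fun s => uCoord (γ s)) U' t)
    (hV : HasDerivAt (fun s => vCoord (γ s)) V' t) (ht : t ∉ crossing γ) :
    etaCoeff (γ t) * Z' = etaReg k a (zCoord (γ t)) (uCoord (γ t)) Z' U' ∧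
      gaussMap (γ t) ^ 2 * etaCoeff (γ t) * Z' =
        dualReg k a (zCoord (γ t)) (vCoord (γ t)) Z' V' ∧
      gaussMap (γ t) * etaCoeff (γ t) * Z' = gaussConst k a * Z' / zCoord (γ t) := by
  have h1a : (1 : ℂ) - a ≠ 0 := sub_ne_zero.2 (by exact_mod_cast ha.ne)
  have ha1 : (a : ℂ) - 1 ≠ 0 := sub_ne_zero.2 (by exact_mod_cast ha.ne')
  have ha0 : (a : ℂ) ≠ 0 := by exact_mod_cast (by linarith : a ≠ 0)
  have h0 := zCoord_ne_zero ha (γ t)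
  by_cases h : zCoord (γ t) = 1 ∨ zCoord (γ t) = a
  · have hZ0 := zCoord_deriv_eq_zero hk hk0 ha hZ hU hV h
    have hu := (uCoord_eq_zero_iff ha).2 h
    have hv := (vCoord_eq_zero_iff hk0 ha).2 h
    have hU0 : U' = 0 := by
      by_contra hne
      exact ht (Or.inl ⟨hu, by rwa [hU.deriv]⟩)
    have hV0 : V' = 0 := by
      by_contra hne
      exact ht (Or.inr ⟨hv, by rwa [hV.deriv]⟩)
    simp [etaReg, dualReg, hZ0, hU0, hV0]
  push Not at h
  have h1 := sub_ne_zero.2 h.1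
  have h2 := sub_ne_zero.2 h.2
  have hw := wCoord_ne_zero ha h.1 h.2
  have hl := sheetEq_logDeriv (a := a) hk0 hZ hU
    (Eventually.of_forall fun s => sheetEq_coord hk0 ha (γ s)) h.1 h.2
  have hUV : ∀ s, uCoord (γ s) * vCoord (γ s) = (zCoord (γ s) - 1) * (zCoord (γ s) - a) := by
    intro s
    by_cases h' : zCoord (γ s) = 1 ∨ zCoord (γ s) = a
    · rw [(uCoord_eq_zero_iff ha).2 h', zero_mul]
      rcases h' with h' | h' <;> rw [h', sub_self] <;> ring
    · push Not at h'
      have := wCoord_ne_zero ha h'.1 h'.2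
      rw [uCoord, vCoord]
      field_simp
  have hprod := (hU.fun_mul hV).unique (((hZ.sub_const 1).fun_mul
    (hZ.sub_const (a : ℂ))).congr_of_eventuallyEq (Eventually.of_forall hUV))
  have hu : uCoord (γ t) * wCoord (γ t) = zCoord (γ t) - 1 := by rw [uCoord]; field_simp
  have hv : vCoord (γ t) = (zCoord (γ t) - a) * wCoord (γ t) := rfl
  have hu0 : uCoord (γ t) ≠ 0 := by
    rw [Ne, uCoord_eq_zero_iff ha]
    push Not
    exact h
  rw [gaussMap_sq, gaussMap, etaCoeff, etaReg, dualReg]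
  set z := zCoord (γ t)
  set u := uCoord (γ t)
  set v := vCoord (γ t)
  set w := wCoord (γ t)
  rw [logPoly] at hl
  have huv : u * v = (z - 1) * (z - a) := hUV t
  -- Divide `logPoly` by z − 1: the quotient is (k − 1)z + (a + 1) and the remainder 1 − a. This
  -- cancels the pole of u z′/(z(z − 1)).
  have key1 : (1 - a) * Z' =
      w * ((k + 1) * z * (z - a) * U' - ((k - 1) * z + (a + 1)) * u * Z') := by
    apply mul_left_cancel₀ h1
    linear_combination -w * hl - Z' * (1 - a) * hu
  -- The same division for (k + 1)v′/v, now by z − a: quotient (k + 3)z + (a − 3), remainder a(a −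
  -- 1).
  have key2 : w * Z' * (a * (a - 1)) =
      (k + 1) * z * (z - 1) * V' - ((k + 3) * z + (a - 3)) * v * Z' := by
    apply mul_left_cancel₀ (mul_ne_zero hu0 h2)
    linear_combination a * (a - 1) * (z - a) * Z' * hu - (k + 1) * z * (z - 1) * (z - a) * hprod +
      v * hl + Z' * (z * (z - a) + k * z * (z - 1) - 2 * (z - 1) * (z - a) +
        ((k + 3) * z + (a - 3)) * (z - a)) * huv
  refine ⟨?_, ?_, ?_⟩
  · rw [eq_div_iff (mul_ne_zero h1a h0)]
    field_simp
    linear_combination key1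
  · rw [← key2]
    field_simp
  · field_simp

end

/-- Continuous differentiability on a closed interval, in terms of `z`, `u` and `v`. -/
def IsC1On (γ : ℝ → surface k a) (b c : ℝ) : Prop :=
  ContDiffOn ℝ 1 (fun t => zCoord (γ t)) (Icc b c) ∧
    ContDiffOn ℝ 1 (fun t => uCoord (γ t)) (Icc b c) ∧
    ContDiffOn ℝ 1 (fun t => vCoord (γ t)) (Icc b c)

lemma hasDerivAt_of_contDiffOn {f : ℝ → ℂ} {b c t : ℝ} (hf : ContDiffOn ℝ 1 f (Icc b c))
    (ht : t ∈ Ioo b c) : HasDerivAt f (derivWithin f (Icc b c) t) t := by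
  have hn : Icc b c ∈ 𝓝 t := Icc_mem_nhds ht.1 ht.2
  have h1 := (hf.differentiableOn one_ne_zero t (Ioo_subset_Icc_self ht)).hasDerivWithinAt
  exact h1.hasDerivAt hn

lemma ae_mem_Ioo_diff {b c : ℝ} {s : Set ℝ} (hs : s.Countable) :
    ∀ᵐ t ∂volume.restrict (Ioc b c), t ∈ Ioo b c \ s := by
  have h1 : ∀ᵐ t ∂volume.restrict (Ioc b c), t ∉ s ∪ {c} :=
    ae_restrict_of_ae ((hs.union (countable_singleton c)).ae_notMem volume)
  filter_upwards [h1, ae_restrict_mem measurableSet_Ioc] with t ht hm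
  rw [mem_union, mem_singleton_iff, not_or] at ht
  exact ⟨⟨hm.1, lt_of_le_of_ne hm.2 ht.2⟩, ht.1⟩

/-- Off a countable set the integrand equals an expression in z, u, v and their one-sided
derivatives that is continuous up to the ends of the interval. -/
lemma intervalIntegrable_phi (hk : Even k) (hk0 : 0 < k) (ha : 1 < a) {γ : ℝ → surface k a}
    {b c : ℝ} (hbc : b ≤ c) (h : IsC1On γ b c) (j : Fin 3) :
    IntervalIntegrable (fun t => phiCoeff (γ t) j * deriv (fun s => zCoord (γ s)) t)
      volume b c := by
  rcases hbc.eq_or_lt with rfl | hbc'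
  · exact IntervalIntegrable.refl
  obtain ⟨hZ, hU, hV⟩ := h
  have hud : UniqueDiffOn ℝ (Icc b c) := uniqueDiffOn_Icc hbc'
  have cZ := hZ.continuousOn
  have cU := hU.continuousOn
  have cV := hV.continuousOn
  have cZ' := hZ.continuousOn_derivWithin hud le_rfl
  have cU' := hU.continuousOn_derivWithin hud le_rfl
  have cV' := hV.continuousOn_derivWithin hud le_rfl
  have h1a : (1 : ℂ) - a ≠ 0 := sub_ne_zero.2 (by exact_mod_cast ha.ne)
  have ha1 : (a : ℂ) - 1 ≠ 0 := sub_ne_zero.2 (by exact_mod_cast ha.ne')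
  have ha0 : (a : ℂ) ≠ 0 := by exact_mod_cast (by linarith : a ≠ 0)
  set Zd := derivWithin (fun t => zCoord (γ t)) (Icc b c) with hZd
  set Ud := derivWithin (fun t => uCoord (γ t)) (Icc b c)
  set Vd := derivWithin (fun t => vCoord (γ t)) (Icc b c)
  set E : ℝ → ℂ := fun t => etaReg k a (zCoord (γ t)) (uCoord (γ t)) (Zd t) (Ud t) with hE
  set D : ℝ → ℂ := fun t => dualReg k a (zCoord (γ t)) (vCoord (γ t)) (Zd t) (Vd t) with hD
  set L : ℝ → ℂ := fun t => gaussConst k a * Zd t / zCoord (γ t) with hL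
  have cE : ContinuousOn E (Icc b c) := by
    refine ContinuousOn.div (by fun_prop) (by fun_prop) fun t _ => ?_
    exact mul_ne_zero h1a (zCoord_ne_zero ha _)
  have cD : ContinuousOn D (Icc b c) := by
    refine ContinuousOn.div (by fun_prop) (by fun_prop) fun t _ => ?_
    exact mul_ne_zero (mul_ne_zero ha0 ha1) (zCoord_ne_zero ha _)
  have cL : ContinuousOn L (Icc b c) :=
    ContinuousOn.div (by fun_prop) cZ fun t _ => zCoord_ne_zero ha _
  have hint : IntervalIntegrable
      (fun t => (![E t - D t, Complex.I * (E t + D t), 2 * L t] : Fin 3 → ℂ) j) volume b c := by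
    apply ContinuousOn.intervalIntegrable
    rw [uIcc_of_le hbc]
    fin_cases j
    · exact cE.sub cD
    · exact continuousOn_const.mul (cE.add cD)
    · exact continuousOn_const.mul cL
  refine hint.congr_ae ?_
  rw [uIoc_of_le hbc]
  filter_upwards [ae_mem_Ioo_diff (b := b) (c := c) (countable_crossing γ)] with t ht
  have dZ := hasDerivAt_of_contDiffOn hZ ht.1
  obtain ⟨e1, e2, e3⟩ := forms_eq_reg hk hk0 ha dZ (hasDerivAt_of_contDiffOn hU ht.1)
    (hasDerivAt_of_contDiffOn hV ht.1) ht.2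
  rw [dZ.deriv]
  simp only [hE, hD, hL]
  fin_cases j
  · simp only [phiCoeff, Fin.zero_eta, Matrix.cons_val_zero]
    rw [← e1, ← e2]
    ring
  · simp only [phiCoeff, Fin.mk_one, Matrix.cons_val_one, Matrix.cons_val_zero]
    rw [← e1, ← e2]
    ring
  · simp only [phiCoeff, Fin.reduceFinMk, Matrix.cons_val]
    rw [← e3]
    ring

/-! ### Integrals as differences of a potential -/

/-- The map to `ℝ³` belonging to a function `∫ η - conj ∫ g ^ 2 η`. -/
noncomputable def potVec (f : surface k a → ℂ) (p : surface k a) : Fin 3 → ℝ :=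
  ![(f p).re, -(f p).im, 2 * gaussConst k a * Real.log ‖zCoord p‖]

lemma hasDerivAt_log_norm {f : ℝ → ℂ} {f' : ℂ} {t : ℝ} (hf : HasDerivAt f f' t) (h0 : f t ≠ 0) :
    HasDerivAt (fun s => Real.log ‖f s‖) (f' / f t).re t := by
  have h1 := hf.norm_sq
  have h2 : ‖f t‖ ^ 2 ≠ 0 := pow_ne_zero 2 (norm_ne_zero_iff.2 h0)
  have h3 := (h1.log h2).div_const 2
  have h4 : (fun s => Real.log (‖f s‖ ^ 2) / 2) = fun s => Real.log ‖f s‖ := by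
    funext s
    rw [Real.log_pow]
    push_cast
    ring
  rw [h4] at h3
  refine h3.congr_deriv ?_
  rw [Complex.inner, Complex.div_re, ← Complex.normSq_eq_norm_sq]
  rw [← Complex.normSq_eq_norm_sq] at h2
  simp only [Complex.mul_re, Complex.conj_re, Complex.conj_im]
  field_simp
  ring

lemma potVec_hasDerivAt (hk : Even k) (hk0 : 0 < k) (ha : 1 < a) {γ : ℝ → surface k a}
    {f : surface k a → ℂ} {Z' U' V' : ℂ} {t : ℝ}
    (hZ : HasDerivAt (fun s => zCoord (γ s)) Z' t) (hU : HasDerivAt (fun s => uCoord (γ s)) U' t)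
    (hV : HasDerivAt (fun s => vCoord (γ s)) V' t) (ht : t ∉ crossing γ)
    (hf : HasDerivAt (fun s => f (γ s)) (potForm (γ t) Z') t) (j : Fin 3) :
    HasDerivAt (fun s => potVec f (γ s) j) (phiCoeff (γ t) j * Z').re t := by
  have hre : HasDerivAt (fun s => (f (γ s)).re) (potForm (γ t) Z').re t :=
    Complex.reCLM.hasFDerivAt.comp_hasDerivAt t hf
  have him : HasDerivAt (fun s => (f (γ s)).im) (potForm (γ t) Z').im t :=
    Complex.imCLM.hasFDerivAt.comp_hasDerivAt t hf
  fin_cases j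
  · refine hre.congr_deriv ?_
    simp only [phiCoeff, Fin.zero_eta, Matrix.cons_val_zero, potForm]
    rw [Complex.sub_re, Complex.conj_re, ← Complex.sub_re]
    congr 1
    ring
  · refine him.neg.congr_deriv ?_
    simp only [phiCoeff, Fin.mk_one, Matrix.cons_val_one, Matrix.cons_val_zero, potForm]
    rw [Complex.sub_im, Complex.conj_im, sub_neg_eq_add, ← Complex.add_im, ← Complex.I_mul_re]
    congr 1
    ring
  · have h3 := (forms_eq_reg hk hk0 ha hZ hU hV ht).2.2
    refine ((hasDerivAt_log_norm hZ (zCoord_ne_zero ha (γ t))).const_mul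
      (2 * gaussConst k a)).congr_deriv ?_
    simp only [phiCoeff, Fin.reduceFinMk, Matrix.cons_val]
    have : 2 * gaussMap (γ t) * etaCoeff (γ t) * Z' =
        ((2 * gaussConst k a : ℝ) : ℂ) * (Z' / zCoord (γ t)) := by
      push_cast
      linear_combination 2 * h3
    rw [this, Complex.re_ofReal_mul]

/-- A function on the surface that is given over a set of values of `z` by the local
potentials. -/
def IsPotential (S : Set ℂ) (f : surface k a → ℂ) : Prop :=
  ∀ z ∈ S, (z ∈ domOne a ∧ ∀ p, zCoord p ∈ domOne a → f p = potOne k a (zCoord p) (uCoord p)) ∨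
    (z ∈ domPole ∧ ∀ p, zCoord p ∈ domPole → f p = potPole k a (zCoord p) (vCoord p)) ∨
    (z ∈ domNeg ∧ ∃ μ : ℝ, ∀ p, zCoord p ∈ domNeg → f p = potNeg k a μ (zCoord p) (wCoord p))

lemma IsPotential.hasDerivAt (hk : Even k) (hk0 : 0 < k) (ha : 1 < a) {γ : ℝ → surface k a}
    {f : surface k a → ℂ} {S : Set ℂ} (hf : IsPotential S f) {Z' U' V' : ℂ} {t : ℝ}
    (hZ : HasDerivAt (fun s => zCoord (γ s)) Z' t) (hU : HasDerivAt (fun s => uCoord (γ s)) U' t)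
    (hV : HasDerivAt (fun s => vCoord (γ s)) V' t) (ht : t ∉ crossing γ) (hS : zCoord (γ t) ∈ S) :
    HasDerivAt (fun s => f (γ s)) (potForm (γ t) Z') t := by
  have hregU : uCoord (γ t) = 0 → U' = 0 := by
    intro h0
    by_contra hne
    exact ht (Or.inl ⟨h0, by rwa [hU.deriv]⟩)
  have hregV : vCoord (γ t) = 0 → V' = 0 := by
    intro h0
    by_contra hne
    exact ht (Or.inr ⟨h0, by rwa [hV.deriv]⟩)
  rcases hf _ hS with ⟨hd, h⟩ | ⟨hd, h⟩ | ⟨hd, μ, h⟩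
  · refine (potOne_hasDerivAt hk hk0 ha hZ hU hd hregU).congr_of_eventuallyEq ?_
    filter_upwards [hZ.continuousAt ((isOpen_domOne a).mem_nhds hd)] with s hs using h _ hs
  · refine (potPole_hasDerivAt hk hk0 ha hZ hV hd hregV).congr_of_eventuallyEq ?_
    filter_upwards [hZ.continuousAt (isOpen_domPole.mem_nhds hd)] with s hs using h _ hs
  · refine (potNeg_hasDerivAt hk ha μ hZ hV hd).congr_of_eventuallyEq ?_
    filter_upwards [hZ.continuousAt (isOpen_domNeg.mem_nhds hd)] with s hs using h _ hs

lemma potOne_continuousWithinAt (hk : Even k) (hk0 : 0 < k) (ha : 1 < a) {Z U : ℝ → ℂ}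
    {s : Set ℝ} {t : ℝ} (hZ : ContinuousWithinAt Z s t) (hU : ContinuousWithinAt U s t)
    (hd : Z t ∈ domOne a) : ContinuousWithinAt (fun x => potOne k a (Z x) (U x)) s t := by
  obtain ⟨_, h1, -⟩ := etaFactor_hasDerivAt hk0 ha hd
  obtain ⟨_, h2, -⟩ := dualFactor_hasDerivAt hk hk0 ha hd
  have c1 := h1.continuousAt.comp_continuousWithinAt hZ
  have c2 := h2.continuousAt.comp_continuousWithinAt hZ
  exact (hU.mul c1).sub
    (Complex.continuous_conj.continuousAt.comp_continuousWithinAt ((hU.pow (2 * k + 1)).mul c2))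

lemma IsPotential.continuousWithinAt (hk : Even k) (hk0 : 0 < k) (ha : 1 < a)
    {γ : ℝ → surface k a} {f : surface k a → ℂ} {S : Set ℂ} (hf : IsPotential S f) {s : Set ℝ}
    {t : ℝ} (hts : t ∈ s) (hZ : ContinuousWithinAt (fun s => zCoord (γ s)) s t)
    (hU : ContinuousWithinAt (fun s => uCoord (γ s)) s t)
    (hV : ContinuousWithinAt (fun s => vCoord (γ s)) s t) (hS : zCoord (γ t) ∈ S) :
    ContinuousWithinAt (fun s => f (γ s)) s t := by
  have h0 := zCoord_ne_zero ha (γ t)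
  rcases hf _ hS with ⟨hd, h⟩ | ⟨hd, h⟩ | ⟨hd, μ, h⟩
  · refine (potOne_continuousWithinAt hk hk0 ha hZ hU hd).congr_of_eventuallyEq_of_mem ?_ hts
    filter_upwards [hZ ((isOpen_domOne a).mem_nhds hd)] with s hs using h _ hs
  · refine ContinuousWithinAt.congr_of_eventuallyEq_of_mem
      (f := fun s => potPole k a (zCoord (γ s)) (vCoord (γ s))) ?_ ?_ hts
    · exact Complex.continuous_conj.continuousAt.comp_continuousWithinAt
        (potOne_continuousWithinAt hk hk0 ha (continuousWithinAt_const.div hZ h0)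
          ((continuousWithinAt_const.mul hV).div hZ h0) (div_mem_domOne ha hd))
    · filter_upwards [hZ (isOpen_domPole.mem_nhds hd)] with s hs using h _ hs
  · refine ContinuousWithinAt.congr_of_eventuallyEq_of_mem
      (f := fun s => potNeg k a μ (zCoord (γ s)) (wCoord (γ s))) ?_ ?_ hts
    · have h2 := ne_pole_of_mem_domNeg ha hd
      have hw := wCoord_ne_zero ha (ne_one_of_mem_domNeg hd) h2
      have hW : ContinuousWithinAt (fun s => wCoord (γ s)) s t :=
        (hV.div (hZ.sub continuousWithinAt_const) (sub_ne_zero.2 h2)).congr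
          (fun s _ => wCoord_eq (γ s)) (wCoord_eq (γ t))
      have c1 : ContinuousWithinAt (fun s => wNeg k a (zCoord (γ s))) s t :=
        ContinuousAt.comp_continuousWithinAt (f := fun s => zCoord (γ s))
          (wNeg_differentiableAt (k := k) ha hd).continuousAt hZ
      have c2 : ContinuousWithinAt (fun s => etaNeg k a (zCoord (γ s))) s t :=
        ContinuousAt.comp_continuousWithinAt (f := fun s => zCoord (γ s))
          (etaNeg_hasDerivAt (k := k) hk ha hd).continuousAt hZ
      have c3 : ContinuousWithinAt (fun s => dualNeg k a (zCoord (γ s))) s t :=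
        ContinuousAt.comp_continuousWithinAt (f := fun s => zCoord (γ s))
          (dualNeg_hasDerivAt (k := k) ha hd).continuousAt hZ
      have c4 := Complex.continuous_conj.continuousAt.comp_continuousWithinAt c3
      exact (c1.div hW hw).mul ((c2.sub c4).add continuousWithinAt_const)
    · filter_upwards [hZ (isOpen_domNeg.mem_nhds hd)] with s hs using h _ hs

lemma integral_phi_piece (hk : Even k) (hk0 : 0 < k) (ha : 1 < a) {γ : ℝ → surface k a}
    {f : surface k a → ℂ} {S : Set ℂ} (hf : IsPotential S f) {b c : ℝ} (hbc : b ≤ c)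
    (h : IsC1On γ b c) (hS : ∀ t ∈ Icc b c, zCoord (γ t) ∈ S) (j : Fin 3) :
    (∫ t in b..c, phiCoeff (γ t) j * deriv (fun s => zCoord (γ s)) t).re =
      potVec f (γ c) j - potVec f (γ b) j := by
  have hint := intervalIntegrable_phi hk hk0 ha hbc h j
  have hre : (∫ t in b..c, phiCoeff (γ t) j * deriv (fun s => zCoord (γ s)) t).re =
      ∫ t in b..c, (phiCoeff (γ t) j * deriv (fun s => zCoord (γ s)) t).re :=
    (Complex.reCLM.intervalIntegral_comp_comm hint).symm
  rw [hre]
  -- At a crossing time only continuity of the potential is needed, so the default value of the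
  -- integrand there is harmless.
  refine integral_eq_of_hasDerivAt_off_countable_of_le (fun t => potVec f (γ t) j) _ hbc
    (countable_crossing γ) ?_ ?_ ?_
  · intro t ht
    have hZ := h.1.continuousOn t ht
    have hc := hf.continuousWithinAt hk hk0 ha ht hZ (h.2.1.continuousOn t ht)
      (h.2.2.continuousOn t ht) (hS t ht)
    fin_cases j
    · exact Complex.continuous_re.continuousAt.comp_continuousWithinAt hc
    · exact (Complex.continuous_im.continuousAt.comp_continuousWithinAt hc).neg
    · exact continuousWithinAt_const.mul
        (hZ.norm.log (norm_ne_zero_iff.2 (zCoord_ne_zero ha (γ t))))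
  · intro t ht
    have dZ := hasDerivAt_of_contDiffOn h.1 ht.1
    have dU := hasDerivAt_of_contDiffOn h.2.1 ht.1
    have dV := hasDerivAt_of_contDiffOn h.2.2 ht.1
    have := potVec_hasDerivAt hk hk0 ha dZ dU dV ht.2
      (hf.hasDerivAt hk hk0 ha dZ dU dV ht.2 (hS t (Ioo_subset_Icc_self ht.1))) j
    rwa [dZ.deriv]
  · exact ⟨hint.1.re, hint.2.re⟩

lemma intervalIntegrable_phi_path (hk : Even k) (hk0 : 0 < k) (ha : 1 < a) {p q : surface k a}
    {γ : Path p q} (hγ : IsPiecewiseC1 γ) (j : Fin 3) :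
    IntervalIntegrable (fun t => phiCoeff (γ.extend t) j *
      deriv (fun s => zCoord (γ.extend s)) t) volume 0 1 := by
  obtain ⟨n, τ, hm, h0, h1, h⟩ := hγ
  have := IntervalIntegrable.trans_iterate (μ := volume) (a := τ) (n := n) fun i hi =>
    intervalIntegrable_phi hk hk0 ha (hm i.le_succ) (h i hi) j
  rwa [h0, h1] at this

/-- The integral of a path over which a potential is given is the difference of its values. -/
theorem reIntegral_eq_sub (hk : Even k) (hk0 : 0 < k) (ha : 1 < a) {p q : surface k a}
    {γ : Path p q} (hγ : IsPiecewiseC1 γ) {f : surface k a → ℂ} {S : Set ℂ}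
    (hf : IsPotential S f) (hS : ∀ t ∈ Icc (0 : ℝ) 1, zCoord (γ.extend t) ∈ S) :
    reIntegral γ = potVec f q - potVec f p := by
  obtain ⟨n, τ, hm, h0, h1, h⟩ := hγ
  funext j
  have hsum := intervalIntegral.sum_integral_adjacent_intervals (μ := volume) (a := τ) (n := n)
    fun i hi => intervalIntegrable_phi hk hk0 ha (hm i.le_succ) (h i hi) j
  rw [h0, h1] at hsum
  rw [reIntegral, ← hsum, Complex.re_sum, Pi.sub_apply]
  have hpiece : ∀ i ∈ Finset.range n, (∫ t in τ i..τ (i + 1), phiCoeff (γ.extend t) j *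
      deriv (fun s => zCoord (γ.extend s)) t).re =
      potVec f (γ.extend (τ (i + 1))) j - potVec f (γ.extend (τ i)) j := by
    intro i hi
    have hi := Finset.mem_range.1 hi
    refine integral_phi_piece hk hk0 ha hf (hm i.le_succ) (h i hi) ?_ j
    intro t ht
    refine hS t ⟨?_, ?_⟩
    · exact (h0 ▸ hm (Nat.zero_le i)).trans ht.1
    · exact ht.2.trans (h1 ▸ hm hi)
  rw [Finset.sum_congr rfl hpiece, Finset.sum_range_sub (fun i => potVec f (γ.extend (τ i)) j),
    h0, h1, γ.extend_zero, γ.extend_one]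

/-! ### The global potential -/

lemma mem_dom_of_ne_zero (ha : 1 < a) {z : ℂ} (hz : z ≠ 0) :
    z ∈ domOne a ∨ z ∈ domPole ∨ z ∈ domNeg := by
  by_cases h : z.im = 0
  · rw [eq_ofReal_of_im_eq_zero h] at hz ⊢
    set x := z.re
    have hx : x ≠ 0 := by exact_mod_cast hz
    rcases hx.lt_or_gt with hx | hx
    · exact Or.inr (Or.inr (ofReal_mem_domNeg hx))
    rcases lt_or_ge x a with hxa | hxa
    · left
      refine ⟨Complex.ofReal_mem_slitPlane.2 hx, ?_⟩
      rw [← Complex.ofReal_sub]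
      exact Complex.ofReal_mem_slitPlane.2 (sub_pos.2 hxa)
    · right; left
      rw [domPole, mem_ofPred_eq, ← Complex.ofReal_one, ← Complex.ofReal_sub]
      exact Complex.ofReal_mem_slitPlane.2 (by linarith)
  · exact Or.inl (domMid_subset_domOne (mem_domMid_of_im h))

lemma im_ne_zero_of_mem {z : ℂ} (h : z ∈ Complex.slitPlane) (h' : z ∈ domNeg) : z.im ≠ 0 := by
  rw [domNeg, mem_ofPred_eq, Complex.mem_slitPlane_iff] at h'
  rw [Complex.mem_slitPlane_iff] at h
  simp only [Complex.neg_re, Complex.neg_im, ne_eq, neg_eq_zero] at h'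
  rcases h with h | h
  · rcases h' with h' | h'
    · linarith
    · exact h'
  · exact h

open Classical in
/-- The function `∫ η - conj ∫ g ^ 2 η` on the whole surface. -/
noncomputable def globalPot (k : ℕ) (a : ℝ) (p : surface k a) : ℂ :=
  if zCoord p ∈ domOne a then potOne k a (zCoord p) (uCoord p)
  else if zCoord p ∈ domPole then potPole k a (zCoord p) (vCoord p)
  else potNeg k a (closeConst k a).re (zCoord p) (wCoord p)

lemma isPotential_globalPot (hk : Even k) (hk0 : 0 < k) (ha : 1 < a)
    (hc : (closeConst k a).im = 0) : IsPotential {z : ℂ | z ≠ 0} (globalPot k a) := by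
  have h1 : ∀ p : surface k a, zCoord p ∈ domOne a →
      globalPot k a p = potOne k a (zCoord p) (uCoord p) := fun p hp => if_pos hp
  have h2 : ∀ p : surface k a, zCoord p ∈ domPole →
      globalPot k a p = potPole k a (zCoord p) (vCoord p) := by
    intro p hp
    by_cases hp1 : zCoord p ∈ domOne a
    · rw [h1 p hp1]
      exact potOne_eq_potPole hk hk0 ha ⟨hp, hp1.2⟩
        (branchEq_coord (sub_ne_zero.1 (sub_ne_zero_of_mem_domOne hp1)))
    · rw [globalPot, if_neg hp1, if_pos hp]
  have h3 : ∀ p : surface k a, zCoord p ∈ domNeg →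
      globalPot k a p = potNeg k a (closeConst k a).re (zCoord p) (wCoord p) := by
    intro p hp
    have hb := branchEq_coord (ne_pole_of_mem_domNeg ha hp)
    by_cases hp1 : zCoord p ∈ domOne a
    · rw [h1 p hp1]
      exact potOne_eq_potNeg hk hk0 ha hc (im_ne_zero_of_mem hp1.1 hp) hb
    · have hp2 : zCoord p ∉ domPole := fun hp2 => hp1 (domMid_subset_domOne
        (mem_domMid_of_im (im_ne_zero_of_mem (domPole_subset_slitPlane hp2) hp)))
      rw [globalPot, if_neg hp1, if_neg hp2]
  intro z hz
  rcases mem_dom_of_ne_zero ha hz with h | h | h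
  · exact Or.inl ⟨h, h1⟩
  · exact Or.inr (Or.inl ⟨h, h2⟩)
  · exact Or.inr (Or.inr ⟨h, _, h3⟩)

/-- The closing condition implies the period condition. -/
theorem periodCondition_of_closeConst (hk : Even k) (hk0 : 0 < k) (ha : 1 < a)
    (hc : (closeConst k a).im = 0) : PeriodCondition k a := by
  intro p γ hγ
  rw [reIntegral_eq_sub hk hk0 ha hγ (isPotential_globalPot hk hk0 ha hc)
    (fun t _ => zCoord_ne_zero ha _), sub_self]

/-! ### Reversal and concatenation of paths; periods and path independence -/

lemma IsC1On.comp_affine {γ δ : ℝ → surface k a} {b c b' c' m d : ℝ} (h : IsC1On γ b c)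
    (hm : MapsTo (fun t => m * t + d) (Icc b' c') (Icc b c))
    (hδ : ∀ t ∈ Icc b' c', δ t = γ (m * t + d)) : IsC1On δ b' c' := by
  have haff : ContDiffOn ℝ 1 (fun t : ℝ => m * t + d) (Icc b' c') := by fun_prop
  refine ⟨(h.1.comp haff hm).congr fun t ht => ?_, (h.2.1.comp haff hm).congr fun t ht => ?_,
    (h.2.2.comp haff hm).congr fun t ht => ?_⟩ <;> simp [hδ t ht]

lemma isPiecewiseC1_symm {p q : surface k a} {γ : Path p q} (hγ : IsPiecewiseC1 γ) :
    IsPiecewiseC1 γ.symm := by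
  obtain ⟨n, τ, hm, h0, h1, h⟩ := hγ
  refine ⟨n, fun i => 1 - τ (n - i), ?_, by simp [h1], by simp [h0], fun i hi => ?_⟩
  · intro i j hij
    exact sub_le_sub_left (hm (Nat.sub_le_sub_left hij n)) 1
  · have hc : IsC1On γ.extend (τ (n - (i + 1))) (τ (n - (i + 1) + 1)) := h _ (by omega)
    have hni : n - (i + 1) + 1 = n - i := by omega
    rw [hni] at hc
    refine hc.comp_affine (m := -1) (d := 1) ?_ ?_
    · intro t ht
      constructor <;> linarith [ht.1, ht.2]
    · intro t _
      rw [γ.extend_symm_apply]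
      congr 1
      ring

lemma isPiecewiseC1_trans {p q r : surface k a} {γ : Path p q} {δ : Path q r}
    (hγ : IsPiecewiseC1 γ) (hδ : IsPiecewiseC1 δ) : IsPiecewiseC1 (γ.trans δ) := by
  obtain ⟨n, τ, hm, h0, h1, h⟩ := hγ
  obtain ⟨n', τ', hm', h0', h1', h'⟩ := hδ
  -- Each partition is compressed to one half of [0, 1]; at i = n both formulas give 1/2.
  set T : ℕ → ℝ := fun i => if i ≤ n then τ i / 2 else 1 / 2 + τ' (i - n) / 2 with hT
  have hT1 : ∀ i ≤ n, T i = τ i / 2 := fun i hi => if_pos hi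
  have hT2 : ∀ i, n ≤ i → T i = 1 / 2 + τ' (i - n) / 2 := by
    intro i hi
    rcases hi.eq_or_lt with rfl | hi
    · rw [hT1 _ le_rfl, h1, Nat.sub_self, h0']; norm_num
    · exact if_neg (not_le.2 hi)
  have hτ : ∀ i ≤ n, τ i ≤ 1 := fun i hi => h1 ▸ hm hi
  have hτ' : ∀ i, 0 ≤ τ' i := fun i => h0' ▸ hm' (Nat.zero_le i)
  refine ⟨n + n', T, ?_, by rw [hT1 0 (Nat.zero_le n), h0, zero_div], ?_, fun i hi => ?_⟩
  · intro i j hij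
    rcases le_total j n with hj | hj
    · rw [hT1 i (hij.trans hj), hT1 j hj]
      linarith [hm hij]
    · rw [hT2 j hj]
      rcases le_total i n with hi | hi
      · rw [hT1 i hi]
        linarith [hτ i hi, hτ' (j - n)]
      · rw [hT2 i hi]
        linarith [hm' (Nat.sub_le_sub_right hij n)]
  · rw [hT2 _ (Nat.le_add_right n n'), Nat.add_sub_cancel_left, h1']
    norm_num
  · rcases lt_or_ge i n with hin | hin
    · rw [hT1 i hin.le, hT1 (i + 1) hin]
      refine IsC1On.comp_affine (m := 2) (d := 0) (show IsC1On _ _ _ from h i hin) ?_ ?_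
      · intro t ht
        constructor <;> linarith [ht.1, ht.2]
      · intro t ht
        rw [γ.extend_trans_of_le_half δ (by linarith [ht.2, hτ (i + 1) hin]), add_zero]
    · rw [hT2 i hin, hT2 (i + 1) (by omega)]
      have e : i + 1 - n = i - n + 1 := by omega
      rw [e]
      refine IsC1On.comp_affine (m := 2) (d := -1)
        (show IsC1On _ _ _ from h' (i - n) (by omega)) ?_ ?_
      · intro t ht
        constructor <;> linarith [ht.1, ht.2]
      · intro t ht
        rw [γ.extend_trans_of_half_le δ (by linarith [ht.1, hτ' (i - n)]), sub_eq_add_neg]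

lemma reIntegral_symm {p q : surface k a} (γ : Path p q) : reIntegral γ.symm = -reIntegral γ := by
  funext j
  have h1 : ∀ t : ℝ, phiCoeff (γ.symm.extend t) j *
      deriv (fun s => zCoord (γ.symm.extend s)) t =
      -(phiCoeff (γ.extend (1 - t)) j * deriv (fun s => zCoord (γ.extend s)) (1 - t)) := by
    intro t
    simp only [γ.extend_symm_apply]
    rw [deriv_comp_const_sub (f := fun s => zCoord (γ.extend s))]
    ring
  simp only [reIntegral, h1, Pi.neg_apply]
  rw [intervalIntegral.integral_neg, intervalIntegral.integral_comp_sub_left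
    (fun t => phiCoeff (γ.extend t) j * deriv (fun s => zCoord (γ.extend s)) t) 1]
  simp

lemma integral_phi_comp_affine {γ δ : ℝ → surface k a} {b c d : ℝ} (hbc : b ≤ c)
    (h : ∀ t ∈ Ioo b c, δ t = γ (2 * t + d)) (j : Fin 3) :
    ∫ t in b..c, phiCoeff (δ t) j * deriv (fun s => zCoord (δ s)) t =
      ∫ t in (2 * b + d)..(2 * c + d), phiCoeff (γ t) j * deriv (fun s => zCoord (γ s)) t := by
  rw [← intervalIntegral.smul_integral_comp_mul_add
    (fun t => phiCoeff (γ t) j * deriv (fun s => zCoord (γ s)) t), ← intervalIntegral.integral_smul]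
  refine intervalIntegral.integral_congr_ae_restrict ?_
  rw [uIoc_of_le hbc]
  filter_upwards [ae_mem_Ioo_diff (b := b) (c := c) countable_empty] with t ht
  have hev : (fun s => zCoord (δ s)) =ᶠ[𝓝 t] fun s => zCoord (γ (2 * s + d)) := by
    filter_upwards [Ioo_mem_nhds ht.1.1 ht.1.2] with s hs
    rw [h s hs]
  rw [hev.deriv_eq, h t ht.1, deriv_comp_mul_left 2 (fun s => zCoord (γ (s + d))),
    deriv_comp_add_const (f := fun s => zCoord (γ s))]
  simp only [Complex.real_smul]
  ring

lemma reIntegral_trans (hk : Even k) (hk0 : 0 < k) (ha : 1 < a) {p q r : surface k a}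
    {γ : Path p q} {δ : Path q r} (hγ : IsPiecewiseC1 γ) (hδ : IsPiecewiseC1 δ) :
    reIntegral (γ.trans δ) = reIntegral γ + reIntegral δ := by
  funext j
  have hint := intervalIntegrable_phi_path hk hk0 ha (isPiecewiseC1_trans hγ hδ) j
  have hhalf : (1 / 2 : ℝ) ∈ uIcc (0 : ℝ) 1 := by
    rw [uIcc_of_le zero_le_one]; constructor <;> norm_num
  have hsplit := intervalIntegral.integral_add_adjacent_intervals
    (hint.mono_set (uIcc_subset_uIcc_left hhalf)) (hint.mono_set (uIcc_subset_uIcc_right hhalf))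
  have h1 := integral_phi_comp_affine (γ := γ.extend) (δ := (γ.trans δ).extend) (b := 0)
    (c := 1 / 2) (d := 0) (by norm_num)
    (fun t ht => by rw [γ.extend_trans_of_le_half δ ht.2.le, add_zero]) j
  have h2 := integral_phi_comp_affine (γ := δ.extend) (δ := (γ.trans δ).extend) (b := 1 / 2)
    (c := 1) (d := -1) (by norm_num)
    (fun t ht => by rw [γ.extend_trans_of_half_le δ ht.1.le, sub_eq_add_neg]) j
  norm_num at h1 h2 hsplit
  simp only [reIntegral, Pi.add_apply]
  rw [← hsplit, h1, h2, Complex.add_re]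

lemma isPiecewiseC1_refl (p : surface k a) : IsPiecewiseC1 (Path.refl p) := by
  refine ⟨1, fun i => i, Nat.mono_cast, by simp, by simp, fun i _ => ?_⟩
  simp only [Path.refl_extend, ContinuousMap.const_apply]
  exact ⟨contDiffOn_const, contDiffOn_const, contDiffOn_const⟩

lemma reIntegral_refl (p : surface k a) : reIntegral (Path.refl p) = 0 := by
  funext j
  simp [reIntegral, Path.refl_extend]

/-- The period condition says that the integral does not depend on the path. -/
theorem periodCondition_iff_isWellDefined (hk : Even k) (hk0 : 0 < k) (ha : 1 < a) :
    PeriodCondition k a ↔ IsWellDefined k a := by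
  classical
  constructor
  · intro h p₀
    -- The default 0 for points not joined to p₀ makes a proof that M is connected unnecessary.
    refine ⟨fun p => if h : ∃ γ : Path p₀ p, IsPiecewiseC1 γ then reIntegral h.choose else 0, ?_⟩
    intro p γ hγ
    have hex : ∃ γ : Path p₀ p, IsPiecewiseC1 γ := ⟨γ, hγ⟩
    simp only [dif_pos hex]
    have h1 := h p₀ _ (isPiecewiseC1_trans hex.choose_spec (isPiecewiseC1_symm hγ))
    rw [reIntegral_trans hk hk0 ha hex.choose_spec (isPiecewiseC1_symm hγ), reIntegral_symm] at h1
    rwa [← sub_eq_add_neg, sub_eq_zero] at h1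
  · intro h p γ hγ
    obtain ⟨f, hf⟩ := h p
    -- A loop has the same end point as the constant path, whose integral is 0.
    rw [← hf p γ hγ, hf p _ (isPiecewiseC1_refl p), reIntegral_refl]

/-! ### Test paths and necessity of the closing condition -/

/-- The point of the surface with the finite coordinates `z` and `w`. -/
noncomputable def mkPoint (z w : ℂ) (hz0 : z ≠ 0) (hza : z ≠ a) (hw : BranchEq k a z w) :
    surface k a :=
  ⟨((z : OnePoint ℂ), (w : OnePoint ℂ)), by
    refine ⟨Or.inl ⟨z, w, rfl, hza, ?_⟩, ?_⟩
    · have e2 := sub_ne_zero.2 hza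
      rw [BranchEq] at hw
      rw [div_pow]
      field_simp
      linear_combination hw
    · simp [hz0]⟩

/-- The path may pass through (1, 0), where W vanishes. Hence the quotient giving u is assumed to be
C¹ separately. -/
lemma exists_path {Z W : ℝ → ℂ} (hZ : ContDiffOn ℝ 1 Z (Icc 0 1)) (hW : ContinuousOn W (Icc 0 1))
    (hU : ContDiffOn ℝ 1 (fun t => (Z t - 1) / W t) (Icc 0 1))
    (hV : ContDiffOn ℝ 1 (fun t => (Z t - a) * W t) (Icc 0 1))
    (hz0 : ∀ t ∈ Icc (0 : ℝ) 1, Z t ≠ 0) (hza : ∀ t ∈ Icc (0 : ℝ) 1, Z t ≠ a)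
    (hB : ∀ t ∈ Icc (0 : ℝ) 1, BranchEq k a (Z t) (W t)) {p q : surface k a}
    (hp : p.1 = ((Z 0 : OnePoint ℂ), (W 0 : OnePoint ℂ)))
    (hq : q.1 = ((Z 1 : OnePoint ℂ), (W 1 : OnePoint ℂ))) :
    ∃ γ : Path p q, IsPiecewiseC1 γ ∧ ∀ t ∈ Icc (0 : ℝ) 1, zCoord (γ.extend t) = Z t := by
  let γ : Path p q :=
    { toFun := fun t => mkPoint (Z t) (W t) (hz0 t t.2) (hza t t.2) (hB t t.2)
      continuous_toFun := by
        refine Continuous.subtype_mk (Continuous.prodMk ?_ ?_) _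
        · exact OnePoint.continuous_coe.comp
            (continuousOn_iff_continuous_domRestrict.1 hZ.continuousOn)
        · exact OnePoint.continuous_coe.comp (continuousOn_iff_continuous_domRestrict.1 hW)
      source' := Subtype.ext hp.symm
      target' := Subtype.ext hq.symm }
  have hγ : ∀ t, ∀ ht : t ∈ Icc (0 : ℝ) 1,
      γ.extend t = mkPoint (Z t) (W t) (hz0 t ht) (hza t ht) (hB t ht) := fun t ht =>
    γ.extend_apply ht
  have h1 : ∀ t ∈ Icc (0 : ℝ) 1, zCoord (γ.extend t) = Z t := fun t ht => by rw [hγ t ht]; rfl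
  have h2 : ∀ t ∈ Icc (0 : ℝ) 1, wCoord (γ.extend t) = W t := fun t ht => by rw [hγ t ht]; rfl
  refine ⟨γ, ⟨1, fun i => i, Nat.mono_cast, by simp, by simp, fun i hi => ?_⟩, h1⟩
  obtain rfl : i = 0 := by omega
  simp only [Nat.cast_zero, zero_add, Nat.cast_one]
  refine ⟨hZ.congr h1, hU.congr fun t ht => ?_, hV.congr fun t ht => ?_⟩
  · rw [uCoord, h1 t ht, h2 t ht]
  · rw [vCoord, h1 t ht, h2 t ht]

lemma contDiffOn_div {f g : ℝ → ℂ} {T : Set ℝ} (hf : ContDiffOn ℝ 1 f T)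
    (hg : ContDiffOn ℝ 1 g T) (h0 : ∀ t ∈ T, g t ≠ 0) : ContDiffOn ℝ 1 (fun t => f t / g t) T := by
  simp only [div_eq_mul_inv]
  exact hf.mul (hg.inv h0)

lemma contDiffOn_comp_of_differentiableOn {S : Set ℂ} (hS : IsOpen S) {f : ℂ → ℂ}
    (hf : ∀ z ∈ S, DifferentiableAt ℂ f z) {Z : ℝ → ℂ} {T : Set ℝ} (hZ : ContDiffOn ℝ 1 Z T)
    (h : MapsTo Z T S) : ContDiffOn ℝ 1 (fun t => f (Z t)) T := by
  have h1 : ContDiffOn ℂ 1 f S :=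
    DifferentiableOn.contDiffOn (fun z hz => (hf z hz).differentiableWithinAt) hS
  exact (h1.restrict_scalars ℝ).comp hZ h

lemma mem_Icc_of_starConvex {S : Set ℂ} {x y : ℂ} (hS : StarConvex ℝ x S) (hy : y ∈ S) {s : ℝ}
    (hs : s ∈ Icc (0 : ℝ) 1) : x + s * (y - x) ∈ S := by
  have := hS.add_smul_sub_mem hy hs.1 hs.2
  rwa [Complex.real_smul] at this

lemma starConvex_domNeg {x : ℝ} (hx : x < 0) : StarConvex ℝ (x : ℂ) domNeg := by
  have := starConvex_preimage_const_sub hx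
  simpa [domNeg] using this

/-- The point of the surface on the branch `wNeg`. -/
noncomputable def negPoint (hk : Even k) (ha : 1 < a) (z : ℂ) (hz : z ∈ domNeg) : surface k a :=
  mkPoint z (wNeg k a z) (ne_zero_of_mem_domNeg hz) (ne_pole_of_mem_domNeg ha hz)
    (wNeg_pow hk ha hz)

/-- The point `(1, 0)` of the surface. -/
noncomputable def onePoint (hk0 : 0 < k) (ha : 1 < a) : surface k a :=
  mkPoint 1 0 one_ne_zero (by exact_mod_cast ha.ne) (by simp [BranchEq, hk0.ne'])

lemma exists_path_negPoint (hk : Even k) (ha : 1 < a) {x : ℝ} (hx : x < 0) {y : ℂ}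
    (hy : y ∈ domNeg) :
    ∃ γ : Path (negPoint hk ha x (ofReal_mem_domNeg hx)) (negPoint hk ha y hy),
      IsPiecewiseC1 γ ∧ ∀ t ∈ Icc (0 : ℝ) 1, zCoord (γ.extend t) ∈ domNeg := by
  set Z : ℝ → ℂ := fun s => x + s * (y - x) with hZdef
  have hm : MapsTo Z (Icc 0 1) domNeg := fun s hs =>
    mem_Icc_of_starConvex (starConvex_domNeg hx) hy hs
  have hZ : ContDiffOn ℝ 1 Z (Icc 0 1) :=
    (contDiff_const.add (Complex.ofRealCLM.contDiff.mul contDiff_const)).contDiffOn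
  have hW : ContDiffOn ℝ 1 (fun s => wNeg k a (Z s)) (Icc 0 1) :=
    contDiffOn_comp_of_differentiableOn isOpen_domNeg (fun z hz => wNeg_differentiableAt ha hz)
      hZ hm
  obtain ⟨γ, h1, h2⟩ := exists_path (k := k) (a := a) hZ hW.continuousOn
    (contDiffOn_div (hZ.sub contDiffOn_const) hW fun s hs => wNeg_ne_zero ha (hm hs))
    ((hZ.sub contDiffOn_const).mul hW) (fun s hs => ne_zero_of_mem_domNeg (hm hs))
    (fun s hs => ne_pole_of_mem_domNeg ha (hm hs)) (fun s hs => wNeg_pow hk ha (hm hs))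
    (p := negPoint hk ha x (ofReal_mem_domNeg hx)) (q := negPoint hk ha y hy)
    (by simp [negPoint, mkPoint, hZdef]) (by simp [negPoint, mkPoint, hZdef])
  exact ⟨γ, h1, fun t ht => by rw [h2 t ht]; exact hm ht⟩

lemma exists_path_onePoint (hk : Even k) (hk0 : 0 < k) (ha : 1 < a) {y : ℂ} (hy : y ∈ domNeg)
    (hy1 : y ∈ domOne a) :
    ∃ γ : Path (onePoint hk0 ha) (negPoint hk ha y hy),
      IsPiecewiseC1 γ ∧ ∀ t ∈ Icc (0 : ℝ) 1, zCoord (γ.extend t) ∈ domOne a := by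
  have hw0 := wNeg_ne_zero (k := k) ha hy
  have hN := unitFactor_ne_zero (k := k) hy1
  have h0 := ne_zero_of_mem_domNeg hy
  have h1 := sub_ne_zero.2 (ne_one_of_mem_domNeg hy)
  have h2 := sub_ne_zero.2 (ne_pole_of_mem_domNeg ha hy)
  -- This root σ of y − 1 is u/N at the end point, which selects the sheet `wNeg` there.
  set σ : ℂ := (y - 1) / wNeg k a y / unitFactor k a y with hσdef
  have hσ0 : σ ≠ 0 := div_ne_zero (div_ne_zero h1 hw0) hN
  have hσ : σ ^ (k + 1) = y - 1 := by
    have e := wNeg_pow hk ha hy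
    change wNeg k a y ^ (k + 1) * (y - a) ^ k = y ^ 2 * (y - 1) ^ k at e
    have e' := pow_ne_zero k h2
    rw [hσdef, div_pow, div_pow, unitFactor_pow hk]
    field_simp
    linear_combination (y - 1) * (-e)
  have hσw : σ ^ k / unitFactor k a y = wNeg k a y := by
    have : σ ^ k = (y - 1) / σ := by rw [← hσ, pow_succ, mul_div_cancel_right₀ _ hσ0]
    rw [this, hσdef]
    field_simp
  -- Moving z − 1 like s^(k+1) makes u = σsN, so the path leaves the branch point as a C¹ path of
  -- the surface.
  set Z : ℝ → ℂ := fun s => 1 + (s : ℂ) ^ (k + 1) * (y - 1) with hZdef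
  set N : ℝ → ℂ := fun s => unitFactor k a (Z s) with hNdef
  set W : ℝ → ℂ := fun s => (σ * s) ^ k / N s with hWdef
  have hm : MapsTo Z (Icc 0 1) (domOne a) := by
    intro s hs
    have := mem_Icc_of_starConvex (starConvex_domOne ha) hy1
      (s := s ^ (k + 1)) ⟨pow_nonneg hs.1 _, pow_le_one₀ hs.1 hs.2⟩
    rwa [Complex.ofReal_pow] at this
  have hid : ContDiffOn ℝ 1 (fun s : ℝ => (s : ℂ)) (Icc 0 1) :=
    Complex.ofRealCLM.contDiff.contDiffOn
  have hZ : ContDiffOn ℝ 1 Z (Icc 0 1) := contDiffOn_const.add ((hid.pow _).mul contDiffOn_const)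
  have hNd : ContDiffOn ℝ 1 N (Icc 0 1) :=
    contDiffOn_comp_of_differentiableOn (isOpen_domOne a)
      (fun z hz => (hasDerivAt_unitFactor hk0 hz).differentiableAt) hZ hm
  have hN0 : ∀ s ∈ Icc (0 : ℝ) 1, N s ≠ 0 := fun s hs => unitFactor_ne_zero (hm hs)
  have hW : ContDiffOn ℝ 1 W (Icc 0 1) := contDiffOn_div ((contDiffOn_const.mul hid).pow k) hNd hN0
  have hσs : ∀ s : ℝ, Z s - 1 = (σ * s) ^ (k + 1) := by
    intro s
    rw [mul_pow, hσ, hZdef]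
    ring
  have hU : ContDiffOn ℝ 1 (fun s => (Z s - 1) / W s) (Icc 0 1) := by
    refine ((contDiffOn_const (c := σ)).mul hid |>.mul hNd).congr fun s hs => ?_
    have := hN0 s hs
    rw [hσs, hWdef]
    -- At s = 0 the quotient is 0/0 = 0, which agrees with σsN.
    rcases eq_or_ne (σ * s) 0 with h | h
    · simp [h]
    · field_simp
      exact pow_succ' _ _
  have hB : ∀ s ∈ Icc (0 : ℝ) 1, BranchEq k a (Z s) (W s) := by
    intro s hs
    have e1 := ne_zero_of_mem_domOne (hm hs)
    have e2 := pow_ne_zero k (sub_ne_zero_of_mem_domOne (hm hs))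
    rw [BranchEq, hσs]
    simp only [hWdef, hNdef]
    rw [div_pow, unitFactor_pow hk, ← pow_mul, ← pow_mul, mul_comm k]
    field_simp
  obtain ⟨γ, h1, h2⟩ := exists_path (k := k) (a := a) hZ hW.continuousOn hU
    ((hZ.sub contDiffOn_const).mul hW) (fun s hs => ne_zero_of_mem_domOne (hm hs))
    (fun s hs => sub_ne_zero.1 (sub_ne_zero_of_mem_domOne (hm hs))) hB
    (p := onePoint hk0 ha) (q := negPoint hk ha y hy)
    (by simp [onePoint, mkPoint, hZdef, hWdef, hk0.ne'])
    (by simp [negPoint, mkPoint, hZdef, hWdef, hNdef, hσw])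
  exact ⟨γ, h1, fun t ht => by rw [h2 t ht]; exact hm ht⟩

/-- Go from (1, 0) to y with `potOne` and on to x with `potNeg`; the two normalizations differ by C
at y. The component with index 1 is minus the imaginary part, so it records −Im C plus a term
independent of y. -/
lemma exists_path_onePoint_negPoint (hk : Even k) (hk0 : 0 < k) (ha : 1 < a) {x : ℝ} (hx : x < 0)
    {y : ℂ} (hy : y.im ≠ 0) {C : ℂ} (hC : potOne k a y (uNeg k a y) =
      etaNeg k a y - starRingEnd ℂ (dualNeg k a y) + C) :
    ∃ γ : Path (onePoint hk0 ha) (negPoint hk ha x (ofReal_mem_domNeg hx)),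
      IsPiecewiseC1 γ ∧
        reIntegral γ 1 = -C.im - (etaNeg k a x - starRingEnd ℂ (dualNeg k a x)).im := by
  have hyn := mem_domNeg_of_im hy
  have hyo : y ∈ domOne a := domMid_subset_domOne (mem_domMid_of_im hy)
  obtain ⟨γ, hγ, hγd⟩ := exists_path_onePoint hk hk0 ha hyn hyo
  obtain ⟨δ, hδ, hδd⟩ := exists_path_negPoint hk ha hx hyn
  refine ⟨γ.trans δ.symm, isPiecewiseC1_trans hγ (isPiecewiseC1_symm hδ), ?_⟩
  have e1 := congrFun (reIntegral_eq_sub hk hk0 ha hγ (S := domOne a)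
    (f := fun p => potOne k a (zCoord p) (uCoord p)) (fun z hz => Or.inl ⟨hz, fun p _ => rfl⟩)
    hγd) 1
  have e2 := congrFun (reIntegral_eq_sub hk hk0 ha hδ (S := domNeg)
    (f := fun p => potNeg k a 0 (zCoord p) (wCoord p))
    (fun z hz => Or.inr (Or.inr ⟨hz, 0, fun p _ => by simp⟩)) hδd) 1
  rw [reIntegral_trans hk hk0 ha hγ (isPiecewiseC1_symm hδ), reIntegral_symm, Pi.add_apply,
    Pi.neg_apply, e1, e2]
  have z1 : zCoord (negPoint hk ha y hyn) = y := rfl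
  have w1 : wCoord (negPoint hk ha y hyn) = wNeg k a y := rfl
  have u1 : uCoord (negPoint hk ha y hyn) = uNeg k a y := rfl
  have z2 : zCoord (negPoint hk ha x (ofReal_mem_domNeg hx)) = x := rfl
  have w2 : wCoord (negPoint hk ha x (ofReal_mem_domNeg hx)) = wNeg k a x := rfl
  have u3 : uCoord (onePoint hk0 ha) = 0 := uCoord_one rfl
  have h1 := wNeg_ne_zero (k := k) ha hyn
  have h2 := wNeg_ne_zero (k := k) ha (ofReal_mem_domNeg hx)
  simp only [potVec, Pi.sub_apply, Matrix.cons_val_one, Matrix.cons_val_zero, z1, w1, u1, z2, w2,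
    u3, hC, potNeg, div_self h1, div_self h2]
  simp [potOne, etaPrim, dualPrim]
  ring

/-- Path independence implies the closing condition. -/
theorem closeConst_im_eq_zero_of_isWellDefined (hk : Even k) (hk0 : 0 < k) (ha : 1 < a)
    (h : IsWellDefined k a) : (closeConst k a).im = 0 := by
  obtain ⟨f, hf⟩ := h (onePoint hk0 ha)
  -- Paths through i and through −i to the same point over −1 see C and conj C; equality of their
  -- integrals gives −Im C = Im C.
  obtain ⟨γ, hγ, e1⟩ := exists_path_onePoint_negPoint hk hk0 ha (x := -1) (by norm_num)
    (y := Complex.I) (by simp) (potOne_uNeg_of_im_pos hk hk0 ha (by simp))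
  obtain ⟨δ, hδ, e2⟩ := exists_path_onePoint_negPoint hk hk0 ha (x := -1) (by norm_num)
    (y := -Complex.I) (by simp) (potOne_uNeg_of_im_neg hk hk0 ha (by simp))
  rw [← hf _ γ hγ] at e1
  rw [← hf _ δ hδ, Complex.conj_im] at e2
  linarith

theorem periodCondition_iff_closeConst (hk : Even k) (hk0 : 0 < k) (ha : 1 < a) :
    PeriodCondition k a ↔ (closeConst k a).im = 0 :=
  ⟨fun h => closeConst_im_eq_zero_of_isWellDefined hk hk0 ha
    ((periodCondition_iff_isWellDefined hk hk0 ha).1 h), periodCondition_of_closeConst hk hk0 ha⟩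

theorem existsUnique_periodCondition (hk : Even k) (hk0 : 0 < k) :
    ∃! a : ℝ, 1 < a ∧ PeriodCondition k a := by
  -- For k ≥ 2 the angle 2π/(k + 1) is less than π, so the second sine is positive too.
  have hk2 : (2 : ℝ) ≤ k := by
    obtain ⟨m, rfl⟩ := hk
    exact_mod_cast (by omega : 2 ≤ m + m)
  have hpi := Real.pi_pos
  have hp : 0 < Real.sin (Real.pi / (k + 1)) :=
    Real.sin_pos_of_pos_of_lt_pi (by positivity) (by rw [div_lt_iff₀ (by positivity)]; nlinarith)
  have hq : 0 < 2 * Real.sin (2 * Real.pi / (k + 1)) :=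
    mul_pos two_pos (Real.sin_pos_of_pos_of_lt_pi (by positivity)
      (by rw [div_lt_iff₀ (by positivity)]; nlinarith))
  refine (existsUnique_congr fun a => ?_).1 (existsUnique_closing k hp hq)
  refine and_congr_right fun ha => ?_
  rw [periodCondition_iff_closeConst hk hk0 ha, closeConst_im, neg_add_eq_zero]

end EvenGenus

theorem mainTheorem3 (k : ℕ) (hk : Even k) (hk0 : 0 < k) :
    (∃! a : ℝ, 1 < a ∧ EvenGenus.PeriodCondition k a) ∧
      ∀ a : ℝ, 1 < a → (EvenGenus.PeriodCondition k a ↔ EvenGenus.IsWellDefined k a) :=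
  ⟨EvenGenus.existsUnique_periodCondition hk hk0,
    fun _ ha => EvenGenus.periodCondition_iff_isWellDefined hk hk0 ha⟩
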